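/- Let $\Psi(\sigma,\tau)=(\sigma^2\tau^2-1:\sigma\tau^2-1:\sigma^2\tau-1:\sigma\tau-1:\tau-1:\sigma-1)$, let $\mathrm{dP}_5\subset\mathbb P^5$ be the closure of its image (the quintic del Pezzo surface), and let $C_\varphi\subset \mathrm{dP}_5$, $\varphi\in\mathbb P^1$, be the Wiman pencil $G_z+\varphi H_z=0$, where $G_z,H_z$ are the quadratic forms on $\mathbb P^5$ with $$G_z\circ\Psi=3\sigma^2\tau^2-\tfrac12\sigma\tau(1+\sigma)(1+\tau)(1+\sigma\tau)+(1-\sigma+\sigma^2)(1-\tau+\tau^2)(1-\sigma\tau+\sigma^2\tau^2),$$ $$H_z\circ\Psi=\sigma\tau(1-\sigma)(1-\tau)(1-\sigma\tau),$$ namely $$G_z=\tfrac12\big(2z_0^2-2z_0z_1-2z_0z_2-2z_0z_3+z_0z_4+z_0z_5+2z_1^2+z_1z_2-2z_1z_3-2z_1z_4+2z_2^2-2z_2z_3-2z_2z_5+6z_3^2-2z_3z_4-2z_3z_5+2z_4^2+z_4z_5+2z_5^2\big),$$ $$H_z=\tfrac13\big(-2z_0z_3+z_0z_4+z_0z_5-z_1z_2+2z_1z_3+2z_2z_3-2z_3z_4-2z_3z_5+z_4z_5\big).$$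 The parameter $\varphi$ is related to the Dwork quintic $\mathcal M_\psi:\ \sum_j x_j^5-5\psi\, x_1x_2x_3x_4x_5=0$ in $\mathbb P^4$ by $\varphi^2=32/\psi^5-3/4$; thus $\psi=0$ corresponds to $\varphi=\infty$, that is, to $C_\infty:\ H_z=0$. Consider the lines in $\mathbb P^4$ $$\big(\alpha(\sigma,\tau)u,\ \alpha(\tau,\sigma)v,\ -\tau^{4/5}\beta(\sigma)(\sigma u+v),\ \beta(\sigma\tau)(\sigma u+\tau v),\ -\sigma^{4/5}\beta(\tau)(u+\tau v)\big),$$ $$\alpha(\sigma,\tau)^5=\sigma^4(1-\sigma)(1-\tau)(1-\sigma\tau)\big[1-\tau(1+\sigma)+\tau^2(1-\sigma+\sigma^2)\big],\qquad \beta(\sigma)^5=(1-\sigma)(1-\sigma+\sigma^2).$$ The fifth powers of their Plücker coordinates $\pi_{ij}$ ($1\le i,j\le 5$, $\pi_{ji}=-\pi_{ij}$) define, up to a common factor, a rational map $g$ from $\mathrm{dP}_5$ to projective space; write $(g_{ij})$ for its coordinates. Let $\widetilde C_\infty\to C_\infty$ be the closure of the set of pairs $(z,l)$, where $z\in C_\infty$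 is a point at which $g$ is defined and $l$ is a line in $\mathbb P^4$ such that $(\pi_{ij}(l)^5)$ is proportional to $(g_{ij}(z))$. For $i\ne j$ let $E_{ij}=E_{ji}\subset\mathbb P^5$ be the line $E_{12}:(2a+2b,a+2b,2a+b,a+b,b,a)$, $E_{13}:(a,b,0,0,0,0)$, $E_{14}:(0,0,a,0,0,b)$, $E_{15}:(a,a,a,a,b,a)$, $E_{23}:(a,a,a,a,a,b)$, $E_{24}:(0,a,0,0,b,0)$, $E_{25}:(a,0,b,0,0,0)$, $E_{34}:(a,b,a,b,0,b)$, $E_{35}:(0,b,a,0,b,a)$, $E_{45}:(a,a,b,b,b,0)$. For $i\neq j$, with $\{k,l,m\}$ the other three labels, let $X_{ij}\to E_{ij}$ be the cover given by the two polynomials $T^5-g_{ik}/g_{im}$ and $U^5-g_{il}/g_{im}$, that is, the closure in $E_{ij}\times\mathbb P^2$ of the set of pairs $(z,w)$ with $g$ defined at $z$ and $(w_k^5:w_l^5:w_m^5)=(g_{ik}:g_{il}:g_{im})(z)$. For a fifth root of unity $\zeta$, let $v_{ij,\zeta}\in\mathbb P^4$ be the point with $x_i=1$, $x_j=-\zeta$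 and all other coordinates $0$. Then: 1. $\mathrm{dP}_5$ contains exactly ten lines, the lines $E_{ij}$, and $C_\infty$ is their union. 2. For each of the ten lines $E_{ij}$, the curve $X_{ij}$ is isomorphic to the Fermat curve $x^5+y^5+z^5=0$ in $\mathbb P^2$. It maps onto $E_{ij}$, and has exactly $25$ points over every point of $E_{ij}$ that lies on no other of the ten lines. 3. $\widetilde C_\infty$ consists of five copies of each of these ten Fermat curves: it is the union, over all $i\ne j$ and $\zeta^5=1$, of the curves $X_{ij,\zeta}$ formed by the pairs $(z,l)$ for which there is $(z,w)\in X_{ij}$ such that $l$ is the line joining $v_{ij,\zeta}$ to the point $w$ of the plane $x_i=x_j=0$. Each $X_{ij,\zeta}$ is isomorphic to the Fermat curve of degree $5$, and $X_{ij,\zeta}\cap X_{ij,\zeta'}=\emptyset$ for $\zeta\neq\zeta'$. Over every point of $C_\infty$ lying on only one of the ten lines there are exactly $125$ points of $\widetilde C_\infty$. 4. The lines $l$ parametrized by $X_{ij,\zeta}$ are exactly the lines of the cone $\{\langle v_{ij,\zeta},x\rangle : x_i=x_j=0,\ \sum_k x_k^5=0\}$. There are exactly $50$ such cones, and the lines parametrized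 by $\widetilde C_\infty$ are exactly the lines of these $50$ cones. They are also exactly all the lines contained in the Fermat quintic $\mathcal M_0:\ \sum_j x_j^5=0$. -/

import Mathlib

noncomputable section

namespace DworkFermat

/-! ### Projective spaces, closures, lines, isomorphisms -/

/-- The complex projective space with homogeneous coordinates indexed by `ι`. -/
abbrev PSpace (ι : Type) : Type := Projectivization ℂ (ι → ℂ)

/-- The points of the projective subspace attached to a linear subspace. -/
def points {ι : Type} (L : Submodule ℂ (ι → ℂ)) : Set (PSpace ι) := {p | p.rep ∈ L}

/-- The lines contained in a subset `X` of projective space; a line is given by a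
two-dimensional linear subspace. -/
def linesOn {ι : Type} (X : Set (PSpace ι)) : Set (Submodule ℂ (ι → ℂ)) :=
  {L | Module.finrank ℂ L = 2 ∧ points L ⊆ X}

/-- Closure in a product of two projective spaces (for the quotient topology: a point lies in
the closure iff its representatives lie in the closure of the cone over the set). -/
def projClosure {α β : Type} (S : Set (PSpace α × PSpace β)) : Set (PSpace α × PSpace β) :=
  {p | (p.1.rep, p.2.rep) ∈ closure {v : (α → ℂ) × (β → ℂ) |
    ∃ (h₁ : v.1 ≠ 0) (h₂ : v.2 ≠ 0),
      (Projectivization.mk ℂ v.1 h₁, Projectivization.mk ℂ v.2 h₂) ∈ S}}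

/-- `f` restricted to `Y` is a regular map: locally it is given by forms of equal degree. -/
def IsRegularMap {α γ : Type} (Y : Set (PSpace α)) (f : PSpace α → PSpace γ) : Prop :=
  ∀ y ∈ Y, ∃ (d : ℕ) (F : γ → MvPolynomial α ℂ), (∀ a, (F a).IsHomogeneous d) ∧
    (fun a => MvPolynomial.eval y.rep (F a)) ≠ 0 ∧
    ∀ y' ∈ Y, ∀ h : (fun a => MvPolynomial.eval y'.rep (F a)) ≠ 0,
      f y' = Projectivization.mk ℂ _ h

/-- `f` restricted to `X` is a regular map, for `X` in a product of two projective spaces: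
locally it is given by bihomogeneous forms of equal bidegree. -/
def IsRegularMapProd {α β γ : Type} (X : Set (PSpace α × PSpace β))
    (f : PSpace α × PSpace β → PSpace γ) : Prop :=
  ∀ x ∈ X, ∃ (d e : ℕ) (F : γ → MvPolynomial (α ⊕ β) ℂ),
    (∀ a, (F a).IsWeightedHomogeneous (Sum.elim (fun _ => 1) (fun _ => 0) : α ⊕ β → ℕ) d ∧
      (F a).IsWeightedHomogeneous (Sum.elim (fun _ => 0) (fun _ => 1) : α ⊕ β → ℕ) e) ∧
    (fun a => MvPolynomial.eval (Sum.elim x.1.rep x.2.rep) (F a)) ≠ 0 ∧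
    ∀ x' ∈ X, ∀ h : (fun a => MvPolynomial.eval (Sum.elim x'.1.rep x'.2.rep) (F a)) ≠ 0,
      f x' = Projectivization.mk ℂ _ h

/-- `X` and `Y` are isomorphic: there are mutually inverse regular maps between them. -/
def IsIsomorphic {α β γ : Type} (X : Set (PSpace α × PSpace β)) (Y : Set (PSpace γ)) : Prop :=
  ∃ (f : PSpace α × PSpace β → PSpace γ) (g₁ : PSpace γ → PSpace α) (g₂ : PSpace γ → PSpace β),
    IsRegularMapProd X f ∧ IsRegularMap Y g₁ ∧ IsRegularMap Y g₂ ∧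
    (∀ x ∈ X, f x ∈ Y ∧ (g₁ (f x), g₂ (f x)) = x) ∧
    (∀ y ∈ Y, (g₁ y, g₂ y) ∈ X ∧ f (g₁ y, g₂ y) = y)

/-! ### The quintic del Pezzo surface, its exceptional lines and the Wiman pencil -/

/-- The blow-up map `ℙ¹ × ℙ¹ ⇢ ℙ⁵` in affine coordinates `σ, τ`. -/
def blowUpMap (σ τ : ℂ) : Fin 6 → ℂ :=
  ![σ ^ 2 * τ ^ 2 - 1, σ * τ ^ 2 - 1, σ ^ 2 * τ - 1, σ * τ - 1, τ - 1, σ - 1]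

/-- The quintic del Pezzo surface in `ℙ⁵`: the closure of the image of the blow-up map. -/
def dP5 : Set (PSpace (Fin 6)) :=
  {z | z.rep ∈ closure {v : Fin 6 → ℂ | ∃ c σ τ : ℂ, v = c • blowUpMap σ τ}}

/-- Two points spanning the exceptional line `E_{ij}`, for `i < j`. The coordinate labels
`1, …, 5` are shifted to `0, …, 4`. -/
def exceptionalBasis : Fin 5 → Fin 5 → (Fin 6 → ℂ) × (Fin 6 → ℂ)
  | 0, 1 => (![2, 1, 2, 1, 0, 1], ![2, 2, 1, 1, 1, 0])
  | 0, 2 => (![1, 0, 0, 0, 0, 0], ![0, 1, 0, 0, 0, 0])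
  | 0, 3 => (![0, 0, 1, 0, 0, 0], ![0, 0, 0, 0, 0, 1])
  | 0, 4 => (![1, 1, 1, 1, 0, 1], ![0, 0, 0, 0, 1, 0])
  | 1, 2 => (![1, 1, 1, 1, 1, 0], ![0, 0, 0, 0, 0, 1])
  | 1, 3 => (![0, 1, 0, 0, 0, 0], ![0, 0, 0, 0, 1, 0])
  | 1, 4 => (![1, 0, 0, 0, 0, 0], ![0, 0, 1, 0, 0, 0])
  | 2, 3 => (![1, 0, 1, 0, 0, 0], ![0, 1, 0, 1, 0, 1])
  | 2, 4 => (![0, 1, 0, 0, 1, 0], ![0, 0, 1, 0, 0, 1])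
  | 3, 4 => (![1, 1, 0, 0, 0, 0], ![0, 0, 1, 1, 1, 0])
  | _, _ => (0, 0)

/-- The exceptional line `E_{ij} = E_{ji}` (for `i ≠ j`). -/
def exceptionalLine (i j : Fin 5) : Submodule ℂ (Fin 6 → ℂ) :=
  Submodule.span ℂ {(exceptionalBasis (min i j) (max i j)).1,
    (exceptionalBasis (min i j) (max i j)).2}

/-- The quadratic form pulling back to
`G = 3σ²τ² - στ(1+σ)(1+τ)(1+στ)/2 + (1-σ+σ²)(1-τ+τ²)(1-στ+σ²τ²)`
(see `formG_blowUpMap`). -/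
def formG (z : Fin 6 → ℂ) : ℂ :=
  (2 * z 0 ^ 2 - 2 * z 0 * z 1 - 2 * z 0 * z 2 - 2 * z 0 * z 3 + z 0 * z 4 + z 0 * z 5
    + 2 * z 1 ^ 2 + z 1 * z 2 - 2 * z 1 * z 3 - 2 * z 1 * z 4 + 2 * z 2 ^ 2 - 2 * z 2 * z 3
    - 2 * z 2 * z 5 + 6 * z 3 ^ 2 - 2 * z 3 * z 4 - 2 * z 3 * z 5 + 2 * z 4 ^ 2 + z 4 * z 5
    + 2 * z 5 ^ 2) / 2

/-- The quadratic form pulling back to `H = στ(1-σ)(1-τ)(1-στ)` (see `formH_blowUpMap`). -/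
def formH (z : Fin 6 → ℂ) : ℂ :=
  (-2 * z 0 * z 3 + z 0 * z 4 + z 0 * z 5 - z 1 * z 2 + 2 * z 1 * z 3 + 2 * z 2 * z 3
    - 2 * z 3 * z 4 - 2 * z 3 * z 5 + z 4 * z 5) / 3

theorem formG_blowUpMap (σ τ : ℂ) : formG (blowUpMap σ τ) =
    3 * σ ^ 2 * τ ^ 2 - σ * τ * (1 + σ) * (1 + τ) * (1 + σ * τ) / 2
      + (1 - σ + σ ^ 2) * (1 - τ + τ ^ 2) * (1 - σ * τ + σ ^ 2 * τ ^ 2) := by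
  simp [formG, blowUpMap]
  ring

theorem formH_blowUpMap (σ τ : ℂ) : formH (blowUpMap σ τ) =
    σ * τ * (1 - σ) * (1 - τ) * (1 - σ * τ) := by
  simp [formH, blowUpMap]
  ring

/-- The member `C_φ : G + φ H = 0` of the Wiman pencil on the del Pezzo surface, with
`φ = φ₁ / φ₀` a point of `ℙ¹` (so `φ = ∞` is `φ₀ = 0`). -/
def wimanCurve (φ₀ φ₁ : ℂ) : Set (PSpace (Fin 6)) :=
  {z | z ∈ dP5 ∧ φ₀ * formG z.rep + φ₁ * formH z.rep = 0}

/-- The relation `φ² = 32 / ψ⁵ - 3 / 4`, with `φ = φ₁ / φ₀` and denominators cleared. -/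
def ParameterRelation (ψ φ₀ φ₁ : ℂ) : Prop :=
  φ₁ ^ 2 * ψ ^ 5 = (32 - 3 / 4 * ψ ^ 5) * φ₀ ^ 2

/-- The member of the Dwork pencil of quintic threefolds with parameter `ψ`. -/
def dworkQuintic (ψ : ℂ) : Set (PSpace (Fin 5)) :=
  {x | ∑ k, x.rep k ^ 5 - 5 * ψ * ∏ k, x.rep k = 0}

/-! ### The family of lines, its Plücker coordinates and the cover -/

/-- The Plücker coordinates `π_{ij} = x_i y_j - x_j y_i` of the line through `x` and `y`. -/
def plucker (x y : Fin 5 → ℂ) : Fin 5 × Fin 5 → ℂ := fun a => x a.1 * y a.2 - x a.2 * y a.1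

/-- `P` is the Plücker point of the line through `x` and `y`. -/
def IsPluckerPoint (x y : Fin 5 → ℂ) (P : PSpace (Fin 5 × Fin 5)) : Prop :=
  ∃ h : plucker x y ≠ 0, P = Projectivization.mk ℂ (plucker x y) h

/-- The fifth power of the coefficient `α(σ, τ)`. -/
def alphaFifth (σ τ : ℂ) : ℂ :=
  σ ^ 4 * (1 - σ) * (1 - τ) * (1 - σ * τ) * (1 - τ * (1 + σ) + τ ^ 2 * (1 - σ + σ ^ 2))

/-- The fifth power of the coefficient `β(σ)`. -/
def betaFifth (σ : ℂ) : ℂ := (1 - σ) * (1 - σ + σ ^ 2)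

/-- `x` and `y` are the points with `(u, v) = (1, 0)` and `(0, 1)` of a line
`(α(σ,τ) u, α(τ,σ) v, -τ^{4/5} β(σ) (σu + v), β(στ) (σu + τv), -σ^{4/5} β(τ) (u + τv))`
of the explicit family with parameters `(σ, τ)`, for some choice of the fifth roots. -/
def IsFamilyLine (σ τ : ℂ) (x y : Fin 5 → ℂ) : Prop :=
  ∃ a a' b₁ b₂ b₃ s t : ℂ,
    a ^ 5 = alphaFifth σ τ ∧ a' ^ 5 = alphaFifth τ σ ∧
    b₁ ^ 5 = betaFifth σ ∧ b₂ ^ 5 = betaFifth (σ * τ) ∧ b₃ ^ 5 = betaFifth τ ∧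
    s ^ 5 = σ ^ 4 ∧ t ^ 5 = τ ^ 4 ∧
    x = ![a, 0, -(t * b₁ * σ), b₂ * σ, -(s * b₃)] ∧
    y = ![0, a', -(t * b₁), b₂ * τ, -(s * b₃ * τ)]

/-- The fifth powers of the Plücker coordinates of the lines of the family do not depend on the
fifth roots and so define a rational map `g = (π_{ij}⁵)` from the del Pezzo surface to
projective space, whose coordinate ratios are the functions `g_{ij} = (π_{ij} / π_{45})⁵`.
`IsPluckerFifthValue z q` says that this rational map is defined at `z`, with value `q`: near
`z` it is given by forms of equal degree on `ℙ⁵` that do not all vanish at `z`. -/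
def IsPluckerFifthValue (z : PSpace (Fin 6)) (q : PSpace (Fin 5 × Fin 5)) : Prop :=
  z ∈ dP5 ∧ ∃ (d : ℕ) (Q : Fin 5 × Fin 5 → MvPolynomial (Fin 6) ℂ),
    (∀ a, (Q a).IsHomogeneous d) ∧
    (∀ (σ τ : ℂ) (x y : Fin 5 → ℂ), IsFamilyLine σ τ x y → ∀ a b,
      MvPolynomial.eval (blowUpMap σ τ) (Q a) * plucker x y b ^ 5 =
        MvPolynomial.eval (blowUpMap σ τ) (Q b) * plucker x y a ^ 5) ∧
    ∃ h : (fun a => MvPolynomial.eval z.rep (Q a)) ≠ 0, q = Projectivization.mk ℂ _ h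

/-- The cover of a curve `C` on the del Pezzo surface obtained from the polynomials
`T⁵ - g_{ij}`: the closure of the set of pairs `(z, l)`, `z` a point of `C` at which `g` is
defined and `l` a line in `ℙ⁴` (given by its Plücker point `P`) for which the fifth powers of
the Plücker coordinates are proportional to `g(z)`. For `C = C_∞` this is `C̃_∞`. -/
def lineCover (C : Set (PSpace (Fin 6))) : Set (PSpace (Fin 6) × PSpace (Fin 5 × Fin 5)) :=
  projClosure {p | p.1 ∈ C ∧ (∃ x y, IsPluckerPoint x y p.2) ∧
    ∃ q, IsPluckerFifthValue p.1 q ∧ ∃ c : ℂ, c ≠ 0 ∧ ∀ a, p.2.rep a ^ 5 = c * q.rep a}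

/-- The coordinate labels different from `i` and `j`. -/
abbrev Others (i j : Fin 5) : Type := {k : Fin 5 // k ≠ i ∧ k ≠ j}

/-- The cover of the single line `E_{ij}` given by the two polynomials `T⁵ - g_{ik} / g_{im}` and
`U⁵ - g_{il} / g_{im}`, where `k, l, m` are the other three labels: the closure of the set of
pairs `(z, w)` with `z` in `E_{ij}` and `(w_k⁵ : w_l⁵ : w_m⁵) = (g_{ik} : g_{il} : g_{im})(z)`. -/
def rootCover (i j : Fin 5) : Set (PSpace (Fin 6) × PSpace (Others i j)) :=
  projClosure {p | p.1 ∈ points (exceptionalLine i j) ∧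
    ∃ q, IsPluckerFifthValue p.1 q ∧
      ∃ c : ℂ, c ≠ 0 ∧ ∀ k : Others i j, p.2.rep k ^ 5 = c * q.rep (i, k.1)}

/-- The plane Fermat curve of degree 5. -/
def fermatCurve : Set (PSpace (Fin 3)) := {w | ∑ k, w.rep k ^ 5 = 0}

/-! ### The cones of lines on the Fermat quintic -/

/-- The point with coordinates `x_i = 1`, `x_j = -ζ` and all others zero. -/
def coneVertex (i j : Fin 5) (ζ : ℂ) : Fin 5 → ℂ := Pi.single i 1 - ζ • Pi.single j 1

/-- The cone of lines joining the vertex to the points of the Fermat curve in the plane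
`x_i = x_j = 0`. -/
def cone (i j : Fin 5) (ζ : ℂ) : Set (Submodule ℂ (Fin 5 → ℂ)) :=
  {L | ∃ x : Fin 5 → ℂ, x ≠ 0 ∧ x i = 0 ∧ x j = 0 ∧ ∑ k, x k ^ 5 = 0 ∧
    L = Submodule.span ℂ {coneVertex i j ζ, x}}

/-- Put a triple indexed by the labels different from `i, j` into `ℂ⁵`, with zeros at `i, j`. -/
def extendZero {i j : Fin 5} (w : Others i j → ℂ) : Fin 5 → ℂ :=
  fun k => if h : k ≠ i ∧ k ≠ j then w ⟨k, h⟩ else 0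

/-- The copy of the curve `rootCover i j` formed by the pairs `(z, l)` with `(z, w)` in
`rootCover i j` and `l` the line joining the vertex attached to `i, j, ζ` to the point `w` of the
plane `x_i = x_j = 0`. -/
def sheet (i j : Fin 5) (ζ : ℂ) : Set (PSpace (Fin 6) × PSpace (Fin 5 × Fin 5)) :=
  {p | ∃ w, (p.1, w) ∈ rootCover i j ∧
    IsPluckerPoint (coneVertex i j ζ) (extendZero w.rep) p.2}

/-- The lines in `ℙ⁴` parametrized by a set of pairs (point of `ℙ⁵`, Plücker point). -/
def parametrizedLines (S : Set (PSpace (Fin 6) × PSpace (Fin 5 × Fin 5))) :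
    Set (Submodule ℂ (Fin 5 → ℂ)) :=
  {L | ∃ x y, L = Submodule.span ℂ {x, y} ∧ ∃ p ∈ S, IsPluckerPoint x y p.2}

end DworkFermat

end

open DworkFermat

/-! View ℂ⁶ as the space of antisymmetric 5×5 matrices ω with zero row sums; `pairForm` and
`ofPairs` translate between the two. In these coordinates E_ij is the set of matrices (e_i - e_j) ∧
u with u_i = u_j = 0 and Σ u_k = 0 (`pairForm_exceptionalLine`, `linePoint_mem`). A point of E_ij is
thus a triple with sum zero, and 8G = Σ ω_ab² (`sum_sq_pairForm`).

The surface is controlled by six pairs of linear forms A_k, B_k with A_k B_k = -H on it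
(`pentagonForm_mul`). Where H = 0, one form of each pair vanishes, and these linear equations put
the point on one of the ten lines (`exists_mem_exceptionalLine`); hence C_∞ is their union. A line
in the surface on which H is not identically zero would meet C_∞ in two points, or in one counted
twice. Both cases are impossible (`formH_eq_zero_of_line`), so every line of the surface is covered
by the ten E_ij and equals one of them.

Up to a common factor, the fifth powers of the Plücker coordinates of the family are Gω_ab +
H·(linear form) (`IsFamilyLine.plucker_pow`). Along C_∞ the second term drops out, so g is simply ω
wherever it is defined (`IsPluckerFifthValue.rep_eq`). The cover of E_ij therefore reads w_k⁵ ∝ u_k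
with Σ u_k = 0, a Fermat quintic. For lines the condition is that the p_ab⁵ are proportional to the
entries of (e_i - e_j) ∧ u. This kills p_ij and the p_kl off i, j, and the Plücker relations make
p_jk / p_ik independent of k, equal to -ζ with ζ⁵ = 1 (`mem_sheet_of_pow`). The line then joins
v_{ij,ζ} to w. The cubics give g only where G ≠ 0, so both covers are found by enclosing them in
closed sets and by reaching the zeros of G along curves (`exists_generic_path`).

On the Fermat quintic, a line has a basis that is reduced at two coordinates i, j. Three
coefficients of Σ (s x_n + t y_n)⁵ force x_n y_n = 0 at every other coordinate
(`mul_eq_zero_of_moments`). One basis vector then has just two nonzero entries, so it is the vertex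
of a cone. -/

namespace DworkFermat

open Topology Filter

/-! ### Representatives and closures in projective space -/

section Projective

variable {ι κ : Type}

theorem exists_rep_mk (v : ι → ℂ) (hv : v ≠ 0) :
    ∃ c : ℂ, c ≠ 0 ∧ (Projectivization.mk ℂ v hv).rep = c • v := by
  obtain ⟨a, ha⟩ := Projectivization.exists_smul_eq_mk_rep ℂ v hv
  exact ⟨a, a.ne_zero, ha.symm⟩

theorem mk_eq_mk_of_smul {v w : ι → ℂ} (hv : v ≠ 0) (hw : w ≠ 0) {c : ℂ} (h : v = c • w) :
    Projectivization.mk ℂ v hv = Projectivization.mk ℂ w hw :=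
  (Projectivization.mk_eq_mk_iff' ℂ v w hv hw).2 ⟨c, h.symm⟩

theorem eq_mk_of_rep {p : PSpace ι} {v : ι → ℂ} (hv : v ≠ 0) {c : ℂ} (h : p.rep = c • v) :
    p = Projectivization.mk ℂ v hv := by
  rw [← p.mk_rep]
  exact mk_eq_mk_of_smul p.rep_nonzero hv h

theorem eq_of_rep_eq_smul {p q : PSpace ι} {c : ℂ} (h : p.rep = c • q.rep) : p = q := by
  rw [← p.mk_rep, ← q.mk_rep]
  exact mk_eq_mk_of_smul p.rep_nonzero q.rep_nonzero h

theorem mk_mem_points {L : Submodule ℂ (ι → ℂ)} {v : ι → ℂ} (hv : v ≠ 0) :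
    Projectivization.mk ℂ v hv ∈ points L ↔ v ∈ L := by
  obtain ⟨c, hc, h⟩ := exists_rep_mk v hv
  simp only [points, Set.mem_ofPred_eq, h]
  exact L.smul_mem_iff hc

/-- A subset of a product of two vector spaces stable under rescaling both components. -/
def IsBicone (C : Set ((ι → ℂ) × (κ → ℂ))) : Prop :=
  ∀ v ∈ C, ∀ c d : ℂ, c ≠ 0 → d ≠ 0 → (c • v.1, d • v.2) ∈ C

theorem IsBicone.mk_rep_iff {C : Set ((ι → ℂ) × (κ → ℂ))} (hC : IsBicone C) {v : ι → ℂ}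
    {w : κ → ℂ} (hv : v ≠ 0) (hw : w ≠ 0) :
    ((Projectivization.mk ℂ v hv).rep, (Projectivization.mk ℂ w hw).rep) ∈ C ↔ (v, w) ∈ C := by
  obtain ⟨c, hc, h⟩ := exists_rep_mk v hv
  obtain ⟨d, hd, k⟩ := exists_rep_mk w hw
  rw [h, k]
  refine ⟨fun H => ?_, fun H => hC _ H c d hc hd⟩
  simpa [smul_smul, hc, hd] using hC _ H c⁻¹ d⁻¹ (inv_ne_zero hc) (inv_ne_zero hd)

/-- A closed condition that is insensitive to the choice of representatives passes to the closure.
This bounds the covers from above; `mem_projClosure_of_tendsto` bounds them from below. -/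
theorem projClosure_subset {S : Set (PSpace ι × PSpace κ)} {C : Set ((ι → ℂ) × (κ → ℂ))}
    (hC : IsBicone C) (hcl : IsClosed C) (hS : ∀ p ∈ S, (p.1.rep, p.2.rep) ∈ C) :
    ∀ p ∈ projClosure S, (p.1.rep, p.2.rep) ∈ C := by
  intro p hp
  refine closure_minimal ?_ hcl hp
  rintro ⟨v, w⟩ ⟨hv, hw, h⟩
  exact (hC.mk_rep_iff hv hw).1 (hS _ h)

theorem mem_projClosure_of_tendsto {S : Set (PSpace ι × PSpace κ)} {p : PSpace ι × PSpace κ}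
    {f : ℂ → ι → ℂ} {g : ℂ → κ → ℂ} (hf : ContinuousAt f 0) (hg : ContinuousAt g 0)
    (hf0 : f 0 = p.1.rep) (hg0 : g 0 = p.2.rep)
    (h : ∀ᶠ t in 𝓝[≠] (0 : ℂ), ∃ (h₁ : f t ≠ 0) (h₂ : g t ≠ 0),
      (Projectivization.mk ℂ (f t) h₁, Projectivization.mk ℂ (g t) h₂) ∈ S) :
    p ∈ projClosure S := by
  have hc : Tendsto (fun t => (f t, g t)) (𝓝[≠] 0) (𝓝 (p.1.rep, p.2.rep)) := by
    rw [← hf0, ← hg0]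
    exact (hf.prodMk hg).mono_left nhdsWithin_le_nhds
  exact mem_closure_of_tendsto hc h

theorem mem_of_punctured {X : Type*} [TopologicalSpace X] {C : Set X} (hC : IsClosed C)
    {f : ℂ → X} (hf : ContinuousAt f 0) (h : ∀ᶠ t in 𝓝[≠] (0 : ℂ), f t ∈ C) : f 0 ∈ C :=
  hC.mem_of_tendsto (hf.tendsto.mono_left nhdsWithin_le_nhds) h

theorem eventually_ne_zero_of_continuous {f : ℂ → ℂ} (hf : ContinuousAt f 0) (h : f 0 ≠ 0) :
    ∀ᶠ t in 𝓝[≠] (0 : ℂ), f t ≠ 0 :=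
  (hf.eventually_ne h).filter_mono nhdsWithin_le_nhds

/-- The projective point of a vector, with an arbitrary value at zero. -/
noncomputable def toProj [Nonempty (PSpace ι)] (v : ι → ℂ) : PSpace ι :=
  open Classical in
  if h : v ≠ 0 then Projectivization.mk ℂ v h else Classical.arbitrary _

theorem toProj_of_ne [Nonempty (PSpace ι)] {v : ι → ℂ} (h : v ≠ 0) :
    toProj v = Projectivization.mk ℂ v h := dif_pos h

instance [Nonempty ι] : Nonempty (PSpace ι) :=
  ⟨Projectivization.mk ℂ (fun _ => 1) fun h => one_ne_zero (congrFun h (Classical.arbitrary ι))⟩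

end Projective

/-! ### Five labels -/

theorem exists_others (i j : Fin 5) (h : i ≠ j) :
    ∃ k l m : Fin 5, k ≠ i ∧ k ≠ j ∧ l ≠ i ∧ l ≠ j ∧ m ≠ i ∧ m ≠ j ∧ k ≠ l ∧ k ≠ m ∧ l ≠ m := by
  revert i j; decide

theorem label_cases {i j k l m : Fin 5} (h : i ≠ j) (hk : k ≠ i ∧ k ≠ j) (hl : l ≠ i ∧ l ≠ j)
    (hm : m ≠ i ∧ m ≠ j) (hkl : k ≠ l) (hkm : k ≠ m) (hlm : l ≠ m) (a : Fin 5) :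
    a = i ∨ a = j ∨ a = k ∨ a = l ∨ a = m := by
  omega

theorem sum_labels {i j k l m : Fin 5} (h : i ≠ j) (hk : k ≠ i ∧ k ≠ j) (hl : l ≠ i ∧ l ≠ j)
    (hm : m ≠ i ∧ m ≠ j) (hkl : k ≠ l) (hkm : k ≠ m) (hlm : l ≠ m) (f : Fin 5 → ℂ) :
    ∑ a, f a = f i + f j + f k + f l + f m := by
  have : (Finset.univ : Finset (Fin 5)) = {i, j, k, l, m} := by
    ext a
    simpa using label_cases h hk hl hm hkl hkm hlm a
  rw [this, Finset.sum_insert, Finset.sum_insert, Finset.sum_insert, Finset.sum_insert,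
    Finset.sum_singleton]
  · ring
  all_goals
    simp only [Finset.mem_insert, Finset.mem_singleton]
    omega

/-! ### Linear forms on `ℙ⁵` indexed by pairs of labels -/

/-- The antisymmetric matrix of linear forms proportional, along each exceptional line, to
the fifth powers of the Plücker coordinates. -/
def pairForm (z : Fin 6 → ℂ) : Fin 5 → Fin 5 → ℂ :=
  ![![0, -z 0 + z 1 + z 2 - z 4 - z 5, z 5, z 4 - z 1, z 0 - z 2],
    ![z 0 - z 1 - z 2 + z 4 + z 5, 0, z 1 - z 0, z 2 - z 5, -z 4],
    ![-z 5, z 0 - z 1, 0, z 1 - 2 * z 3 + z 5, 2 * z 3 - z 0],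
    ![z 1 - z 4, z 5 - z 2, 2 * z 3 - z 1 - z 5, 0, z 2 - 2 * z 3 + z 4],
    ![z 2 - z 0, z 4, z 0 - 2 * z 3, 2 * z 3 - z 2 - z 4, 0]]

/-- The point of `ℂ⁶` with a prescribed matrix of values of the forms `pairForm`. -/
noncomputable def ofPairs : (Fin 5 × Fin 5 → ℂ) →ₗ[ℂ] (Fin 6 → ℂ) where
  toFun M := ![-M (1, 4) - M (0, 3) - M (1, 2), -M (1, 4) - M (0, 3), M (0, 2) + M (1, 3),
    (-M (1, 4) - M (0, 3) - M (1, 2) + M (2, 4)) / 2, -M (1, 4), M (0, 2)]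
  map_add' M N := by ext a; fin_cases a <;> simp <;> ring
  map_smul' c M := by ext a; fin_cases a <;> simp <;> ring

theorem ofPairs_pairForm (z : Fin 6 → ℂ) : ofPairs (fun a => pairForm z a.1 a.2) = z := by
  ext a
  fin_cases a <;> simp [ofPairs, pairForm]

theorem pairForm_smul (c : ℂ) (z : Fin 6 → ℂ) : pairForm (c • z) = c • pairForm z := by
  ext a b
  fin_cases a <;> fin_cases b <;> simp [pairForm] <;> ring

theorem continuous_pairForm (a b : Fin 5) : Continuous fun z => pairForm z a b := by
  fin_cases a <;> fin_cases b <;> simp [pairForm] <;> fun_prop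

/-- Antisymmetric 5×5 matrices with zero row sums form a space of dimension 10 - 4 = 6, so the left
inverse `ofPairs` is also a right inverse on them. -/
theorem pairForm_ofPairs {M : Fin 5 × Fin 5 → ℂ} (hM : ∀ a b, M (a, b) = -M (b, a))
    (hs : ∀ a, ∑ b, M (a, b) = 0) (a b : Fin 5) : pairForm (ofPairs M) a b = M (a, b) := by
  have hd : ∀ a, M (a, a) = 0 := fun a => by
    have := hM a a
    linear_combination this / 2
  simp only [Fin.sum_univ_five] at hs
  fin_cases a <;> fin_cases b <;> simp [pairForm, ofPairs] <;> grind

theorem pairForm_antisymm (z : Fin 6 → ℂ) (a b : Fin 5) : pairForm z a b = -pairForm z b a := by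
  fin_cases a <;> fin_cases b <;> simp [pairForm] <;> ring

theorem pairForm_row_sum (z : Fin 6 → ℂ) (a : Fin 5) : ∑ b, pairForm z a b = 0 := by
  rw [Fin.sum_univ_five]
  fin_cases a <;> simp [pairForm] <;> ring

theorem exceptionalLine_comm (i j : Fin 5) : exceptionalLine i j = exceptionalLine j i := by
  rw [exceptionalLine, exceptionalLine, min_comm, max_comm]

set_option maxHeartbeats 1600000 in
/-- The exceptional line `E_{ij}` is the zero locus of the forms indexed by pairs that are
equal to or disjoint from `{i, j}`. -/
theorem mem_exceptionalLine_iff {i j : Fin 5} (h : i ≠ j) (z : Fin 6 → ℂ) :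
    z ∈ exceptionalLine i j ↔ pairForm z i j = 0 ∧
      ∀ k l : Fin 5, k ≠ i ∧ k ≠ j → l ≠ i ∧ l ≠ j → pairForm z k l = 0 := by
  wlog hlt : i < j generalizing i j
  · rw [exceptionalLine_comm, this h.symm (by omega), pairForm_antisymm z i j, neg_eq_zero]
    simp only [and_comm]
  rw [exceptionalLine, min_eq_left hlt.le, max_eq_right hlt.le, Submodule.mem_span_pair]
  constructor
  · rintro ⟨a, b, rfl⟩
    constructor
    · fin_cases i <;> fin_cases j <;> simp at hlt <;> simp [exceptionalBasis, pairForm] <;> ring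
    · intro k l
      wlog hkl : k < l generalizing k l
      · rcases eq_or_lt_of_le (not_lt.1 hkl) with rfl | hlk
        · fin_cases l <;> simp [pairForm]
        · intro hk hl
          rw [pairForm_antisymm, this l k hlk hl hk, neg_zero]
      fin_cases i <;> fin_cases j <;> simp at hlt <;> fin_cases k <;> fin_cases l <;>
        simp at hkl <;> simp [exceptionalBasis, pairForm] <;> ring
  · rintro ⟨h0, h1⟩
    have e01 := h1 0 1
    have e02 := h1 0 2
    have e03 := h1 0 3
    have e04 := h1 0 4
    have e12 := h1 1 2
    have e13 := h1 1 3
    have e14 := h1 1 4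
    have e23 := h1 2 3
    have e24 := h1 2 4
    have e34 := h1 3 4
    clear h1
    fin_cases i <;> fin_cases j <;> simp at hlt <;>
      simp [pairForm] at h0 e01 e02 e03 e04 e12 e13 e14 e23 e24 e34
    on_goal 1 => refine ⟨z 5, z 4, ?_⟩
    on_goal 2 => refine ⟨z 0, z 1, ?_⟩
    on_goal 3 => refine ⟨z 2, z 5, ?_⟩
    on_goal 4 => refine ⟨z 0, z 4, ?_⟩
    on_goal 5 => refine ⟨z 0, z 5, ?_⟩
    on_goal 6 => refine ⟨z 1, z 4, ?_⟩
    on_goal 7 => refine ⟨z 0, z 2, ?_⟩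
    on_goal 8 => refine ⟨z 0, z 1, ?_⟩
    on_goal 9 => refine ⟨z 1, z 2, ?_⟩
    on_goal 10 => refine ⟨z 0, z 2, ?_⟩
    all_goals
      ext a
      fin_cases a <;> simp [exceptionalBasis] <;> grind

/-- The vector of values of the forms `pairForm z i` off the labels `i` and `j`. -/
def branchValues (i j : Fin 5) (z : Fin 6 → ℂ) (k : Fin 5) : ℂ :=
  if k ≠ i ∧ k ≠ j then pairForm z i k else 0

/-- For k off i, j the only entries of row k that can survive on E_ij are those in columns i and j.
The zero row sum makes them opposite, which gives the shape (e_i - e_j) ∧ u. -/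
theorem pairForm_exceptionalLine {i j : Fin 5} (h : i ≠ j) {z : Fin 6 → ℂ}
    (hz : z ∈ exceptionalLine i j) (a b : Fin 5) :
    pairForm z a b = plucker (coneVertex i j 1) (branchValues i j z) (a, b) := by
  obtain ⟨h0, h1⟩ := (mem_exceptionalLine_iff h z).1 hz
  have hj : ∀ k, k ≠ i ∧ k ≠ j → pairForm z j k = -pairForm z i k := fun k hk => by
    obtain ⟨l, m, hl, hm, hkl, hkm, hlm⟩ : ∃ l m : Fin 5, (l ≠ i ∧ l ≠ j) ∧ (m ≠ i ∧ m ≠ j) ∧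
        k ≠ l ∧ k ≠ m ∧ l ≠ m := by
      clear h0 h1 hz
      revert i j k; decide
    have := pairForm_row_sum z k
    rw [sum_labels h hk hl hm hkl hkm hlm, h1 k k hk hk, h1 k l hk hl, h1 k m hk hm] at this
    rw [pairForm_antisymm z j, pairForm_antisymm z i]
    linear_combination -this
  have hd : ∀ a, pairForm z a a = 0 := fun a => by
    linear_combination pairForm_antisymm z a a / 2
  have hi0 : pairForm z j i = 0 := by rw [pairForm_antisymm, h0, neg_zero]
  have key : ∀ c : Fin 5, c = i ∨ c = j ∨ (c ≠ i ∧ c ≠ j) := fun c => by omega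
  rcases key a with rfl | rfl | ha <;> rcases key b with rfl | rfl | hb <;>
    simp [plucker, coneVertex, branchValues, *, h.symm]
  · rw [pairForm_antisymm]
  · rw [pairForm_antisymm, hj _ ha, neg_neg]

theorem branchValues_sum {i j : Fin 5} (h : i ≠ j) {z : Fin 6 → ℂ}
    (hz : z ∈ exceptionalLine i j) : ∑ k, branchValues i j z k = 0 := by
  have := pairForm_row_sum z i
  rw [← this]
  refine Finset.sum_congr rfl fun k _ => ?_
  rw [pairForm_exceptionalLine h hz]
  by_cases hk : k ≠ i ∧ k ≠ j
  · simp [plucker, coneVertex, branchValues, hk, h]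
  · have : k = i ∨ k = j := by tauto
    rcases this with rfl | rfl <;> simp [plucker, coneVertex, branchValues]

/-- The Plücker coordinates of the line through a fixed point, as a linear map. -/
def pluckerLeft (x : Fin 5 → ℂ) : (Fin 5 → ℂ) →ₗ[ℂ] (Fin 5 × Fin 5 → ℂ) where
  toFun y := plucker x y
  map_add' y y' := by ext a; simp [plucker]; ring
  map_smul' c y := by ext a; simp [plucker]; ring

/-- The parametrization of the exceptional line `E_{ij}` by triples with sum zero. -/
noncomputable def linePoint (i j : Fin 5) : (Fin 5 → ℂ) →ₗ[ℂ] (Fin 6 → ℂ) :=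
  ofPairs ∘ₗ pluckerLeft (coneVertex i j 1)

theorem pairForm_linePoint {i j : Fin 5} {u : Fin 5 → ℂ}
    (hu : ∑ k, u k = 0) (a b : Fin 5) :
    pairForm (linePoint i j u) a b = plucker (coneVertex i j 1) u (a, b) := by
  refine pairForm_ofPairs (fun a b => by simp [pluckerLeft, plucker]) (fun a => ?_) a b
  have hv : ∑ b, coneVertex i j 1 b = 0 := by simp [coneVertex, Finset.sum_sub_distrib]
  simp only [pluckerLeft, plucker, LinearMap.coe_mk, AddHom.coe_mk, Finset.sum_sub_distrib,
    ← Finset.mul_sum, ← Finset.sum_mul, hu, hv]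
  ring

theorem linePoint_mem {i j : Fin 5} (h : i ≠ j) {u : Fin 5 → ℂ} (hi : u i = 0) (hj : u j = 0)
    (hu : ∑ k, u k = 0) : linePoint i j u ∈ exceptionalLine i j := by
  rw [mem_exceptionalLine_iff h]
  refine ⟨?_, fun k l hk hl => ?_⟩
  · rw [pairForm_linePoint hu]
    simp [plucker, hi, hj]
  · rw [pairForm_linePoint hu]
    simp [plucker, coneVertex, hk, hl]

theorem linePoint_branchValues {i j : Fin 5} (h : i ≠ j) {z : Fin 6 → ℂ}
    (hz : z ∈ exceptionalLine i j) : linePoint i j (branchValues i j z) = z := by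
  conv_rhs => rw [← ofPairs_pairForm z]
  change ofPairs _ = _
  congr 1
  ext a
  exact (pairForm_exceptionalLine h hz a.1 a.2).symm

theorem branchValues_linePoint {i j : Fin 5} (h : i ≠ j) {u : Fin 5 → ℂ} (hi : u i = 0)
    (hj : u j = 0) (hu : ∑ k, u k = 0) : branchValues i j (linePoint i j u) = u := by
  ext k
  by_cases hk : k ≠ i ∧ k ≠ j
  · rw [branchValues, if_pos hk, pairForm_linePoint hu]
    simp [plucker, coneVertex, h, hi]
  · rw [branchValues, if_neg hk]
    have : k = i ∨ k = j := by tauto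
    rcases this with rfl | rfl <;> simp [hi, hj]

theorem sum_sq_pairForm (z : Fin 6 → ℂ) : ∑ a, ∑ b, pairForm z a b ^ 2 = 8 * formG z := by
  simp [Fin.sum_univ_five, pairForm, formG]
  ring

/-- Each u_k occurs, up to sign, in exactly four entries of (e_i - e_j) ∧ u, so 8G = 4 Σ u_k². -/
theorem formG_exceptionalLine {i j k l m : Fin 5} (h : i ≠ j) (hk : k ≠ i ∧ k ≠ j)
    (hl : l ≠ i ∧ l ≠ j) (hm : m ≠ i ∧ m ≠ j) (hkl : k ≠ l) (hkm : k ≠ m) (hlm : l ≠ m)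
    {u : Fin 5 → ℂ} (hi : u i = 0) (hj : u j = 0) (hu : ∑ k, u k = 0) :
    2 * formG (linePoint i j u) = u k ^ 2 + u l ^ 2 + u m ^ 2 := by
  have := sum_sq_pairForm (linePoint i j u)
  simp only [pairForm_linePoint hu, sum_labels h hk hl hm hkl hkm hlm] at this
  simp [plucker, coneVertex, hi, hj, h, h.symm, hk, hl, hm] at this
  linear_combination -this / 4

theorem mem_exceptionalLine_of_labels {i j k l m : Fin 5} (h : i ≠ j) (hk : k ≠ i ∧ k ≠ j)
    (hl : l ≠ i ∧ l ≠ j) (hm : m ≠ i ∧ m ≠ j) (hkl : k ≠ l) (hkm : k ≠ m) (hlm : l ≠ m)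
    {z : Fin 6 → ℂ} (h0 : pairForm z i j = 0) (h1 : pairForm z k l = 0) (h2 : pairForm z k m = 0)
    (h3 : pairForm z l m = 0) : z ∈ exceptionalLine i j := by
  refine (mem_exceptionalLine_iff h z).2 ⟨h0, fun a b ha hb => ?_⟩
  have hd : ∀ a, pairForm z a a = 0 := fun a => by
    linear_combination pairForm_antisymm z a a / 2
  have h1' : pairForm z l k = 0 := by rw [pairForm_antisymm, h1, neg_zero]
  have h2' : pairForm z m k = 0 := by rw [pairForm_antisymm, h2, neg_zero]
  have h3' : pairForm z m l = 0 := by rw [pairForm_antisymm, h3, neg_zero]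
  have key := label_cases h hk hl hm hkl hkm hlm
  rcases key a with rfl | rfl | rfl | rfl | rfl <;> rcases key b with rfl | rfl | rfl | rfl | rfl <;>
    simp_all

/-! ### Incidences and independence of the ten lines. -/

theorem mem_exceptionalLine_of_branchValues {i j k l m : Fin 5} (h : i ≠ j) (hk : k ≠ i ∧ k ≠ j)
    (hl : l ≠ i ∧ l ≠ j) (hm : m ≠ i ∧ m ≠ j) (hkl : k ≠ l) (hkm : k ≠ m) (hlm : l ≠ m)
    {z : Fin 6 → ℂ} (hz : z ∈ exceptionalLine i j) (h0 : branchValues i j z k = 0) :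
    z ∈ exceptionalLine l m := by
  have hv := pairForm_exceptionalLine h hz
  refine mem_exceptionalLine_of_labels (k := i) (l := j) (m := k) hlm ⟨hl.1.symm, hm.1.symm⟩
    ⟨hl.2.symm, hm.2.symm⟩ ⟨hkl, hkm⟩ h hk.1.symm hk.2.symm ?_ ?_ ?_ ?_ <;> rw [hv]
  · simp [plucker, coneVertex, hl, hm]
  · simp [plucker, branchValues]
  · simp [plucker, coneVertex, hk, h0]
  · simp [plucker, coneVertex, hk, h0]

/-- For two different pairs of labels this supplies a form ω_ab that vanishes identically on the
second line but restricts to ± the branch value at b on the first. -/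
theorem crossing_pair : ∀ i j i' j' : Fin 5, i ≠ j → i' ≠ j' →
    (i' = i ∧ j' = j) ∨ (i' = j ∧ j' = i) ∨ ∃ a b : Fin 5, (a = i ∨ a = j) ∧ (b ≠ i ∧ b ≠ j) ∧
      ((a = i' ∧ b = j') ∨ (a = j' ∧ b = i') ∨ ((a ≠ i' ∧ a ≠ j') ∧ (b ≠ i' ∧ b ≠ j'))) := by
  decide

/-- Two different exceptional lines meet only where one of the branch values vanishes. -/
theorem labels_eq_of_mem {i j i' j' : Fin 5} (h : i ≠ j) (h' : i' ≠ j') {z : Fin 6 → ℂ}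
    (hz : z ∈ exceptionalLine i j) (hz' : z ∈ exceptionalLine i' j')
    (hb : ∀ k, k ≠ i ∧ k ≠ j → branchValues i j z k ≠ 0) :
    (i' = i ∧ j' = j) ∨ (i' = j ∧ j' = i) := by
  rcases crossing_pair i j i' j' h h' with H | H | ⟨a, b, ha, hk, hab⟩
  · exact Or.inl H
  · exact Or.inr H
  exfalso
  refine hb b hk ?_
  obtain ⟨h0, h1⟩ := (mem_exceptionalLine_iff h' z).1 hz'
  have hab0 : pairForm z a b = 0 := by
    rcases hab with ⟨rfl, rfl⟩ | ⟨rfl, rfl⟩ | ⟨ha', hb'⟩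
    · exact h0
    · rw [pairForm_antisymm, h0, neg_zero]
    · exact h1 a b ha' hb'
  rw [pairForm_exceptionalLine h hz] at hab0
  rcases ha with rfl | rfl
  · simpa [plucker, coneVertex, h, h.symm, hk, branchValues] using hab0
  · simpa [plucker, coneVertex, h, h.symm, hk, branchValues] using hab0

theorem exists_generic_point {i j : Fin 5} (h : i ≠ j) : ∃ z ∈ exceptionalLine i j,
    ∀ k, k ≠ i ∧ k ≠ j → branchValues i j z k ≠ 0 := by
  obtain ⟨k, l, m, hki, hkj, hli, hlj, hmi, hmj, hkl, hkm, hlm⟩ := exists_others i j h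
  let u : Fin 5 → ℂ := Pi.single k 1 + Pi.single l 1 - Pi.single m 2
  have hi : u i = 0 := by simp [u, *, hki.symm, hli.symm, hmi.symm]
  have hj : u j = 0 := by simp [u, *, hkj.symm, hlj.symm, hmj.symm]
  have hu : ∑ a, u a = 0 := by simp [u, Finset.sum_sub_distrib, Finset.sum_add_distrib]; norm_num
  refine ⟨linePoint i j u, linePoint_mem h hi hj hu, fun a ha => ?_⟩
  rw [branchValues_linePoint h hi hj hu]
  rcases label_cases h ⟨hki, hkj⟩ ⟨hli, hlj⟩ ⟨hmi, hmj⟩ hkl hkm hlm a with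
    rfl | rfl | rfl | rfl | rfl
  · simp at ha
  · simp at ha
  · simp [u, hkl, hkm]
  · simp [u, hkl.symm, hlm]
  · simp [u, hkm.symm, hlm.symm]

theorem exceptionalLine_eq_iff {i j i' j' : Fin 5} (h : i ≠ j) (h' : i' ≠ j') :
    exceptionalLine i j = exceptionalLine i' j' ↔ (i' = i ∧ j' = j) ∨ (i' = j ∧ j' = i) := by
  constructor
  · intro he
    obtain ⟨z, hz, hb⟩ := exists_generic_point h
    exact labels_eq_of_mem h h' hz (he ▸ hz) hb
  · rintro (⟨rfl, rfl⟩ | ⟨rfl, rfl⟩)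
    · rfl
    · exact exceptionalLine_comm _ _

theorem finrank_exceptionalLine {i j : Fin 5} (h : i ≠ j) :
    Module.finrank ℂ (exceptionalLine i j) = 2 := by
  wlog hlt : i < j generalizing i j
  · rw [exceptionalLine_comm, this h.symm (by omega)]
  -- Two coordinates of ℂ⁶ that are dual to the chosen spanning vectors prove their independence.
  obtain ⟨p, q, hpq⟩ : ∃ p q : Fin 6, ∀ a b : ℂ,
      (a • (exceptionalBasis i j).1 + b • (exceptionalBasis i j).2) p = a ∧
      (a • (exceptionalBasis i j).1 + b • (exceptionalBasis i j).2) q = b := by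
    fin_cases i <;> fin_cases j <;> simp at hlt
    exacts [⟨5, 4, by simp [exceptionalBasis]⟩, ⟨0, 1, by simp [exceptionalBasis]⟩,
      ⟨2, 5, by simp [exceptionalBasis]⟩, ⟨0, 4, by simp [exceptionalBasis]⟩,
      ⟨0, 5, by simp [exceptionalBasis]⟩, ⟨1, 4, by simp [exceptionalBasis]⟩,
      ⟨0, 2, by simp [exceptionalBasis]⟩, ⟨0, 1, by simp [exceptionalBasis]⟩,
      ⟨1, 2, by simp [exceptionalBasis]⟩, ⟨0, 2, by simp [exceptionalBasis]⟩]
  rw [exceptionalLine, min_eq_left hlt.le, max_eq_right hlt.le]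
  have hli : LinearIndependent ℂ ![(exceptionalBasis i j).1, (exceptionalBasis i j).2] := by
    refine LinearIndependent.pair_iff.2 fun a b hab => ?_
    obtain ⟨h1, h2⟩ := hpq a b
    rw [hab] at h1 h2
    exact ⟨h1.symm, h2.symm⟩
  have := finrank_span_eq_card hli
  rwa [Matrix.range_cons_cons_empty, Fintype.card_fin] at this

/-! ### Equations of the surface and the zero locus of H. -/

/-- The linear forms on `ℙ⁵` vanishing along pentagons of exceptional lines, in six
complementary pairs. -/
def pentagonForm (k : Fin 6) (b : Fin 2) (z : Fin 6 → ℂ) : ℂ :=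
  ![![z 2 - z 3, z 1 - z 3 - z 4], ![z 1 - z 3, z 2 - z 3 - z 5], ![z 0 - z 3, z 3 - z 4 - z 5],
    ![z 3 - z 4, z 0 - z 2 - z 3 + z 5], ![z 3 - z 5, z 0 - z 1 - z 3 + z 4],
    ![z 0 - z 1 - z 2 + z 3, z 3]] k b

theorem pentagonForm_add (k : Fin 6) (b : Fin 2) (z w : Fin 6 → ℂ) :
    pentagonForm k b (z + w) = pentagonForm k b z + pentagonForm k b w := by
  fin_cases k <;> fin_cases b <;> simp [pentagonForm] <;> ring

theorem pentagonForm_smul (k : Fin 6) (b : Fin 2) (c : ℂ) (z : Fin 6 → ℂ) :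
    pentagonForm k b (c • z) = c * pentagonForm k b z := by
  fin_cases k <;> fin_cases b <;> simp [pentagonForm] <;> ring

theorem continuous_pentagonForm (k : Fin 6) (b : Fin 2) : Continuous (pentagonForm k b) := by
  change Continuous fun z => pentagonForm k b z
  fin_cases k <;> fin_cases b <;> simp [pentagonForm] <;> fun_prop

theorem continuous_formH : Continuous formH := by unfold formH; fun_prop

/-- A suitable choice of one form from each pair is already a system of six independent linear
forms. This rules out tangency in `formH_eq_zero_of_line`. -/
theorem eq_zero_of_pentagonForm {z : Fin 6 → ℂ} (h : ∀ k b, pentagonForm k b z = 0) : z = 0 := by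
  have h1 := h 0 0
  have h2 := h 1 0
  have h3 := h 2 0
  have h4 := h 3 0
  have h5 := h 4 0
  have h6 := h 5 1
  simp [pentagonForm] at h1 h2 h3 h4 h5 h6
  ext a
  fin_cases a <;> simp <;> grind

/-- The cone over the quintic del Pezzo surface. -/
def surfaceCone : Set (Fin 6 → ℂ) :=
  closure {v : Fin 6 → ℂ | ∃ c σ τ : ℂ, v = c • blowUpMap σ τ}

theorem isClosed_surfaceCone : IsClosed surfaceCone := isClosed_closure

theorem smul_mem_surfaceCone {v : Fin 6 → ℂ} (hv : v ∈ surfaceCone) (c : ℂ) :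
    c • v ∈ surfaceCone := by
  refine map_mem_closure (continuous_const_smul c) hv ?_
  rintro _ ⟨d, σ, τ, rfl⟩
  exact ⟨c * d, σ, τ, by rw [smul_smul]⟩

theorem mk_mem_dP5 {v : Fin 6 → ℂ} (hv : v ≠ 0) :
    Projectivization.mk ℂ v hv ∈ dP5 ↔ v ∈ surfaceCone := by
  obtain ⟨c, hc, h⟩ := exists_rep_mk v hv
  change (Projectivization.mk ℂ v hv).rep ∈ surfaceCone ↔ _
  rw [h]
  refine ⟨fun H => ?_, fun H => smul_mem_surfaceCone H c⟩
  simpa [smul_smul, hc] using smul_mem_surfaceCone H c⁻¹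

/-- The quadratic relations of the quintic del Pezzo surface. -/
theorem pentagonForm_mul {v : Fin 6 → ℂ} (hv : v ∈ surfaceCone) (k : Fin 6) :
    pentagonForm k 0 v * pentagonForm k 1 v = -formH v := by
  have hc : IsClosed {v | pentagonForm k 0 v * pentagonForm k 1 v = -formH v} :=
    isClosed_eq ((continuous_pentagonForm k 0).mul (continuous_pentagonForm k 1))
      continuous_formH.neg
  refine closure_minimal ?_ hc hv
  rintro _ ⟨c, σ, τ, rfl⟩
  fin_cases k <;> simp [pentagonForm, formH, blowUpMap] <;> ring

/-- Choosing a vanishing factor in each product turns the six quadratic equations into linear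
systems, and every such system has its solutions inside a single E_ij. -/
theorem exists_mem_exceptionalLine {z : Fin 6 → ℂ}
    (hz : ∀ k, pentagonForm k 0 z * pentagonForm k 1 z = 0) :
    ∃ i j : Fin 5, i ≠ j ∧ z ∈ exceptionalLine i j := by
  have e0 := hz 0
  have e1 := hz 1
  have e2 := hz 2
  have e3 := hz 3
  have e4 := hz 4
  have e5 := hz 5
  simp only [pentagonForm, Matrix.cons_val] at e0 e1 e2 e3 e4 e5
  clear hz
  have key : ∀ i j k l m : Fin 5, i ≠ j → (k ≠ i ∧ k ≠ j) → (l ≠ i ∧ l ≠ j) → (m ≠ i ∧ m ≠ j) →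
      k ≠ l → k ≠ m → l ≠ m → pairForm z i j = 0 → pairForm z k l = 0 → pairForm z k m = 0 →
      pairForm z l m = 0 → ∃ i j : Fin 5, i ≠ j ∧ z ∈ exceptionalLine i j :=
    fun i j _ _ _ h hk hl hm hkl hkm hlm h0 h1 h2 h3 =>
      ⟨i, j, h, mem_exceptionalLine_of_labels h hk hl hm hkl hkm hlm h0 h1 h2 h3⟩
  have L01 := key 0 1 2 3 4 (by decide) (by decide) (by decide) (by decide) (by decide)
    (by decide) (by decide)
  have L02 := key 0 2 1 3 4 (by decide) (by decide) (by decide) (by decide) (by decide)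
    (by decide) (by decide)
  have L03 := key 0 3 1 2 4 (by decide) (by decide) (by decide) (by decide) (by decide)
    (by decide) (by decide)
  have L04 := key 0 4 1 2 3 (by decide) (by decide) (by decide) (by decide) (by decide)
    (by decide) (by decide)
  have L12 := key 1 2 0 3 4 (by decide) (by decide) (by decide) (by decide) (by decide)
    (by decide) (by decide)
  have L13 := key 1 3 0 2 4 (by decide) (by decide) (by decide) (by decide) (by decide)
    (by decide) (by decide)
  have L14 := key 1 4 0 2 3 (by decide) (by decide) (by decide) (by decide) (by decide)
    (by decide) (by decide)
  have L23 := key 2 3 0 1 4 (by decide) (by decide) (by decide) (by decide) (by decide)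
    (by decide) (by decide)
  have L24 := key 2 4 0 1 3 (by decide) (by decide) (by decide) (by decide) (by decide)
    (by decide) (by decide)
  have L34 := key 3 4 0 1 2 (by decide) (by decide) (by decide) (by decide) (by decide)
    (by decide) (by decide)
  clear key
  simp only [pairForm, Matrix.cons_val] at L01 L02 L03 L04 L12 L13 L14 L23 L24 L34
  -- A branch stops as soon as the chosen factors imply the four equations of some E_ij, so the 64
  -- choices are not all listed.
  rcases mul_eq_zero.1 e0 with h0 | h0
  · rcases mul_eq_zero.1 e1 with h1 | h1
    · rcases mul_eq_zero.1 e2 with h2 | h2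
      · rcases mul_eq_zero.1 e3 with h3 | h3
        · exact L12 (by grind) (by grind) (by grind) (by grind)
        · exact L04 (by grind) (by grind) (by grind) (by grind)
      · rcases mul_eq_zero.1 e3 with h3 | h3
        · rcases mul_eq_zero.1 e4 with h4 | h4
          · exact L02 (by grind) (by grind) (by grind) (by grind)
          · exact L12 (by grind) (by grind) (by grind) (by grind)
        · rcases mul_eq_zero.1 e4 with h4 | h4
          · exact L04 (by grind) (by grind) (by grind) (by grind)
          · rcases mul_eq_zero.1 e5 with h5 | h5
            · exact L01 (by grind) (by grind) (by grind) (by grind)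
            · exact L01 (by grind) (by grind) (by grind) (by grind)
    · rcases mul_eq_zero.1 e2 with h2 | h2
      · rcases mul_eq_zero.1 e3 with h3 | h3
        · rcases mul_eq_zero.1 e4 with h4 | h4
          · exact L02 (by grind) (by grind) (by grind) (by grind)
          · exact L12 (by grind) (by grind) (by grind) (by grind)
        · exact L13 (by grind) (by grind) (by grind) (by grind)
      · rcases mul_eq_zero.1 e4 with h4 | h4
        · exact L02 (by grind) (by grind) (by grind) (by grind)
        · exact L34 (by grind) (by grind) (by grind) (by grind)
  · rcases mul_eq_zero.1 e1 with h1 | h1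
    · rcases mul_eq_zero.1 e2 with h2 | h2
      · rcases mul_eq_zero.1 e3 with h3 | h3
        · exact L03 (by grind) (by grind) (by grind) (by grind)
        · rcases mul_eq_zero.1 e4 with h4 | h4
          · exact L04 (by grind) (by grind) (by grind) (by grind)
          · exact L03 (by grind) (by grind) (by grind) (by grind)
      · rcases mul_eq_zero.1 e3 with h3 | h3
        · exact L14 (by grind) (by grind) (by grind) (by grind)
        · exact L23 (by grind) (by grind) (by grind) (by grind)
    · rcases mul_eq_zero.1 e2 with h2 | h2
      · rcases mul_eq_zero.1 e3 with h3 | h3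
        · rcases mul_eq_zero.1 e4 with h4 | h4
          · rcases mul_eq_zero.1 e5 with h5 | h5
            · exact L01 (by grind) (by grind) (by grind) (by grind)
            · exact L01 (by grind) (by grind) (by grind) (by grind)
          · exact L03 (by grind) (by grind) (by grind) (by grind)
        · exact L24 (by grind) (by grind) (by grind) (by grind)
      · rcases mul_eq_zero.1 e3 with h3 | h3
        · rcases mul_eq_zero.1 e4 with h4 | h4
          · exact L02 (by grind) (by grind) (by grind) (by grind)
          · exact L01 (by grind) (by grind) (by grind) (by grind)
        · exact L01 (by grind) (by grind) (by grind) (by grind)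

/-- Which pentagon form of each complementary pair vanishes along an exceptional line. -/
def pentagonSide (i j : Fin 5) : Fin 6 → Fin 2 :=
  match min i j, max i j with
  | 0, 1 => ![1, 1, 1, 1, 1, 0]
  | 0, 2 => ![0, 1, 1, 0, 0, 1]
  | 0, 3 => ![1, 0, 0, 0, 1, 1]
  | 0, 4 => ![0, 0, 0, 1, 0, 0]
  | 1, 2 => ![0, 0, 0, 0, 1, 0]
  | 1, 3 => ![0, 1, 0, 1, 0, 1]
  | 1, 4 => ![1, 0, 1, 0, 0, 1]
  | 2, 3 => ![1, 0, 1, 1, 0, 0]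
  | 2, 4 => ![1, 1, 0, 1, 1, 1]
  | 3, 4 => ![0, 1, 1, 0, 1, 0]
  | _, _ => 0

theorem pentagonForm_side {i j : Fin 5} (h : i ≠ j) {z : Fin 6 → ℂ}
    (hz : z ∈ exceptionalLine i j) (k : Fin 6) : pentagonForm k (pentagonSide i j k) z = 0 := by
  wlog hlt : i < j generalizing i j
  · have := this h.symm (by rwa [exceptionalLine_comm]) (by omega)
    rwa [pentagonSide, min_comm, max_comm, ← pentagonSide]
  rw [exceptionalLine, min_eq_left hlt.le, max_eq_right hlt.le, Submodule.mem_span_pair] at hz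
  obtain ⟨a, b, rfl⟩ := hz
  rw [pentagonForm_add, pentagonForm_smul, pentagonForm_smul, pentagonSide, min_eq_left hlt.le,
    max_eq_right hlt.le]
  have key : pentagonForm k (pentagonSide i j k) (exceptionalBasis i j).1 = 0 ∧
      pentagonForm k (pentagonSide i j k) (exceptionalBasis i j).2 = 0 := by
    fin_cases i <;> fin_cases j <;> simp at hlt <;> fin_cases k <;>
      simp [pentagonForm, pentagonSide, exceptionalBasis] <;> norm_num
  rw [pentagonSide, min_eq_left hlt.le, max_eq_right hlt.le] at key
  simp [key]

/-- Any two of the ten lines lie in a common hyperplane cut out by a pentagon form. This makes a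
linear form vanish at two points of a hypothetical further line. -/
theorem exists_common_pentagonSide : ∀ i j i' j' : Fin 5, i ≠ j → i' ≠ j' →
    ∃ k, pentagonSide i j k = pentagonSide i' j' k := by
  decide

theorem formH_exceptionalLine {i j : Fin 5} (h : i ≠ j) {z : Fin 6 → ℂ}
    (hz : z ∈ exceptionalLine i j) (hs : z ∈ surfaceCone) : formH z = 0 := by
  have h0 := pentagonForm_mul hs 0
  have h1 := pentagonForm_side h hz 0
  generalize pentagonSide i j 0 = b at h1
  fin_cases b <;> simp at h1 <;> simpa [h1] using h0

theorem formH_eq_zero_of_form {v : Fin 6 → ℂ} (hs : v ∈ surfaceCone) {k : Fin 6} {b : Fin 2}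
    (h : pentagonForm k b v = 0) : formH v = 0 := by
  have h0 := pentagonForm_mul hs k
  fin_cases b <;> simp at h <;> simpa [h] using h0

/-- A plane contained in the cone over the surface lies in the zero locus of `H`. -/
theorem formH_eq_zero_of_line {v w : Fin 6 → ℂ} (hli : LinearIndependent ℂ ![v, w])
    (h : ∀ a b : ℂ, a • v + b • w ∈ surfaceCone) : formH v = 0 := by
  by_contra hv
  have hne : ∀ t : ℂ, w + t • v ≠ 0 := fun t ht => by
    have := (LinearIndependent.pair_iff.1 hli t 1 (by rw [← ht]; module)).2
    exact one_ne_zero this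
  have hmem : ∀ s t : ℂ, s • w + t • v ∈ surfaceCone := fun s t => by
    rw [add_comm]; exact h t s
  have hv' : v ∈ surfaceCone := by simpa using h 1 0
  -- the restriction of `H` to the line is a quadratic polynomial
  obtain ⟨B, hB⟩ : ∃ B : ℂ, ∀ t, formH (w + t • v) = formH w + B * t + formH v * t ^ 2 := by
    refine ⟨formH (w + v) - formH w - formH v, fun t => ?_⟩
    simp [formH]
    ring
  obtain ⟨a, ha⟩ : ∃ a, formH (w + a • v) = 0 := by
    obtain ⟨s, hs⟩ := IsAlgClosed.exists_pow_nat_eq (discrim (formH v) B (formH w)) two_pos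
    obtain ⟨a, ha⟩ := exists_quadratic_eq_zero hv ⟨s, by rw [← hs, sq]⟩
    exact ⟨a, by rw [hB]; linear_combination ha⟩
  have hroot : ∀ t, formH (w + t • v) = 0 → ∃ i j : Fin 5, i ≠ j ∧ w + t • v ∈ exceptionalLine i j :=
    fun t ht => exists_mem_exceptionalLine fun k => by
      rw [pentagonForm_mul (by simpa using hmem 1 t), ht, neg_zero]
  -- By Vieta this is the second root of H on the line. If the roots differ, a pentagon form common
  -- to the two exceptional lines vanishes at both points, hence at v, and then H(v) = 0.
  by_cases hb : formH (w + (-B / formH v - a) • v) = 0 ∧ -B / formH v - a ≠ a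
  · obtain ⟨i, j, hij, h1⟩ := hroot a ha
    obtain ⟨i', j', hij', h2⟩ := hroot _ hb.1
    obtain ⟨k, hk⟩ := exists_common_pentagonSide i j i' j' hij hij'
    have e1 := pentagonForm_side hij h1 k
    have e2 := pentagonForm_side hij' h2 k
    rw [← hk] at e2
    rw [pentagonForm_add, pentagonForm_smul] at e1 e2
    refine hv (formH_eq_zero_of_form hv' (k := k) (b := pentagonSide i j k) ?_)
    have : (-B / formH v - a - a) * pentagonForm k (pentagonSide i j k) v = 0 := by
      linear_combination e2 - e1
    exact (mul_eq_zero.1 this).resolve_left (sub_ne_zero.2 hb.2)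
  -- For a double root at w + a v, each product A_k B_k is a nonzero multiple of t² along the line
  -- centred there. Both factors must then vanish at the centre for every k, which makes the centre
  -- zero.
  · have hBa : B = -2 * a * formH v := by
      by_contra hne'
      apply hb
      constructor
      · rw [hB] at ha ⊢
        field_simp
        linear_combination formH v * ha
      · intro hh
        apply hne'
        field_simp at hh
        linear_combination -hh
    refine hne a (eq_zero_of_pentagonForm fun k => ?_)
    have hexp : ∀ t : ℂ, formH (w + a • v + t • v) = formH v * t ^ 2 := fun t => by
      rw [show w + a • v + t • v = w + (a + t) • v by module, hB]
      rw [hB] at ha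
      linear_combination ha + t * hBa
    have hprod : ∀ t : ℂ, (pentagonForm k 0 (w + a • v) + t * pentagonForm k 0 v) *
        (pentagonForm k 1 (w + a • v) + t * pentagonForm k 1 v) = -(formH v * t ^ 2) := fun t => by
      rw [← hexp, ← pentagonForm_smul, ← pentagonForm_smul, ← pentagonForm_add,
        ← pentagonForm_add, pentagonForm_mul]
      rw [show w + a • v + t • v = (1 : ℂ) • w + (a + t) • v by module]
      exact hmem _ _
    have hn : ∀ b, pentagonForm k b v ≠ 0 := fun b hb0 => hv (formH_eq_zero_of_form hv' hb0)
    have p0 := hprod 0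
    have p1 := hprod 1
    have p2 := hprod (-1)
    have hm := pentagonForm_mul hv' k
    have hn0 := hn 0
    have hn1 := hn 1
    set x := pentagonForm k 0 (w + a • v)
    set y := pentagonForm k 1 (w + a • v)
    have q0 : x * y = 0 := by linear_combination p0
    have q1 : x * pentagonForm k 1 v + y * pentagonForm k 0 v = 0 := by
      linear_combination (p1 - p2) / 2
    have hxy : x = 0 ∧ y = 0 := by
      rcases mul_eq_zero.1 q0 with h0 | h0
      · exact ⟨h0, by simpa [h0, hn0] using q1⟩
      · exact ⟨by simpa [h0, hn1] using q1, h0⟩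
    intro b
    fin_cases b
    exacts [hxy.1, hxy.2]

/-! ### The exceptional lines lie on the surface -/

/-- The bihomogeneous form of the blow-up map. -/
def blowUpForm (a s b t : ℂ) : Fin 6 → ℂ :=
  ![a ^ 2 * b ^ 2 - s ^ 2 * t ^ 2, a * s * b ^ 2 - s ^ 2 * t ^ 2, a ^ 2 * b * t - s ^ 2 * t ^ 2,
    a * s * b * t - s ^ 2 * t ^ 2, s ^ 2 * b * t - s ^ 2 * t ^ 2, a * s * t ^ 2 - s ^ 2 * t ^ 2]

theorem eventually_add_mul_ne (c : ℂ) {d : ℂ} (hd : d ≠ 0) :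
    ∀ᶠ t in 𝓝[≠] (0 : ℂ), c + d * t ≠ 0 := by
  by_cases hc : c = 0
  · filter_upwards [self_mem_nhdsWithin] with t ht
    simpa [hc, hd] using ht
  · exact eventually_ne_zero_of_continuous (by fun_prop) (by simpa using hc)

theorem blowUpForm_mem (a s b t : ℂ) : blowUpForm a s b t ∈ surfaceCone := by
  have hf : Continuous fun e : ℂ => blowUpForm a (s + 1 * e) b (t + 1 * e) := by
    unfold blowUpForm
    fun_prop
  have := mem_of_punctured isClosed_surfaceCone hf.continuousAt ?_
  · simpa using this
  filter_upwards [eventually_add_mul_ne s one_ne_zero, eventually_add_mul_ne t one_ne_zero]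
    with e hs ht
  refine subset_closure ⟨(s + 1 * e) ^ 2 * (t + 1 * e) ^ 2, a / (s + 1 * e), b / (t + 1 * e), ?_⟩
  generalize s + 1 * e = s at hs
  generalize t + 1 * e = t at ht
  ext k
  fin_cases k <;> simp [blowUpForm, blowUpMap] <;> field_simp

theorem mem_surfaceCone_of_smul {v : Fin 6 → ℂ} {c : ℂ} (hc : c ≠ 0) (h : c • v ∈ surfaceCone) :
    v ∈ surfaceCone := by
  simpa [smul_smul, hc] using smul_mem_surfaceCone h c⁻¹

/-- The explicit parametrizations of the lines carry factors such as p, q, p + q or p - 2q, which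
have to be divided out. Closedness restores the excluded combinations. -/
theorem mem_surfaceCone_of_generic {A B : Fin 6 → ℂ} (x y : ℂ)
    (h : ∀ p q : ℂ, p ≠ 0 → q ≠ 0 → p + q ≠ 0 → p - 2 * q ≠ 0 → p • A + q • B ∈ surfaceCone) :
    x • A + y • B ∈ surfaceCone := by
  -- With slopes 1 and 2, each of p, q, p + q and p - 2q varies with e, so each is nonzero for small
  -- e ≠ 0.
  have hf : Continuous fun e : ℂ => (x + 1 * e) • A + (y + 2 * e) • B := by fun_prop
  have := mem_of_punctured isClosed_surfaceCone hf.continuousAt ?_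
  · simpa using this
  filter_upwards [eventually_add_mul_ne x one_ne_zero, eventually_add_mul_ne y two_ne_zero,
    eventually_add_mul_ne (x + y) three_ne_zero,
    eventually_add_mul_ne (x - 2 * y) (show (-3 : ℂ) ≠ 0 by norm_num)] with e h1 h2 h3 h4
  refine h _ _ h1 h2 ?_ ?_
  · convert h3 using 1; ring
  · convert h4 using 1; ring

/-- Seven of the lines are images of the curves σ, τ ∈ {0, 1, ∞} and στ = 1 on ℙ¹ × ℙ¹. The other
three are exceptional curves over (1, 1), (∞, 0) and (0, ∞), obtained as limits along arcs through
these points in varying directions. -/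
theorem exceptionalLine_subset {i j : Fin 5} (h : i ≠ j) {z : Fin 6 → ℂ}
    (hz : z ∈ exceptionalLine i j) : z ∈ surfaceCone := by
  wlog hlt : i < j generalizing i j
  · exact this h.symm (by rwa [exceptionalLine_comm]) (by omega)
  rw [exceptionalLine, min_eq_left hlt.le, max_eq_right hlt.le, Submodule.mem_span_pair] at hz
  obtain ⟨x, y, rfl⟩ := hz
  refine mem_surfaceCone_of_generic x y fun p q hp hq hpq hpq' => ?_
  have lim : ∀ (v : Fin 6 → ℂ) (f : ℂ → Fin 6 → ℂ), Continuous f → f 0 = v →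
      (∀ e, e • f e ∈ surfaceCone) → v ∈ surfaceCone := fun v f hf h0 he => by
    rw [← h0]
    refine mem_of_punctured isClosed_surfaceCone hf.continuousAt ?_
    filter_upwards [self_mem_nhdsWithin] with e hne
    exact mem_surfaceCone_of_smul hne (he e)
  fin_cases i <;> fin_cases j <;> simp at hlt
  -- The arc σ = 1 + pe, τ = 1 + qe through (1, 1); the vector is its image divided by e.
  · refine lim _ (fun e => ![(p + q + p * q * e) * (2 + e * (p + q + p * q * e)),
      (p + q + p * q * e) + q + e * (p + q + p * q * e) * q,
      (p + q + p * q * e) + p + e * (p + q + p * q * e) * p, p + q + p * q * e, q, p])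
      (by fun_prop) ?_ fun e => ?_
    · ext k
      fin_cases k <;> simp [exceptionalBasis] <;> ring
    · convert blowUpForm_mem (1 + p * e) 1 (1 + q * e) 1 using 1
      ext k
      fin_cases k <;> simp [blowUpForm] <;> ring
  · refine mem_surfaceCone_of_smul hp ?_
    convert blowUpForm_mem p q 1 0 using 1
    ext k
    fin_cases k <;> simp [blowUpForm, exceptionalBasis] <;> ring
  · refine lim _ (fun e => ![e * p ^ 2 - e * q ^ 2, e ^ 2 * p ^ 2 * q - e * q ^ 2, p - e * q ^ 2,
      e * q * p - e * q ^ 2, e ^ 2 * q ^ 2 * p - e * q ^ 2, q - e * q ^ 2])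
      (by fun_prop) ?_ fun e => ?_
    · ext k
      fin_cases k <;> simp [exceptionalBasis]
    · convert blowUpForm_mem 1 (e * q) (e * p) 1 using 1
      ext k
      fin_cases k <;> simp [blowUpForm] <;> ring
  · refine mem_surfaceCone_of_smul (neg_ne_zero.2 hp) ?_
    convert blowUpForm_mem 0 1 (p - q) p using 1
    ext k
    fin_cases k <;> simp [blowUpForm, exceptionalBasis] <;> ring
  · refine mem_surfaceCone_of_smul (neg_ne_zero.2 hp) ?_
    convert blowUpForm_mem (p - q) p 0 1 using 1
    ext k
    fin_cases k <;> simp [blowUpForm, exceptionalBasis] <;> ring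
  · refine lim _ (fun e => ![e * p ^ 2 - e * q ^ 2, p - e * q ^ 2, e ^ 2 * p ^ 2 * q - e * q ^ 2,
      e * q * p - e * q ^ 2, q - e * q ^ 2, e ^ 2 * q ^ 2 * p - e * q ^ 2])
      (by fun_prop) ?_ fun e => ?_
    · ext k
      fin_cases k <;> simp [exceptionalBasis]
    · convert blowUpForm_mem (e * p) 1 1 (e * q) using 1
      ext k
      fin_cases k <;> simp [blowUpForm] <;> ring
  · refine mem_surfaceCone_of_smul hp ?_
    convert blowUpForm_mem 1 0 p q using 1
    ext k
    fin_cases k <;> simp [blowUpForm, exceptionalBasis] <;> ring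
  · refine mem_surfaceCone_of_smul hpq' ?_
    convert blowUpForm_mem (p - q) q 1 1 using 1
    ext k
    fin_cases k <;> simp [blowUpForm, exceptionalBasis] <;> ring
  · refine mem_surfaceCone_of_smul (mul_ne_zero (neg_ne_zero.2 (mul_ne_zero hp hq)) hpq) ?_
    convert blowUpForm_mem (-q) p p (-q) using 1
    ext k
    fin_cases k <;> simp [blowUpForm, exceptionalBasis] <;> ring
  · refine mem_surfaceCone_of_smul hpq' ?_
    convert blowUpForm_mem 1 1 (p - q) q using 1
    ext k
    fin_cases k <;> simp [blowUpForm, exceptionalBasis] <;> ring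

/-! ### The ten lines and the degenerate member of the Wiman pencil -/

theorem points_exceptionalLine_subset {i j : Fin 5} (h : i ≠ j) :
    points (exceptionalLine i j) ⊆ dP5 := fun _ hz => exceptionalLine_subset h hz

theorem linesOn_dP5 : linesOn dP5 = {L | ∃ i j : Fin 5, i ≠ j ∧ L = exceptionalLine i j} := by
  ext L
  constructor
  · rintro ⟨hr, hL⟩
    have hLs : ∀ v ∈ L, v ∈ surfaceCone := fun v hv => by
      by_cases h0 : v = 0
      · simpa [h0] using smul_mem_surfaceCone (blowUpForm_mem 0 0 0 0) 0
      · exact (mk_mem_dP5 h0).1 (hL ((mk_mem_points h0).2 hv))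
    have hH : ∀ v ∈ L, formH v = 0 := fun v hv => by
      by_cases h0 : v = 0
      · simp [h0, formH]
      obtain ⟨w, hw⟩ := exists_linearIndependent_pair_of_one_lt_finrank (R := ℂ) (M := L)
        (by omega) (x := ⟨v, hv⟩) (by simpa using h0)
      refine formH_eq_zero_of_line (v := v) (w := w) ?_ fun a b =>
        hLs _ (L.add_mem (L.smul_mem a hv) (L.smul_mem b w.2))
      have := hw.map' L.subtype L.ker_subtype
      have e : ⇑L.subtype ∘ ![⟨v, hv⟩, w] = ![v, (w : Fin 6 → ℂ)] := by
        funext k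
        fin_cases k <;> rfl
      rw [e] at this
      exact this
    -- A vector space over an infinite field is not a finite union of proper subspaces, so one of
    -- the ten lines contains all of L.
    have hcover : ⋃ p : {p : Fin 5 × Fin 5 // p.1 ≠ p.2},
        (((exceptionalLine p.1.1 p.1.2).comap L.subtype : Submodule ℂ L) : Set L) = Set.univ := by
      refine Set.eq_univ_of_forall fun v => ?_
      obtain ⟨i, j, hij, hm⟩ := exists_mem_exceptionalLine (z := v.1) fun k => by
        rw [pentagonForm_mul (hLs _ v.2), hH _ v.2, neg_zero]
      exact Set.mem_iUnion.2 ⟨⟨(i, j), hij⟩, hm⟩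
    obtain ⟨p, hp⟩ := Subspace.exists_eq_top_of_iUnion_eq_univ hcover
    refine ⟨p.1.1, p.1.2, p.2, ?_⟩
    have hle : L ≤ exceptionalLine p.1.1 p.1.2 := by
      rwa [Submodule.comap_subtype_eq_top] at hp
    exact Submodule.eq_of_le_of_finrank_eq hle (by rw [hr, finrank_exceptionalLine p.2])
  · rintro ⟨i, j, hij, rfl⟩
    exact ⟨finrank_exceptionalLine hij, points_exceptionalLine_subset hij⟩

theorem wimanCurve_infinity {φ : ℂ} (hφ : φ ≠ 0) :
    wimanCurve 0 φ = {z | ∃ i j : Fin 5, i ≠ j ∧ z ∈ points (exceptionalLine i j)} := by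
  ext z
  simp only [wimanCurve, zero_mul, zero_add, mul_eq_zero, hφ, false_or, Set.mem_ofPred_eq]
  constructor
  · rintro ⟨hz, hH⟩
    exact exists_mem_exceptionalLine fun k => by
      rw [pentagonForm_mul (show z.rep ∈ surfaceCone from hz), hH, neg_zero]
  · rintro ⟨i, j, hij, hz⟩
    have hs := exceptionalLine_subset hij hz
    exact ⟨hs, formH_exceptionalLine hij hz hs⟩

theorem ncard_linesOn_dP5 : (linesOn dP5).ncard = 10 := by
  have hset : linesOn dP5 = (fun p : Fin 5 × Fin 5 => exceptionalLine p.1 p.2) ''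
      ((Finset.univ.filter fun p : Fin 5 × Fin 5 => p.1 < p.2 : Finset (Fin 5 × Fin 5)) :
        Set (Fin 5 × Fin 5)) := by
    rw [linesOn_dP5]
    ext L
    simp only [Set.mem_ofPred_eq, Set.mem_image, Finset.coe_filter, Finset.mem_univ, true_and,
      Prod.exists]
    constructor
    · rintro ⟨i, j, hij, rfl⟩
      rcases lt_or_gt_of_ne hij with h | h
      · exact ⟨i, j, h, rfl⟩
      · exact ⟨j, i, h, exceptionalLine_comm j i⟩
    · rintro ⟨i, j, hij, rfl⟩
      exact ⟨i, j, hij.ne, rfl⟩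
  rw [hset, Set.InjOn.ncard_image, Set.ncard_coe_finset]
  · decide
  · rintro ⟨i, j⟩ h ⟨i', j'⟩ h' he
    simp only [Finset.coe_filter, Finset.mem_univ, true_and, Set.mem_ofPred_eq] at h h'
    rcases (exceptionalLine_eq_iff h.ne h'.ne).1 he with ⟨rfl, rfl⟩ | ⟨rfl, rfl⟩
    · rfl
    · exact absurd h h'.not_gt

/-! ### The rational map given by the fifth powers of the Plücker coordinates -/

theorem eval_smul_of_isHomogeneous {ι : Type} {p : MvPolynomial ι ℂ} {d : ℕ}
    (hp : p.IsHomogeneous d) (c : ℂ) (v : ι → ℂ) :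
    MvPolynomial.eval (c • v) p = c ^ d * MvPolynomial.eval v p := by
  rw [MvPolynomial.eval_eq, MvPolynomial.eval_eq, Finset.mul_sum]
  refine Finset.sum_congr rfl fun m hm => ?_
  have hd : ∑ i ∈ m.support, m i = d := by
    rw [← hp (MvPolynomial.mem_support_iff.1 hm), Finsupp.weight_apply]
    simp [Finsupp.sum]
  simp only [Pi.smul_apply, smul_eq_mul, mul_pow, Finset.prod_mul_distrib,
    Finset.prod_pow_eq_pow_sum, hd]
  ring

/-- The linear form with given coefficients. -/
noncomputable def linearPoly (c : Fin 6 → ℂ) : MvPolynomial (Fin 6) ℂ :=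
  ∑ k, MvPolynomial.C (c k) * MvPolynomial.X k

theorem linearPoly_isHomogeneous (c : Fin 6 → ℂ) : (linearPoly c).IsHomogeneous 1 :=
  MvPolynomial.IsHomogeneous.sum _ _ _ fun k _ => by
    simpa using (MvPolynomial.isHomogeneous_C (Fin 6) (c k)).mul
      (MvPolynomial.isHomogeneous_X ℂ k)

theorem eval_linearPoly (c v : Fin 6 → ℂ) :
    MvPolynomial.eval v (linearPoly c) = ∑ k, c k * v k := by
  simp [linearPoly]

/-- The coefficients of twice the linear forms multiplying `H` in the cubic forms defining the
rational map. -/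
def correctionCoeff : Fin 5 → Fin 5 → Fin 6 → ℂ :=
  ![![0, ![-1, -1, -1, 6, -1, -1], ![0, 0, 2, -2, 2, -1],
      ![2, -1, 0, -2, -1, 0], ![-1, 2, -1, -2, 0, 2]],
    ![![1, 1, 1, -6, 1, 1], 0, ![1, 1, -2, 2, -2, 0],
      ![-2, 0, 1, 2, 0, 1], ![0, -2, 0, 2, 1, -2]],
    ![![0, 0, -2, 2, -2, 1], ![-1, -1, 2, -2, 2, 0], 0,
      ![2, -1, -2, 0, 2, 1], ![-1, 2, 2, 0, -2, -2]],
    ![![-2, 1, 0, 2, 1, 0], ![2, 0, -1, -2, 0, -1], ![-2, 1, 2, 0, -2, -1],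
      0, ![2, -2, -1, 0, 1, 2]],
    ![![1, -2, 1, 2, 0, -2], ![0, 2, 0, -2, -1, 2], ![1, -2, -2, 0, 2, 2],
      ![-2, 2, 1, 0, -1, -2], 0]]

theorem eval_pairForm (a b : Fin 5) (v : Fin 6 → ℂ) :
    MvPolynomial.eval v (linearPoly fun k => pairForm (Pi.single k 1) a b) = pairForm v a b := by
  rw [eval_linearPoly, Fin.sum_univ_six]
  fin_cases a <;> fin_cases b <;> simp [pairForm] <;> ring

theorem eval_pentagonForm (k : Fin 6) (b : Fin 2) (v : Fin 6 → ℂ) :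
    MvPolynomial.eval v (linearPoly fun l => pentagonForm k b (Pi.single l 1)) =
      pentagonForm k b v := by
  rw [eval_linearPoly, Fin.sum_univ_six]
  fin_cases k <;> fin_cases b <;> simp [pentagonForm] <;> ring

/-- The cubic forms on `ℙ⁵` defining the rational map. -/
noncomputable def pluckerCubic (a : Fin 5 × Fin 5) : MvPolynomial (Fin 6) ℂ :=
  (∑ i, ∑ j, linearPoly (fun k => pairForm (Pi.single k 1) i j) *
      linearPoly (fun k => pairForm (Pi.single k 1) i j)) *
    linearPoly (fun k => pairForm (Pi.single k 1) a.1 a.2) -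
  linearPoly (fun l => pentagonForm 0 0 (Pi.single l 1)) *
    linearPoly (fun l => pentagonForm 0 1 (Pi.single l 1)) *
    linearPoly (fun k => 4 * correctionCoeff a.1 a.2 k)

theorem pluckerCubic_isHomogeneous (a : Fin 5 × Fin 5) : (pluckerCubic a).IsHomogeneous 3 := by
  have h := linearPoly_isHomogeneous
  refine MvPolynomial.IsHomogeneous.sub (MvPolynomial.IsHomogeneous.mul (m := 2) (n := 1)
    (MvPolynomial.IsHomogeneous.sum _ _ _ fun i _ => MvPolynomial.IsHomogeneous.sum _ _ _
      fun j _ => (h _).mul (h _)) (h _)) (((h _).mul (h _)).mul (h _))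

/-- In the cubics Σ ω² stands for 8G, and the product of the first pentagon pair stands for -H. The
latter agrees only on the surface. -/
theorem eval_pluckerCubic {v : Fin 6 → ℂ} (hv : v ∈ surfaceCone) (a : Fin 5 × Fin 5) :
    MvPolynomial.eval v (pluckerCubic a) =
      8 * formG v * pairForm v a.1 a.2 +
        4 * formH v * ∑ k, correctionCoeff a.1 a.2 k * v k := by
  have h1 := sum_sq_pairForm v
  have h2 := pentagonForm_mul hv 0
  have h3 : MvPolynomial.eval v (linearPoly fun k => 4 * correctionCoeff a.1 a.2 k) =
      4 * ∑ k, correctionCoeff a.1 a.2 k * v k := by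
    simp only [eval_linearPoly, mul_assoc, ← Finset.mul_sum]
  simp only [pluckerCubic, map_sub, map_mul, map_sum, eval_pairForm, eval_pentagonForm, h2, h3]
  simp only [← sq, h1]
  ring

theorem eval_pluckerCubic_line {i j : Fin 5} (h : i ≠ j) {v : Fin 6 → ℂ}
    (hv : v ∈ exceptionalLine i j) (a : Fin 5 × Fin 5) :
    MvPolynomial.eval v (pluckerCubic a) = 8 * formG v * pairForm v a.1 a.2 := by
  have hs := exceptionalLine_subset h hv
  rw [eval_pluckerCubic hs, formH_exceptionalLine h hv hs]
  ring

theorem blowUpMap_mem (σ τ : ℂ) : blowUpMap σ τ ∈ surfaceCone :=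
  subset_closure ⟨1, σ, τ, (one_smul _ _).symm⟩

/-- The common factor of the fifth powers of the Plücker coordinates of the family. -/
def commonFactor (σ τ : ℂ) : ℂ := σ ^ 4 * τ ^ 4 * (1 - σ) * (1 - τ) * (1 - σ * τ)

set_option maxHeartbeats 1600000 in
theorem IsFamilyLine.plucker_pow {σ τ : ℂ} {x y : Fin 5 → ℂ} (h : IsFamilyLine σ τ x y)
    (a : Fin 5 × Fin 5) : 8 * plucker x y a ^ 5 =
      commonFactor σ τ * MvPolynomial.eval (blowUpMap σ τ) (pluckerCubic a) := by
  obtain ⟨a₁, a₂, b₁, b₂, b₃, s, t, h₁, h₂, h₃, h₄, h₅, hs, ht, hx, hy⟩ := h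
  -- A line of the family is the diagonal rescaling by m of the line through p and q, which has
  -- polynomial coordinates. Its Plücker coordinates acquire the factors m_a m_b, so their fifth
  -- powers involve no roots.
  let m : Fin 5 → ℂ := ![a₁, a₂, -(t * b₁), b₂, -(s * b₃)]
  let M : Fin 5 → ℂ := ![alphaFifth σ τ, alphaFifth τ σ, -(τ ^ 4 * betaFifth σ),
    betaFifth (σ * τ), -(σ ^ 4 * betaFifth τ)]
  let p : Fin 5 → ℂ := ![1, 0, σ, σ, 1]
  let q : Fin 5 → ℂ := ![0, 1, 1, τ, τ]
  have hm : ∀ k, m k ^ 5 = M k := fun k => by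
    fin_cases k <;> simp [m, M, h₁, h₂, ← h₃, h₄, ← h₅, ← hs, ← ht] <;> ring
  have hx' : ∀ k, x k = m k * p k := fun k => by
    fin_cases k <;> simp [hx, m, p]
  have hy' : ∀ k, y k = m k * q k := fun k => by
    fin_cases k <;> simp [hy, m, q]
  have hpow : plucker x y a ^ 5 = M a.1 * M a.2 * (p a.1 * q a.2 - p a.2 * q a.1) ^ 5 := by
    rw [← hm, ← hm, plucker, hx', hx', hy', hy']
    ring
  rw [hpow, eval_pluckerCubic (blowUpMap_mem σ τ), formG_blowUpMap, formH_blowUpMap]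
  obtain ⟨i, j⟩ := a
  clear hpow hx' hy' hm hx hy
  fin_cases i <;> fin_cases j <;>
    simp [M, p, q, alphaFifth, betaFifth, commonFactor, pairForm, correctionCoeff,
      blowUpMap, Fin.sum_univ_six] <;> ring

theorem exists_isFamilyLine (σ τ : ℂ) : ∃ x y, IsFamilyLine σ τ x y := by
  have r : ∀ c : ℂ, ∃ z, z ^ 5 = c := fun c => IsAlgClosed.exists_pow_nat_eq c (by norm_num)
  obtain ⟨a₁, h₁⟩ := r (alphaFifth σ τ)
  obtain ⟨a₂, h₂⟩ := r (alphaFifth τ σ)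
  obtain ⟨b₁, h₃⟩ := r (betaFifth σ)
  obtain ⟨b₂, h₄⟩ := r (betaFifth (σ * τ))
  obtain ⟨b₃, h₅⟩ := r (betaFifth τ)
  obtain ⟨s, hs⟩ := r (σ ^ 4)
  obtain ⟨t, ht⟩ := r (τ ^ 4)
  exact ⟨_, _, a₁, a₂, b₁, b₂, b₃, s, t, h₁, h₂, h₃, h₄, h₅, hs, ht, rfl, rfl⟩

theorem pluckerCubic_compatible {σ τ : ℂ} {x y : Fin 5 → ℂ} (h : IsFamilyLine σ τ x y)
    (a b : Fin 5 × Fin 5) :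
    MvPolynomial.eval (blowUpMap σ τ) (pluckerCubic a) * plucker x y b ^ 5 =
      MvPolynomial.eval (blowUpMap σ τ) (pluckerCubic b) * plucker x y a ^ 5 := by
  have ha := h.plucker_pow a
  have hb := h.plucker_pow b
  linear_combination MvPolynomial.eval (blowUpMap σ τ) (pluckerCubic a) * hb / 8 -
    MvPolynomial.eval (blowUpMap σ τ) (pluckerCubic b) * ha / 8

open MvPolynomial in
/-- Two polynomial functions on the plane agree if they agree up to the common factor. -/
theorem eq_of_commonFactor_mul {p : MvPolynomial (Fin 2) ℂ}
    (h : ∀ σ τ : ℂ, commonFactor σ τ * eval ![σ, τ] p = 0) (σ τ : ℂ) : eval ![σ, τ] p = 0 := by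
  let K : MvPolynomial (Fin 2) ℂ :=
    X 0 ^ 4 * X 1 ^ 4 * (1 - X 0) * (1 - X 1) * (1 - X 0 * X 1)
  have hK : ∀ σ τ : ℂ, eval ![σ, τ] K = commonFactor σ τ := fun σ τ => by
    simp [K, commonFactor]
  have hKp : K * p = 0 := by
    refine MvPolynomial.funext fun x => ?_
    have hx : x = ![x 0, x 1] := by
      ext k
      fin_cases k <;> rfl
    rw [map_mul, map_zero, hx, hK, h]
  have hK0 : K ≠ 0 := fun h0 => by
    have := hK 2 2
    rw [h0, map_zero] at this
    norm_num [commonFactor] at this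
  rw [(mul_eq_zero.1 hKp).resolve_left hK0, map_zero]

/-- The blow-up map as a tuple of polynomials. -/
noncomputable def blowUpPoly : Fin 6 → MvPolynomial (Fin 2) ℂ :=
  open MvPolynomial in
  ![X 0 ^ 2 * X 1 ^ 2 - 1, X 0 * X 1 ^ 2 - 1, X 0 ^ 2 * X 1 - 1, X 0 * X 1 - 1, X 1 - 1, X 0 - 1]

theorem eval_bind₁_blowUpPoly (σ τ : ℂ) (p : MvPolynomial (Fin 6) ℂ) :
    MvPolynomial.eval ![σ, τ] (MvPolynomial.bind₁ blowUpPoly p) =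
      MvPolynomial.eval (blowUpMap σ τ) p := by
  have : (fun k => MvPolynomial.eval ![σ, τ] (blowUpPoly k)) = blowUpMap σ τ := by
    ext k
    fin_cases k <;> simp [blowUpPoly, blowUpMap]
  rw [← this]
  exact MvPolynomial.eval₂Hom_bind₁ _ _ _ _

/-- Any two systems of forms defining the rational map are proportional on the surface. -/
theorem eval_mul_pluckerCubic {d : ℕ} {Q : Fin 5 × Fin 5 → MvPolynomial (Fin 6) ℂ}
    (hQ : ∀ a, (Q a).IsHomogeneous d)
    (hc : ∀ (σ τ : ℂ) (x y : Fin 5 → ℂ), IsFamilyLine σ τ x y → ∀ a b,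
      MvPolynomial.eval (blowUpMap σ τ) (Q a) * plucker x y b ^ 5 =
        MvPolynomial.eval (blowUpMap σ τ) (Q b) * plucker x y a ^ 5)
    {v : Fin 6 → ℂ} (hv : v ∈ surfaceCone) (a b : Fin 5 × Fin 5) :
    MvPolynomial.eval v (Q a) * MvPolynomial.eval v (pluckerCubic b) =
      MvPolynomial.eval v (Q b) * MvPolynomial.eval v (pluckerCubic a) := by
  have hcl : IsClosed {v | MvPolynomial.eval v (Q a) * MvPolynomial.eval v (pluckerCubic b) =
      MvPolynomial.eval v (Q b) * MvPolynomial.eval v (pluckerCubic a)} :=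
    isClosed_eq ((MvPolynomial.continuous_eval _).mul (MvPolynomial.continuous_eval _))
      ((MvPolynomial.continuous_eval _).mul (MvPolynomial.continuous_eval _))
  refine closure_minimal ?_ hcl hv
  rintro _ ⟨c, σ, τ, rfl⟩
  -- The family gives the identity only after multiplication by `commonFactor`, which vanishes on
  -- some curves. Pulled back to polynomials in σ, τ, this factor can be cancelled.
  have key : ∀ σ τ : ℂ, MvPolynomial.eval ![σ, τ] (MvPolynomial.bind₁ blowUpPoly
      (Q a * pluckerCubic b - Q b * pluckerCubic a)) = 0 := by
    refine eq_of_commonFactor_mul fun σ τ => ?_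
    obtain ⟨x, y, hxy⟩ := exists_isFamilyLine σ τ
    have ha := hxy.plucker_pow a
    have hb := hxy.plucker_pow b
    have hq := hc σ τ x y hxy a b
    rw [eval_bind₁_blowUpPoly, map_sub, map_mul, map_mul]
    linear_combination 8 * hq - MvPolynomial.eval (blowUpMap σ τ) (Q a) * hb +
      MvPolynomial.eval (blowUpMap σ τ) (Q b) * ha
  have h0 := key σ τ
  rw [eval_bind₁_blowUpPoly, map_sub, map_mul, map_mul] at h0
  simp only [Set.mem_ofPred_eq, eval_smul_of_isHomogeneous (hQ _),
    eval_smul_of_isHomogeneous (pluckerCubic_isHomogeneous _)]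
  linear_combination c ^ d * c ^ 3 * h0

theorem formG_add_smul (v w : Fin 6 → ℂ) : ∃ B : ℂ, ∀ t : ℂ,
    formG (v + t • w) = formG v + B * t + formG w * t ^ 2 := by
  refine ⟨formG (v + w) - formG v - formG w, fun t => ?_⟩
  simp [formG]
  ring

theorem pairForm_ne_zero {z : Fin 6 → ℂ} (hz : z ≠ 0) : (fun a : Fin 5 × Fin 5 =>
    pairForm z a.1 a.2) ≠ 0 := fun h => hz (by rw [← ofPairs_pairForm z, h, map_zero])

theorem exists_formG_ne_zero {i j : Fin 5} (h : i ≠ j) :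
    ∃ z ∈ exceptionalLine i j, formG z ≠ 0 := by
  obtain ⟨k, l, m, hki, hkj, hli, hlj, hmi, hmj, hkl, hkm, hlm⟩ := exists_others i j h
  let u : Fin 5 → ℂ := Pi.single k 1 - Pi.single l 1
  have hi : u i = 0 := by simp [u, *, hki.symm, hli.symm]
  have hj : u j = 0 := by simp [u, *, hkj.symm, hlj.symm]
  have hu : ∑ a, u a = 0 := by simp [u, Finset.sum_sub_distrib]
  refine ⟨linePoint i j u, linePoint_mem h hi hj hu, fun h0 => ?_⟩
  have := formG_exceptionalLine h ⟨hki, hkj⟩ ⟨hli, hlj⟩ ⟨hmi, hmj⟩ hkl hkm hlm hi hj hu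
  rw [h0] at this
  norm_num [u, hkl, hkl.symm, hkm.symm, hlm.symm] at this

/-- Comparing with the cubics gives this relation multiplied by 8G. Since G is not identically zero
on E_ij, continuity extends it to the zeros of G, where g might be defined by other forms. -/
theorem proportional_on_line {i j : Fin 5} (h : i ≠ j) {d : ℕ}
    {Q : Fin 5 × Fin 5 → MvPolynomial (Fin 6) ℂ} (hQ : ∀ a, (Q a).IsHomogeneous d)
    (hc : ∀ (σ τ : ℂ) (x y : Fin 5 → ℂ), IsFamilyLine σ τ x y → ∀ a b,
      MvPolynomial.eval (blowUpMap σ τ) (Q a) * plucker x y b ^ 5 =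
        MvPolynomial.eval (blowUpMap σ τ) (Q b) * plucker x y a ^ 5)
    {v : Fin 6 → ℂ} (hv : v ∈ exceptionalLine i j) (a b : Fin 5 × Fin 5) :
    MvPolynomial.eval v (Q a) * pairForm v b.1 b.2 =
      MvPolynomial.eval v (Q b) * pairForm v a.1 a.2 := by
  have hG : ∀ w ∈ exceptionalLine i j, formG w ≠ 0 →
      MvPolynomial.eval w (Q a) * pairForm w b.1 b.2 =
        MvPolynomial.eval w (Q b) * pairForm w a.1 a.2 := fun w hw h0 => by
    have := eval_mul_pluckerCubic hQ hc (exceptionalLine_subset h hw) a b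
    rw [eval_pluckerCubic_line h hw, eval_pluckerCubic_line h hw] at this
    refine mul_left_cancel₀ (mul_ne_zero (by norm_num : (8 : ℂ) ≠ 0) h0) ?_
    linear_combination this
  by_cases h0 : formG v = 0
  · obtain ⟨w, hw, hw0⟩ := exists_formG_ne_zero h
    obtain ⟨B, hB⟩ := formG_add_smul v w
    have hcl : IsClosed {v | MvPolynomial.eval v (Q a) * pairForm v b.1 b.2 =
        MvPolynomial.eval v (Q b) * pairForm v a.1 a.2} :=
      isClosed_eq ((MvPolynomial.continuous_eval _).mul (continuous_pairForm _ _))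
        ((MvPolynomial.continuous_eval _).mul (continuous_pairForm _ _))
    have := mem_of_punctured hcl (f := fun t : ℂ => v + t • w) (by fun_prop) ?_
    · simpa using this
    filter_upwards [eventually_add_mul_ne B hw0, self_mem_nhdsWithin] with t ht ht0
    refine hG _ (Submodule.add_mem _ hv (Submodule.smul_mem _ t hw)) ?_
    rw [hB, h0]
    have : (0 : ℂ) + B * t + formG w * t ^ 2 = t * (B + formG w * t) := by ring
    rw [this]
    exact mul_ne_zero ht0 ht
  · exact hG v hv h0

/-- Along an exceptional line the value of the rational map is given by the linear forms. -/
theorem IsPluckerFifthValue.rep_eq {i j : Fin 5} (h : i ≠ j) {z : PSpace (Fin 6)}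
    {q : PSpace (Fin 5 × Fin 5)} (hz : z ∈ points (exceptionalLine i j))
    (hq : IsPluckerFifthValue z q) :
    ∃ c : ℂ, c ≠ 0 ∧ ∀ a : Fin 5 × Fin 5, q.rep a = c * pairForm z.rep a.1 a.2 := by
  obtain ⟨-, d, Q, hQ, hc, hne, rfl⟩ := hq
  obtain ⟨c, hc0, hrep⟩ := exists_rep_mk _ hne
  obtain ⟨b, hb⟩ := Function.ne_iff.1 (pairForm_ne_zero z.rep_nonzero)
  have hb' : pairForm z.rep b.1 b.2 ≠ 0 := hb
  have key : ∀ a, MvPolynomial.eval z.rep (Q a) =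
      MvPolynomial.eval z.rep (Q b) / pairForm z.rep b.1 b.2 * pairForm z.rep a.1 a.2 :=
    fun a => by
      have := proportional_on_line h hQ hc hz a b
      field_simp
      linear_combination this
  have hQb : MvPolynomial.eval z.rep (Q b) ≠ 0 := fun h0 => hne <| by
    ext a
    rw [key, h0]
    simp
  refine ⟨c * (MvPolynomial.eval z.rep (Q b) / pairForm z.rep b.1 b.2),
    mul_ne_zero hc0 (div_ne_zero hQb hb'), fun a => ?_⟩
  rw [hrep, Pi.smul_apply, smul_eq_mul, key a]
  ring

theorem isPluckerFifthValue_of_formG {i j : Fin 5} (h : i ≠ j) {z : PSpace (Fin 6)}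
    (hz : z ∈ points (exceptionalLine i j)) (hG : formG z.rep ≠ 0) :
    IsPluckerFifthValue z (Projectivization.mk ℂ _ (pairForm_ne_zero z.rep_nonzero)) := by
  have hev : (fun a => MvPolynomial.eval z.rep (pluckerCubic a)) =
      (8 * formG z.rep) • fun a : Fin 5 × Fin 5 => pairForm z.rep a.1 a.2 := by
    ext a
    rw [eval_pluckerCubic_line h hz]
    rfl
  have hne : (fun a => MvPolynomial.eval z.rep (pluckerCubic a)) ≠ 0 := by
    rw [hev]
    exact smul_ne_zero (mul_ne_zero (by norm_num) hG) (pairForm_ne_zero z.rep_nonzero)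
  refine ⟨points_exceptionalLine_subset h hz, 3, pluckerCubic, pluckerCubic_isHomogeneous,
    fun σ τ x y hxy a b => pluckerCubic_compatible hxy a b, hne, ?_⟩
  exact (mk_eq_mk_of_smul _ _ hev).symm

/-! ### The covers of the exceptional lines -/

section Triples

variable {i j : Fin 5}

theorem extendZero_of_ne (w : Others i j → ℂ) (k : Others i j) :
    extendZero w k.1 = w k := by
  simp only [extendZero]
  rw [dif_pos k.2]

theorem extendZero_left (w : Others i j → ℂ) : extendZero w i = 0 := by
  simp [extendZero]

theorem extendZero_right (w : Others i j → ℂ) : extendZero w j = 0 := by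
  simp [extendZero]

theorem extendZero_eq_zero (w : Others i j → ℂ) {k : Fin 5} (hk : ¬(k ≠ i ∧ k ≠ j)) :
    extendZero w k = 0 := dif_neg hk

/-- Extension by zero as a linear map. -/
def extendZeroLinear (i j : Fin 5) : (Others i j → ℂ) →ₗ[ℂ] (Fin 5 → ℂ) where
  toFun := extendZero
  map_add' v w := by
    ext k
    by_cases hk : k ≠ i ∧ k ≠ j <;> simp [extendZero, hk]
  map_smul' c w := by
    ext k
    by_cases hk : k ≠ i ∧ k ≠ j <;> simp [extendZero, hk]

theorem extendZero_smul (c : ℂ) (w : Others i j → ℂ) : extendZero (c • w) = c • extendZero w :=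
  (extendZeroLinear i j).map_smul c w

theorem extendZero_injective : Function.Injective (extendZero : (Others i j → ℂ) → _) := by
  intro v w h
  ext k
  rw [← extendZero_of_ne v, h, extendZero_of_ne]

theorem extendZero_ne_zero {w : Others i j → ℂ} (hw : w ≠ 0) : extendZero w ≠ 0 := fun h =>
  hw (extendZero_injective (h.trans (extendZeroLinear i j).map_zero.symm))

theorem sum_extendZero (w : Others i j → ℂ) : ∑ k, extendZero w k = ∑ k, w k := by
  refine (Fintype.sum_of_injective Subtype.val Subtype.val_injective _ _ ?_ ?_).symm
  · intro k hk
    refine extendZero_eq_zero w fun h => hk ⟨⟨k, h⟩, rfl⟩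
  · exact fun k => (extendZero_of_ne w k).symm

theorem continuous_extendZero : Continuous (extendZero : (Others i j → ℂ) → _) :=
  (extendZeroLinear i j).continuous_of_finiteDimensional

/-- The vector of fifth powers of a triple, extended by zero. -/
noncomputable def fifthPowers (w : Others i j → ℂ) : Fin 5 → ℂ := extendZero fun k => w k ^ 5

theorem fifthPowers_smul (c : ℂ) (w : Others i j → ℂ) :
    fifthPowers (c • w) = c ^ 5 • fifthPowers w := by
  rw [fifthPowers, fifthPowers, ← extendZero_smul]
  congr 1
  ext k
  simp [mul_pow]

theorem fifthPowers_left (w : Others i j → ℂ) : fifthPowers w i = 0 := extendZero_left _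

theorem fifthPowers_right (w : Others i j → ℂ) : fifthPowers w j = 0 := extendZero_right _

theorem fifthPowers_ne_zero {w : Others i j → ℂ} (hw : w ≠ 0) : fifthPowers w ≠ 0 := by
  refine extendZero_ne_zero fun h => hw ?_
  ext k
  simpa using congrFun h k

theorem sum_fifthPowers (w : Others i j → ℂ) : ∑ k, fifthPowers w k = ∑ k, w k ^ 5 :=
  sum_extendZero _

theorem extendZero_pow (w : Others i j → ℂ) (k : Fin 5) :
    extendZero w k ^ 5 = fifthPowers w k := by
  by_cases hk : k ≠ i ∧ k ≠ j <;> simp [fifthPowers, extendZero, hk]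

theorem continuous_fifthPowers : Continuous (fifthPowers : (Others i j → ℂ) → _) :=
  continuous_extendZero.comp (by fun_prop)

theorem branchValues_smul (c : ℂ) (z : Fin 6 → ℂ) :
    branchValues i j (c • z) = c • branchValues i j z := by
  ext k
  by_cases hk : k ≠ i ∧ k ≠ j <;> simp [branchValues, hk, pairForm_smul]

theorem continuous_branchValues (k : Fin 5) : Continuous fun z => branchValues i j z k := by
  by_cases hk : k ≠ i ∧ k ≠ j
  · simpa [branchValues, hk] using continuous_pairForm i k
  · simpa [branchValues, hk] using continuous_const

theorem branchValues_ne_zero (h : i ≠ j) {z : Fin 6 → ℂ} (hz : z ∈ exceptionalLine i j)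
    (h0 : z ≠ 0) : branchValues i j z ≠ 0 := fun hb => h0 <| by
  rw [← linePoint_branchValues h hz, hb, map_zero]

/-- The cone over the cover of an exceptional line. -/
def rootCone (i j : Fin 5) : Set ((Fin 6 → ℂ) × (Others i j → ℂ)) :=
  {p | ∑ k, fifthPowers p.2 k = 0 ∧ ∃ c : ℂ, c ≠ 0 ∧ p.1 = c • linePoint i j (fifthPowers p.2)}

theorem isBicone_rootCone : IsBicone (rootCone i j) := by
  rintro ⟨v, w⟩ ⟨hs, c, hc, hv⟩ a b ha hb
  simp only at hs hv
  refine ⟨?_, a * c * (b ^ 5)⁻¹, by positivity, ?_⟩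
  · simp only [fifthPowers_smul, Pi.smul_apply, smul_eq_mul, ← Finset.mul_sum, hs, mul_zero]
  · simp only [fifthPowers_smul, map_smul, hv, smul_smul]
    congr 1
    field_simp

theorem rootCone_mem_line (h : i ≠ j) {p : (Fin 6 → ℂ) × (Others i j → ℂ)}
    (hp : p ∈ rootCone i j) : p.1 ∈ exceptionalLine i j := by
  obtain ⟨hs, c, -, hv⟩ := hp
  rw [hv]
  exact Submodule.smul_mem _ _
    (linePoint_mem h (fifthPowers_left _) (fifthPowers_right _) hs)

theorem rootCone_branchValues (h : i ≠ j) {p : (Fin 6 → ℂ) × (Others i j → ℂ)}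
    (hp : p ∈ rootCone i j) :
    ∃ c : ℂ, c ≠ 0 ∧ branchValues i j p.1 = c • fifthPowers p.2 := by
  obtain ⟨hs, c, hc, hv⟩ := hp
  refine ⟨c, hc, ?_⟩
  rw [hv, branchValues_smul, branchValues_linePoint h (fifthPowers_left _) (fifthPowers_right _) hs]

theorem mem_rootCone_of_branchValues (h : i ≠ j) {z : Fin 6 → ℂ} {w : Others i j → ℂ}
    (hz : z ∈ exceptionalLine i j) {c : ℂ} (hc : c ≠ 0)
    (hb : fifthPowers w = c • branchValues i j z) : (z, w) ∈ rootCone i j := by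
  refine ⟨?_, c⁻¹, inv_ne_zero hc, ?_⟩
  · simp only [hb, Pi.smul_apply, smul_eq_mul, ← Finset.mul_sum, branchValues_sum h hz, mul_zero]
  · simp only [hb, map_smul, smul_smul, inv_mul_cancel₀ hc, one_smul, linePoint_branchValues h hz]

/-- Cross-multiplied proportionality is a closed condition. For nonzero z and w neither side of the
proportion vanishes, so the nonzero scalar can be recovered from it. -/
theorem mem_rootCone_of_proportional (h : i ≠ j) {z : Fin 6 → ℂ} {w : Others i j → ℂ}
    (hz : z ∈ exceptionalLine i j) (hz0 : z ≠ 0) (hw0 : w ≠ 0)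
    (hprop : ∀ k l, fifthPowers w k * branchValues i j z l =
      fifthPowers w l * branchValues i j z k) : (z, w) ∈ rootCone i j := by
  obtain ⟨l, hl⟩ := Function.ne_iff.1 (branchValues_ne_zero h hz hz0)
  have hl' : branchValues i j z l ≠ 0 := hl
  have hb : fifthPowers w = (fifthPowers w l / branchValues i j z l) • branchValues i j z := by
    ext k
    rw [Pi.smul_apply, smul_eq_mul, div_mul_eq_mul_div, eq_div_iff hl', hprop]
  refine mem_rootCone_of_branchValues h hz ?_ hb
  intro h0
  rw [h0, zero_smul] at hb
  exact fifthPowers_ne_zero hw0 hb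

theorem formG_smul (c : ℂ) (z : Fin 6 → ℂ) : formG (c • z) = c ^ 2 * formG z := by
  simp [formG]
  ring

theorem mem_rootCone_of_mem_rootCover (h : i ≠ j) {p : PSpace (Fin 6) × PSpace (Others i j)}
    (hp : p ∈ rootCover i j) : (p.1.rep, p.2.rep) ∈ rootCone i j := by
  let C : Set ((Fin 6 → ℂ) × (Others i j → ℂ)) := {p | p.1 ∈ exceptionalLine i j ∧
    ∀ k l, fifthPowers p.2 k * branchValues i j p.1 l =
      fifthPowers p.2 l * branchValues i j p.1 k}
  have hC : IsBicone C := by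
    rintro ⟨v, w⟩ ⟨hv, hw⟩ a b ha hb
    refine ⟨Submodule.smul_mem _ _ hv, fun k l => ?_⟩
    have := hw k l
    simp only [fifthPowers_smul, branchValues_smul, Pi.smul_apply, smul_eq_mul] at this ⊢
    linear_combination b ^ 5 * a * this
  have hcl : IsClosed C := by
    have hCeq : C = (Prod.fst ⁻¹' (exceptionalLine i j : Set (Fin 6 → ℂ))) ∩
        ⋂ k, ⋂ l, {p | fifthPowers p.2 k * branchValues i j p.1 l =
          fifthPowers p.2 l * branchValues i j p.1 k} := by
      ext p
      simp [C]
    rw [hCeq]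
    refine ((Submodule.closed_of_finiteDimensional _).preimage continuous_fst).inter ?_
    refine isClosed_iInter fun k => isClosed_iInter fun l => isClosed_eq ?_ ?_ <;>
    exact ((continuous_apply _).comp (continuous_fifthPowers.comp continuous_snd)).mul
      ((continuous_branchValues _).comp continuous_fst)
  have hmem := projClosure_subset hC hcl (fun p hp => by
    obtain ⟨hz, q, hq, c, -, hw⟩ := hp
    obtain ⟨d, -, hq'⟩ := hq.rep_eq h hz
    refine ⟨hz, ?_⟩
    have key : ∀ k, fifthPowers p.2.rep k = c * d * branchValues i j p.1.rep k := fun k => by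
      by_cases hk : k ≠ i ∧ k ≠ j
      · have := hw ⟨k, hk⟩
        rw [hq'] at this
        rw [fifthPowers, extendZero_of_ne _ ⟨k, hk⟩, this, branchValues, if_pos hk, mul_assoc]
      · rw [fifthPowers, extendZero_eq_zero _ hk, branchValues, if_neg hk, mul_zero]
    intro k l
    simp only [key]
    ring) p hp
  obtain ⟨hz, hprop⟩ := hmem
  simp only at hz hprop
  exact mem_rootCone_of_proportional h hz p.1.rep_nonzero p.2.rep_nonzero hprop

/-- The pairs of the cover lying over points at which the rational map is defined. -/
theorem generic_mem_rootCover (h : i ≠ j) {p : PSpace (Fin 6) × PSpace (Others i j)}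
    (hp : (p.1.rep, p.2.rep) ∈ rootCone i j) (hG : formG p.1.rep ≠ 0) :
    p.1 ∈ points (exceptionalLine i j) ∧ ∃ q, IsPluckerFifthValue p.1 q ∧
      ∃ c : ℂ, c ≠ 0 ∧ ∀ k : Others i j, p.2.rep k ^ 5 = c * q.rep (i, k.1) := by
  have hz : p.1 ∈ points (exceptionalLine i j) := rootCone_mem_line h hp
  refine ⟨hz, _, isPluckerFifthValue_of_formG h hz hG, ?_⟩
  obtain ⟨c, hc, hb⟩ := rootCone_branchValues h hp
  obtain ⟨d, hd, hrep⟩ := exists_rep_mk _ (pairForm_ne_zero p.1.rep_nonzero)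
  refine ⟨(c * d)⁻¹, by positivity, fun k => ?_⟩
  have hk := congrFun hb k.1
  simp only [branchValues, if_pos k.2, Pi.smul_apply, smul_eq_mul, fifthPowers,
    extendZero_of_ne] at hk
  rw [hrep, Pi.smul_apply, smul_eq_mul, hk]
  field_simp

/-- Every point of the cone over the cover is a limit of points at which the form `G` does not
vanish. -/
theorem exists_generic_path (h : i ≠ j) {z : Fin 6 → ℂ} {w : Others i j → ℂ} (hw : w ≠ 0)
    (hp : (z, w) ∈ rootCone i j) : ∃ (f : ℂ → Fin 6 → ℂ) (g : ℂ → Others i j → ℂ),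
      ContinuousAt f 0 ∧ ContinuousAt g 0 ∧ f 0 = z ∧ g 0 = w ∧
      ∀ᶠ t in 𝓝[≠] (0 : ℂ), (f t, g t) ∈ rootCone i j ∧ formG (f t) ≠ 0 := by
  by_cases hG : formG z ≠ 0
  · exact ⟨fun _ => z, fun _ => w, continuousAt_const, continuousAt_const, rfl, rfl,
      Eventually.of_forall fun _ => ⟨hp, hG⟩⟩
  rw [not_not] at hG
  obtain ⟨hs, c, hc, hz⟩ := hp
  simp only at hs hz
  obtain ⟨k, l, m, hki, hkj, hli, hlj, hmi, hmj, hkl, hkm, hlm⟩ := exists_others i j h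
  have hi : fifthPowers w i = 0 := extendZero_left _
  have hj : fifthPowers w j = 0 := extendZero_right _
  have hsum := hs
  rw [sum_labels h ⟨hki, hkj⟩ ⟨hli, hlj⟩ ⟨hmi, hmj⟩ hkl hkm hlm, hi, hj] at hsum
  have hsq : fifthPowers w k ^ 2 + fifthPowers w l ^ 2 + fifthPowers w m ^ 2 = 0 := by
    rw [← formG_exceptionalLine h ⟨hki, hkj⟩ ⟨hli, hlj⟩ ⟨hmi, hmj⟩ hkl hkm hlm hi hj hs]
    rw [hz, formG_smul] at hG
    have := (mul_eq_zero.1 hG).resolve_left (by positivity)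
    rw [this, mul_zero]
  have hne : ¬(fifthPowers w k = 0 ∧ fifthPowers w l = 0) := fun ⟨h1, h2⟩ => by
    refine fifthPowers_ne_zero hw (funext fun a => ?_)
    rcases label_cases h ⟨hki, hkj⟩ ⟨hli, hlj⟩ ⟨hmi, hmj⟩ hkl hkm hlm a with
      rfl | rfl | rfl | rfl | rfl
    exacts [hi, hj, h1, h2, by rw [h1, h2] at hsum; simpa using hsum]
  set A := fifthPowers w k with hA
  set B := fifthPowers w l with hB
  have hm' : fifthPowers w m = -A - B := by linear_combination hsum
  rw [hm'] at hsq
  -- At a zero of G the three values have zero sum and zero sum of squares, so A² + AB + B² = 0. As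
  -- they are not all zero, A and B are nonzero and distinct.
  have hAB : A - B ≠ 0 := fun h0 => by
    have hAB' : A = B := by linear_combination h0
    have : B = 0 := by
      rw [hAB'] at hsq
      have : B ^ 2 = 0 := by linear_combination hsq / 6
      simpa using this
    exact hne ⟨hAB'.trans this, this⟩
  have hA0 : A ≠ 0 := fun h0 => by
    rw [h0] at hsq
    have : B ^ 2 = 0 := by linear_combination hsq / 2
    exact hne ⟨h0, by simpa using this⟩
  have hB0 : B ≠ 0 := fun h0 => by
    rw [h0] at hsq
    have : A ^ 2 = 0 := by linear_combination hsq / 2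
    exact hne ⟨by simpa using this, h0⟩
  -- The principal fifth root is continuous near 1 and equals 1 at t = 0, so multiplying by it lifts
  -- the perturbation of the fifth powers to a path starting at w.
  let r : ℂ → ℂ → ℂ := fun d t => (1 + d * t) ^ (1 / 5 : ℂ)
  have hr : ∀ d, ContinuousAt (r d) 0 := fun d => by
    refine ContinuousAt.cpow (by fun_prop) (by fun_prop) ?_
    simp
  have hr5 : ∀ d t, r d t ^ 5 = 1 + d * t := fun d t => by
    simp [r]
  let g : ℂ → Others i j → ℂ := fun t a =>
    if a.1 = k then w a * r A⁻¹ t else if a.1 = l then w a * r (-B⁻¹) t else w a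
  -- The direction e_k - e_l has sum zero, so the path stays on the cover. Along it Σ U² changes
  -- from 0 to t(2(A - B) + 2t), hence G ≠ 0 for small t ≠ 0.
  let U : ℂ → Fin 5 → ℂ := fun t => fifthPowers w + t • (Pi.single k 1 - Pi.single l 1)
  have hU : ∀ t, fifthPowers (g t) = U t := fun t => by
    funext a
    rcases label_cases h ⟨hki, hkj⟩ ⟨hli, hlj⟩ ⟨hmi, hmj⟩ hkl hkm hlm a with
      rfl | rfl | rfl | rfl | rfl
    · simp [U, fifthPowers, extendZero_left, hki.symm, hli.symm]
    · simp [U, fifthPowers, extendZero_right, hkj.symm, hlj.symm]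
    · have e := extendZero_of_ne (fun k => g t k ^ 5) ⟨a, hki, hkj⟩
      have e' := extendZero_of_ne (fun k => w k ^ 5) ⟨a, hki, hkj⟩
      simp only [U, fifthPowers, Pi.add_apply, Pi.smul_apply, Pi.sub_apply, Pi.single_eq_same,
        Pi.single_eq_of_ne hkl] at hA e e' ⊢
      rw [e, ← hA]
      simp only [g, if_pos, mul_pow, hr5]
      rw [← e', ← hA]
      simp
      field_simp
    · have e := extendZero_of_ne (fun k => g t k ^ 5) ⟨a, hli, hlj⟩
      have e' := extendZero_of_ne (fun k => w k ^ 5) ⟨a, hli, hlj⟩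
      simp only [U, fifthPowers, Pi.add_apply, Pi.smul_apply, Pi.sub_apply, Pi.single_eq_same,
        Pi.single_eq_of_ne hkl.symm] at hB e e' ⊢
      rw [e, ← hB]
      simp only [g, if_pos, if_neg hkl.symm, mul_pow, hr5]
      rw [← e', ← hB]
      simp
      field_simp
    · have e := extendZero_of_ne (fun k => g t k ^ 5) ⟨a, hmi, hmj⟩
      have e' := extendZero_of_ne (fun k => w k ^ 5) ⟨a, hmi, hmj⟩
      simp only [U, fifthPowers, Pi.add_apply, Pi.smul_apply, Pi.sub_apply,
        Pi.single_eq_of_ne hkm.symm, Pi.single_eq_of_ne hlm.symm] at e e' ⊢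
      rw [e, e']
      simp [g, hkm.symm, hlm.symm]
  have hUsum : ∀ t, ∑ a, U t a = 0 := fun t => by
    simp [U, Finset.sum_add_distrib, hs, ← Finset.mul_sum, Finset.sum_sub_distrib]
  have hUi : ∀ t, U t i = 0 := fun t => by simp [U, hi, hki.symm, hli.symm]
  have hUj : ∀ t, U t j = 0 := fun t => by simp [U, hj, hkj.symm, hlj.symm]
  refine ⟨fun t => c • linePoint i j (U t), g, ?_, ?_, ?_, ?_, ?_⟩
  · have hcont : Continuous U := by fun_prop
    exact (((linePoint i j).continuous_of_finiteDimensional.comp hcont).const_smul c).continuousAt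
  · refine continuousAt_pi.2 fun a => ?_
    have h1 := hr A⁻¹
    have h2 := hr (-B⁻¹)
    by_cases hak : a.1 = k
    · simp only [g, hak, if_true]
      exact continuousAt_const.mul h1
    by_cases hal : a.1 = l
    · simp only [g, hal, hkl.symm, if_true, if_false]
      exact continuousAt_const.mul h2
    · simpa [g, hak, hal] using continuousAt_const
  · simp [U, hz]
  · ext a
    simp [g, r]
  · filter_upwards [eventually_add_mul_ne (2 * (A - B)) two_ne_zero, self_mem_nhdsWithin]
      with t ht ht0
    refine ⟨⟨?_, c, hc, ?_⟩, ?_⟩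
    · simpa only [hU] using hUsum t
    · simp only [hU]
    · rw [formG_smul]
      refine mul_ne_zero (by positivity) fun h0 => ?_
      have hq := formG_exceptionalLine h ⟨hki, hkj⟩ ⟨hli, hlj⟩ ⟨hmi, hmj⟩ hkl hkm hlm
        (hUi t) (hUj t) (hUsum t)
      rw [h0] at hq
      simp [U, hkl, hkl.symm, hkm.symm, hlm.symm, hm', ← hA, ← hB] at hq
      refine mul_ne_zero ht0 ht ?_
      linear_combination -hq - hsq

theorem mem_rootCover_iff (h : i ≠ j) (p : PSpace (Fin 6) × PSpace (Others i j)) :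
    p ∈ rootCover i j ↔ (p.1.rep, p.2.rep) ∈ rootCone i j := by
  refine ⟨mem_rootCone_of_mem_rootCover h, fun hp => ?_⟩
  obtain ⟨f, g, hf, hg, hf0, hg0, hev⟩ := exists_generic_path h p.2.rep_nonzero hp
  unfold rootCover
  refine mem_projClosure_of_tendsto hf hg hf0 hg0 ?_
  have hf0' : f 0 ≠ 0 := by rw [hf0]; exact p.1.rep_nonzero
  have hg0' : g 0 ≠ 0 := by rw [hg0]; exact p.2.rep_nonzero
  have hfne : ∀ᶠ t in 𝓝[≠] (0 : ℂ), f t ≠ 0 :=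
    (hf.eventually_ne hf0').filter_mono nhdsWithin_le_nhds
  have hgne : ∀ᶠ t in 𝓝[≠] (0 : ℂ), g t ≠ 0 :=
    (hg.eventually_ne hg0').filter_mono nhdsWithin_le_nhds
  filter_upwards [hev, hfne, hgne] with t hmem h1 h2
  obtain ⟨hmem, hG⟩ := hmem
  refine ⟨h1, h2, ?_⟩
  obtain ⟨d, hd, hrep⟩ := exists_rep_mk _ h1
  have hG' : formG (Projectivization.mk ℂ (f t) h1).rep ≠ 0 := by
    rw [hrep, formG_smul]
    exact mul_ne_zero (by positivity) hG
  exact generic_mem_rootCover h (p := (Projectivization.mk ℂ (f t) h1,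
    Projectivization.mk ℂ (g t) h2)) ((isBicone_rootCone.mk_rep_iff h1 h2).2 hmem) hG'

theorem mk_mem_rootCover_iff (h : i ≠ j) {v : Fin 6 → ℂ} {w : Others i j → ℂ} (hv : v ≠ 0)
    (hw : w ≠ 0) : (Projectivization.mk ℂ v hv, Projectivization.mk ℂ w hw) ∈ rootCover i j ↔
      (v, w) ∈ rootCone i j := by
  rw [mem_rootCover_iff h]
  exact isBicone_rootCone.mk_rep_iff hv hw

theorem exists_fifthPowers_eq (u : Fin 5 → ℂ) (hi : u i = 0) (hj : u j = 0) :
    ∃ w : Others i j → ℂ, fifthPowers w = u := by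
  choose r hr using fun c : ℂ => IsAlgClosed.exists_pow_nat_eq c (show 0 < 5 by norm_num)
  refine ⟨fun k => r (u k.1), funext fun k => ?_⟩
  by_cases hk : k ≠ i ∧ k ≠ j
  · exact (extendZero_of_ne _ ⟨k, hk⟩).trans (hr _)
  · rw [fifthPowers, extendZero_eq_zero _ hk]
    have : k = i ∨ k = j := by tauto
    rcases this with rfl | rfl
    exacts [hi.symm, hj.symm]

theorem exists_mem_rootCover (h : i ≠ j) {z : PSpace (Fin 6)}
    (hz : z ∈ points (exceptionalLine i j)) : ∃ w, (z, w) ∈ rootCover i j := by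
  obtain ⟨w, hw⟩ := exists_fifthPowers_eq (i := i) (j := j) (branchValues i j z.rep)
    (by simp [branchValues]) (by simp [branchValues])
  have hw0 : w ≠ 0 := fun h0 => branchValues_ne_zero h hz z.rep_nonzero <| by
    rw [← hw, h0]
    ext k
    by_cases hk : k ≠ i ∧ k ≠ j <;> simp [fifthPowers, extendZero, hk]
  refine ⟨Projectivization.mk ℂ w hw0, ?_⟩
  rw [← z.mk_rep, mk_mem_rootCover_iff h z.rep_nonzero hw0]
  exact mem_rootCone_of_branchValues h hz one_ne_zero (by rw [hw, one_smul])

theorem image_fst_rootCover (h : i ≠ j) :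
    Prod.fst '' rootCover i j = points (exceptionalLine i j) := by
  ext z
  constructor
  · rintro ⟨p, hp, rfl⟩
    exact rootCone_mem_line h ((mem_rootCover_iff h p).1 hp)
  · intro hz
    obtain ⟨w, hw⟩ := exists_mem_rootCover h hz
    exact ⟨_, hw, rfl⟩

end Triples

/-! ### Isomorphisms with the Fermat curve -/

theorem toProj_eq {ι : Type} [Nonempty (PSpace ι)] {p : PSpace ι} {v : ι → ℂ} {c : ℂ}
    (hc : c ≠ 0) (h : v = c • p.rep) : toProj v = p := by
  have hv : v ≠ 0 := by
    rw [h]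
    exact smul_ne_zero hc p.rep_nonzero
  rw [toProj_of_ne hv]
  exact (mk_eq_mk_of_smul hv p.rep_nonzero h).trans p.mk_rep

theorem isRegularMap_toProj {α γ : Type} [Nonempty (PSpace γ)] {Y : Set (PSpace α)} {d : ℕ}
    {F : γ → MvPolynomial α ℂ} (hF : ∀ a, (F a).IsHomogeneous d)
    (h : ∀ y ∈ Y, (fun a => MvPolynomial.eval y.rep (F a)) ≠ 0) :
    IsRegularMap Y fun y => toProj fun a => MvPolynomial.eval y.rep (F a) :=
  fun y hy => ⟨d, F, hF, h y hy, fun _ _ h' => toProj_of_ne h'⟩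

theorem isRegularMapProd_toProj {α β γ : Type} [Nonempty (PSpace γ)]
    {X : Set (PSpace α × PSpace β)} (s : γ → β)
    (h : ∀ p ∈ X, (fun a => p.2.rep (s a)) ≠ 0) :
    IsRegularMapProd X fun p => toProj fun a => p.2.rep (s a) := by
  refine fun p hp => ⟨0, 1, fun a => MvPolynomial.X (Sum.inr (s a)), fun a => ⟨?_, ?_⟩, ?_, ?_⟩
  · exact MvPolynomial.isWeightedHomogeneous_X ℂ _ _
  · exact MvPolynomial.isWeightedHomogeneous_X ℂ _ _
  · simpa using h p hp
  · intro q _ hq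
    simp only [MvPolynomial.eval_X, Sum.elim_inr] at hq ⊢
    exact toProj_of_ne hq

/-- The forms whose values are the components of a linear map applied to `n`-th powers. -/
noncomputable def powerForm {γ α : Type} [Fintype γ] [DecidableEq γ]
    (T : (γ → ℂ) →ₗ[ℂ] (α → ℂ)) (n : ℕ) (a : α) : MvPolynomial γ ℂ :=
  ∑ k, MvPolynomial.C (T (Pi.single k 1) a) * MvPolynomial.X k ^ n

theorem powerForm_isHomogeneous {γ α : Type} [Fintype γ] [DecidableEq γ]
    (T : (γ → ℂ) →ₗ[ℂ] (α → ℂ)) (n : ℕ) (a : α) : (powerForm T n a).IsHomogeneous n :=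
  MvPolynomial.IsHomogeneous.sum _ _ _ fun k _ => by
    simpa using (MvPolynomial.isHomogeneous_C γ (T (Pi.single k 1) a)).mul
      ((MvPolynomial.isHomogeneous_X ℂ k).pow n)

theorem eval_powerForm {γ α : Type} [Fintype γ] [DecidableEq γ]
    (T : (γ → ℂ) →ₗ[ℂ] (α → ℂ)) (n : ℕ) (a : α) (x : γ → ℂ) :
    MvPolynomial.eval x (powerForm T n a) = T (fun k => x k ^ n) a := by
  have hk : ∀ k : γ, (fun l => if k = l then (1 : ℂ) else 0) = Pi.single k 1 := fun k => by
    ext l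
    simp [Pi.single_apply, eq_comm]
  rw [LinearMap.pi_apply_eq_sum_univ T]
  simp [powerForm, mul_comm, hk]

section Fermat

variable {i j : Fin 5}

theorem card_others (h : i ≠ j) : Fintype.card (Others i j) = 3 := by
  revert i j; decide

theorem linePoint_fifthPowers_ne_zero (h : i ≠ j) {w : Others i j → ℂ} (hw : w ≠ 0)
    (hs : ∑ k, fifthPowers w k = 0) : linePoint i j (fifthPowers w) ≠ 0 := fun h0 => by
  have := branchValues_linePoint h (fifthPowers_left w) (fifthPowers_right w) hs
  rw [h0, ← zero_smul ℂ (0 : Fin 6 → ℂ), branchValues_smul, zero_smul] at this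
  exact fifthPowers_ne_zero hw this.symm

/-- A set of pairs parametrized linearly by the triples of a root cover is a Fermat curve. -/
theorem isIsomorphic_fermatCurve {β : Type} [Nonempty (PSpace β)] (h : i ≠ j)
    {X : Set (PSpace (Fin 6) × PSpace β)} (T : (Others i j → ℂ) →ₗ[ℂ] (β → ℂ))
    (s : Others i j → β) (hs : ∀ w k, T w (s k) = w k)
    (hX : ∀ p, p ∈ X ↔ ∃ w, (p.1.rep, w) ∈ rootCone i j ∧ p.2.rep = T w) :
    IsIsomorphic X fermatCurve := by
  let e : Fin 3 ≃ Others i j := (Fintype.equivFinOfCardEq (card_others h)).symm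
  let R : (Fin 3 → ℂ) →ₗ[ℂ] (Others i j → ℂ) := LinearMap.funLeft ℂ ℂ e.symm
  have hR : ∀ x k, R x k = x (e.symm k) := fun _ _ => rfl
  have hR0 : ∀ x, x ≠ 0 → R x ≠ 0 := fun x hx h0 => hx <| by
    ext a
    simpa [hR] using congrFun h0 (e a)
  have hTinj : ∀ w, w ≠ 0 → T w ≠ 0 := fun w hw h0 => hw <| by
    ext k
    rw [← hs w k, h0]
    rfl
  let A : (Fin 3 → ℂ) →ₗ[ℂ] (Fin 6 → ℂ) := linePoint i j ∘ₗ extendZeroLinear i j ∘ₗ R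
  have hA : ∀ x : Fin 3 → ℂ, A (fun k => x k ^ 5) = linePoint i j (fifthPowers (R x)) :=
    fun _ => rfl
  have hsum : ∀ x : Fin 3 → ℂ, ∑ k, fifthPowers (R x) k = ∑ k, x k ^ 5 := fun x => by
    rw [sum_fifthPowers]
    exact Equiv.sum_comp e.symm fun k => x k ^ 5
  have hcone : ∀ x : Fin 3 → ℂ, ∑ k, x k ^ 5 = 0 →
      (linePoint i j (fifthPowers (R x)), R x) ∈ rootCone i j := fun x hx =>
    ⟨by simpa [hsum] using hx, 1, one_ne_zero, (one_smul _ _).symm⟩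
  have hline : ∀ x : Fin 3 → ℂ, x ≠ 0 → ∑ k, x k ^ 5 = 0 →
      linePoint i j (fifthPowers (R x)) ≠ 0 := fun x hx hx5 =>
    linePoint_fifthPowers_ne_zero h (hR0 x hx) (by rw [hsum, hx5])
  let g₁ : PSpace (Fin 3) → PSpace (Fin 6) := fun y =>
    toProj fun a => MvPolynomial.eval y.rep (powerForm A 5 a)
  let g₂ : PSpace (Fin 3) → PSpace β := fun y =>
    toProj fun a => MvPolynomial.eval y.rep (powerForm (T ∘ₗ R) 1 a)
  have hg₁ : ∀ y, g₁ y = toProj (linePoint i j (fifthPowers (R y.rep))) := fun y => by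
    simp only [g₁, eval_powerForm, hA]
  have hg₂ : ∀ y, g₂ y = toProj (T (R y.rep)) := fun y => by
    simp only [g₂, eval_powerForm, pow_one, LinearMap.comp_apply]
  have hf : ∀ p ∈ X, ∃ w, (p.1.rep, w) ∈ rootCone i j ∧ w ≠ 0 ∧ p.2.rep = T w ∧
      ∀ a, p.2.rep (s (e a)) = w (e a) := fun p hp => by
    obtain ⟨w, hw, hT⟩ := (hX p).1 hp
    refine ⟨w, hw, fun h0 => p.2.rep_nonzero (by rw [hT, h0, map_zero]), hT, fun a => ?_⟩
    rw [hT, hs]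
  have hwe : ∀ w : Others i j → ℂ, w ≠ 0 → (fun a => w (e a)) ≠ 0 := fun w hw h0 => hw <| by
    ext k
    simpa using congrFun h0 (e.symm k)
  refine ⟨fun p => toProj fun a => p.2.rep (s (e a)), g₁, g₂, ?_, ?_, ?_, ?_, ?_⟩
  · refine isRegularMapProd_toProj (fun a => s (e a)) fun p hp => ?_
    obtain ⟨w, -, hw0, -, hwa⟩ := hf p hp
    simp only [hwa]
    exact hwe w hw0
  · refine isRegularMap_toProj (powerForm_isHomogeneous A 5) fun y hy => ?_
    simp only [eval_powerForm, hA]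
    exact hline y.rep y.rep_nonzero hy
  · refine isRegularMap_toProj (powerForm_isHomogeneous (T ∘ₗ R) 1) fun y hy => ?_
    simp only [eval_powerForm, pow_one, LinearMap.comp_apply]
    exact hTinj _ (hR0 _ y.rep_nonzero)
  · intro p hp
    obtain ⟨w, hcw, hw0, hT, hwa⟩ := hf p hp
    simp only [hwa, toProj_of_ne (hwe w hw0)]
    obtain ⟨c, hc, hrep⟩ := exists_rep_mk _ (hwe w hw0)
    obtain ⟨hs5, d, hd, hd'⟩ := hcw
    simp only at hs5 hd'
    have hRw : R (Projectivization.mk ℂ _ (hwe w hw0)).rep = c • w := by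
      rw [hrep]
      ext k
      simp [hR]
    refine ⟨?_, Prod.ext ?_ ?_⟩
    · change ∑ k, (Projectivization.mk ℂ _ (hwe w hw0)).rep k ^ 5 = 0
      rw [← hsum, hRw, fifthPowers_smul]
      simp only [Pi.smul_apply, smul_eq_mul, ← Finset.mul_sum, hs5, mul_zero]
    · simp only
      rw [hg₁, hRw, fifthPowers_smul, map_smul]
      refine toProj_eq (c := c ^ 5 * d⁻¹) (by positivity) ?_
      rw [hd', smul_smul, mul_assoc, inv_mul_cancel₀ hd, mul_one]
    · simp only
      rw [hg₂, hRw, map_smul]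
      exact toProj_eq hc (by rw [hT])
  · intro y hy
    have hy5 : ∑ k, y.rep k ^ 5 = 0 := hy
    have h1 := hline y.rep y.rep_nonzero hy5
    have h2 := hTinj _ (hR0 _ y.rep_nonzero)
    rw [hg₁, hg₂, toProj_of_ne h1, toProj_of_ne h2]
    obtain ⟨c, hc, hrep⟩ := exists_rep_mk _ h1
    obtain ⟨d, hd, hrep'⟩ := exists_rep_mk _ h2
    constructor
    · refine (hX _).2 ⟨d • R y.rep, ?_, ?_⟩
      · simp only [hrep]
        exact isBicone_rootCone _ (hcone _ hy5) c d hc hd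
      · simp only [hrep', map_smul]
    · refine toProj_eq hd ?_
      simp only [hrep']
      ext a
      simp [hs, hR]

theorem rootCover_isIsomorphic (h : i ≠ j) : IsIsomorphic (rootCover i j) fermatCurve := by
  have : Nonempty (Others i j) := Fintype.card_pos_iff.1 (by rw [card_others h]; norm_num)
  refine isIsomorphic_fermatCurve h LinearMap.id id (fun _ _ => rfl) fun p => ?_
  rw [mem_rootCover_iff h]
  simp

/-! ### The sheets of the cover of the degenerate Wiman curve -/

/-- The Plücker coordinates of the line joining a cone vertex to a point of the opposite
plane. -/
def sheetMap (i j : Fin 5) (ζ : ℂ) : (Others i j → ℂ) →ₗ[ℂ] (Fin 5 × Fin 5 → ℂ) :=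
  pluckerLeft (coneVertex i j ζ) ∘ₗ extendZeroLinear i j

theorem sheetMap_apply (ζ : ℂ) (w : Others i j → ℂ) :
    sheetMap i j ζ w = plucker (coneVertex i j ζ) (extendZero w) := rfl

theorem sheetMap_left (h : i ≠ j) (ζ : ℂ) (w : Others i j → ℂ) (k : Others i j) :
    sheetMap i j ζ w (i, k.1) = w k := by
  simp [sheetMap_apply, plucker, coneVertex, h, extendZero_of_ne, extendZero_left]

theorem sheetMap_right (h : i ≠ j) (ζ : ℂ) (w : Others i j → ℂ) (k : Others i j) :
    sheetMap i j ζ w (j, k.1) = -ζ * w k := by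
  simp [sheetMap_apply, plucker, coneVertex, h.symm, extendZero_of_ne, extendZero_right]

theorem sheetMap_ne_zero (h : i ≠ j) (ζ : ℂ) {w : Others i j → ℂ} (hw : w ≠ 0) :
    sheetMap i j ζ w ≠ 0 := fun h0 => hw <| by
  ext k
  rw [← sheetMap_left h ζ w k, h0]
  rfl

theorem mem_sheet_iff (h : i ≠ j) (ζ : ℂ) (p : PSpace (Fin 6) × PSpace (Fin 5 × Fin 5)) :
    p ∈ sheet i j ζ ↔ ∃ w, (p.1.rep, w) ∈ rootCone i j ∧ p.2.rep = sheetMap i j ζ w := by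
  constructor
  · rintro ⟨w, hw, hP, hp⟩
    obtain ⟨c, hc, hrep⟩ := exists_rep_mk _ hP
    refine ⟨c • w.rep, ?_, ?_⟩
    · simpa using isBicone_rootCone _ ((mem_rootCover_iff h _).1 hw) 1 c one_ne_zero hc
    · rw [hp, hrep, map_smul, sheetMap_apply]
  · rintro ⟨w, hw, hp⟩
    have hw0 : w ≠ 0 := fun h0 => p.2.rep_nonzero (by rw [hp, h0, map_zero])
    obtain ⟨c, hc, hrep⟩ := exists_rep_mk _ hw0
    have hP : plucker (coneVertex i j ζ) (extendZero (Projectivization.mk ℂ w hw0).rep) =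
        c • p.2.rep := by
      rw [hrep, ← sheetMap_apply, map_smul, hp]
    refine ⟨Projectivization.mk ℂ w hw0, ?_, ?_, ?_⟩
    · rw [mem_rootCover_iff h]
      simp only [hrep]
      simpa using isBicone_rootCone _ hw 1 c one_ne_zero hc
    · rw [hP]
      exact smul_ne_zero hc p.2.rep_nonzero
    · refine eq_mk_of_rep _ (c := c⁻¹) ?_
      rw [hP, smul_smul, inv_mul_cancel₀ hc, one_smul]

theorem sheet_isIsomorphic (h : i ≠ j) (ζ : ℂ) : IsIsomorphic (sheet i j ζ) fermatCurve :=
  isIsomorphic_fermatCurve h (sheetMap i j ζ) (fun k => (i, k.1)) (sheetMap_left h ζ)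
    (mem_sheet_iff h ζ)

theorem sheetMap_eq_smul (h : i ≠ j) {ζ ζ' c : ℂ} {w w' : Others i j → ℂ} (hw : w ≠ 0)
    (he : sheetMap i j ζ w = c • sheetMap i j ζ' w') : ζ = ζ' ∧ w = c • w' := by
  have hl : ∀ k, w k = c * w' k := fun k => by
    simpa [sheetMap_left h] using congrFun he (i, k.1)
  obtain ⟨k, hk⟩ := Function.ne_iff.1 hw
  have hk0 : w k ≠ 0 := hk
  have hr := congrFun he (j, k.1)
  rw [Pi.smul_apply, sheetMap_right h, sheetMap_right h, smul_eq_mul] at hr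
  refine ⟨mul_right_cancel₀ hk0 ?_, funext fun k => hl k⟩
  rw [hl k] at hr ⊢
  linear_combination -hr

theorem disjoint_sheet (h : i ≠ j) {ζ ζ' : ℂ} (hne : ζ ≠ ζ') :
    Disjoint (sheet i j ζ) (sheet i j ζ') := by
  rw [Set.disjoint_left]
  intro p hp hp'
  obtain ⟨w, -, hw⟩ := (mem_sheet_iff h ζ p).1 hp
  obtain ⟨w', -, hw'⟩ := (mem_sheet_iff h ζ' p).1 hp'
  have hw0 : w ≠ 0 := fun h0 => p.2.rep_nonzero (by rw [hw, h0, map_zero])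
  exact hne (sheetMap_eq_smul h hw0 (c := 1) (by rw [one_smul, ← hw, ← hw'])).1

/-- The vertex and w have disjoint supports, so every Plücker coordinate is a single product. Taking
fifth powers therefore commutes with the wedge: it turns ζ into 1 and, 5 being odd, preserves signs.
-/
theorem sheetMap_pow (h : i ≠ j) {ζ : ℂ} (hζ : ζ ^ 5 = 1) (w : Others i j → ℂ)
    (a : Fin 5 × Fin 5) :
    sheetMap i j ζ w a ^ 5 = plucker (coneVertex i j 1) (fifthPowers w) a := by
  obtain ⟨a, b⟩ := a
  have hi := extendZero_left w
  have hj := extendZero_right w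
  have hi' := fifthPowers_left w
  have hj' := fifthPowers_right w
  have key : ∀ c : Fin 5, c = i ∨ c = j ∨ (c ≠ i ∧ c ≠ j) := fun c => by omega
  rw [sheetMap_apply]
  rcases key a with rfl | rfl | ha <;> rcases key b with rfl | rfl | hb <;>
    simp [plucker, coneVertex, *, h.symm, ← extendZero_pow, mul_pow]
  all_goals ring_nf
  all_goals simp [hζ]

theorem sheet_pow (h : i ≠ j) {ζ : ℂ} (hζ : ζ ^ 5 = 1)
    {p : PSpace (Fin 6) × PSpace (Fin 5 × Fin 5)} (hp : p ∈ sheet i j ζ) :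
    p.1 ∈ points (exceptionalLine i j) ∧ ∃ c : ℂ, c ≠ 0 ∧ ∀ a : Fin 5 × Fin 5,
      p.2.rep a ^ 5 = c * pairForm p.1.rep a.1 a.2 := by
  obtain ⟨w, hw, hT⟩ := (mem_sheet_iff h ζ p).1 hp
  have hz : p.1 ∈ points (exceptionalLine i j) := rootCone_mem_line h hw
  obtain ⟨c, hc, hb⟩ := rootCone_branchValues h hw
  refine ⟨hz, c⁻¹, inv_ne_zero hc, fun a => ?_⟩
  simp only at hb
  rw [hT, sheetMap_pow h hζ, pairForm_exceptionalLine h hz, hb]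
  change _ = c⁻¹ * pluckerLeft _ (c • fifthPowers w) a
  rw [map_smul, Pi.smul_apply, smul_eq_mul, inv_mul_cancel_left₀ hc]
  rfl

/-- Pairs of a sheet over points at which the form `G` does not vanish. -/
theorem generic_mem_lineCover (h : i ≠ j) {φ ζ : ℂ} (hφ : φ ≠ 0) (hζ : ζ ^ 5 = 1)
    {p : PSpace (Fin 6) × PSpace (Fin 5 × Fin 5)} (hp : p ∈ sheet i j ζ)
    (hG : formG p.1.rep ≠ 0) :
    p.1 ∈ wimanCurve 0 φ ∧ (∃ x y, IsPluckerPoint x y p.2) ∧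
      ∃ q, IsPluckerFifthValue p.1 q ∧ ∃ c : ℂ, c ≠ 0 ∧ ∀ a, p.2.rep a ^ 5 = c * q.rep a := by
  obtain ⟨hz, c, hc, hpow⟩ := sheet_pow h hζ hp
  refine ⟨?_, ?_, _, isPluckerFifthValue_of_formG h hz hG, ?_⟩
  · rw [wimanCurve_infinity hφ]
    exact ⟨i, j, h, hz⟩
  · obtain ⟨w', -, hw'⟩ := hp
    exact ⟨_, _, hw'⟩
  · obtain ⟨d, hd, hrep⟩ := exists_rep_mk _ (pairForm_ne_zero p.1.rep_nonzero)
    refine ⟨c * d⁻¹, mul_ne_zero hc (inv_ne_zero hd), fun a => ?_⟩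
    rw [hrep, Pi.smul_apply, smul_eq_mul, hpow, mul_assoc, inv_mul_cancel_left₀ hd]

theorem sheet_subset_lineCover (h : i ≠ j) {φ ζ : ℂ} (hφ : φ ≠ 0) (hζ : ζ ^ 5 = 1) :
    sheet i j ζ ⊆ lineCover (wimanCurve 0 φ) := by
  intro p hp
  obtain ⟨w, hw, hT⟩ := (mem_sheet_iff h ζ p).1 hp
  have hw0 : w ≠ 0 := fun h0 => p.2.rep_nonzero (by rw [hT, h0, map_zero])
  obtain ⟨f, g, hf, hg, hf0, hg0, hev⟩ := exists_generic_path h hw0 hw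
  have hgT : ContinuousAt (fun t => sheetMap i j ζ (g t)) 0 :=
    (sheetMap i j ζ).continuous_of_finiteDimensional.continuousAt.comp hg
  unfold lineCover
  refine mem_projClosure_of_tendsto hf hgT hf0 (by rw [hg0, hT]) ?_
  have hf0' : f 0 ≠ 0 := by rw [hf0]; exact p.1.rep_nonzero
  have hg0' : g 0 ≠ 0 := by rw [hg0]; exact hw0
  have hfne : ∀ᶠ t in 𝓝[≠] (0 : ℂ), f t ≠ 0 :=
    (hf.eventually_ne hf0').filter_mono nhdsWithin_le_nhds
  have hgne : ∀ᶠ t in 𝓝[≠] (0 : ℂ), g t ≠ 0 :=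
    (hg.eventually_ne hg0').filter_mono nhdsWithin_le_nhds
  filter_upwards [hev, hfne, hgne] with t hmem h1 h2
  obtain ⟨hmem, hG⟩ := hmem
  have h2' := sheetMap_ne_zero h ζ h2
  refine ⟨h1, h2', ?_⟩
  obtain ⟨c, hc, hrep⟩ := exists_rep_mk _ h1
  obtain ⟨d, hd, hrep'⟩ := exists_rep_mk _ h2'
  have hG' : formG (Projectivization.mk ℂ (f t) h1).rep ≠ 0 := by
    rw [hrep, formG_smul]
    exact mul_ne_zero (by positivity) hG
  refine generic_mem_lineCover h (p := (Projectivization.mk ℂ (f t) h1,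
    Projectivization.mk ℂ _ h2')) hφ hζ ((mem_sheet_iff h ζ _).2 ⟨d • g t, ?_, ?_⟩) hG'
  · simp only [hrep]
    exact isBicone_rootCone _ hmem c d hc hd
  · simp only [hrep', map_smul]

/-! ### From fifth powers of Plücker coordinates back to a sheet. -/

theorem plucker_relation (x y : Fin 5 → ℂ) (a b c d : Fin 5) :
    plucker x y (a, b) * plucker x y (c, d) - plucker x y (a, c) * plucker x y (b, d) +
      plucker x y (a, d) * plucker x y (b, c) = 0 := by
  simp [plucker]
  ring

/-- Fifth powers alone would allow an independent root of unity in each nonzero coordinate.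
Decomposability leaves the triple (p_ik) and a single ζ relating rows i and j. -/
theorem mem_sheet_of_pow (h : i ≠ j) {p : PSpace (Fin 6) × PSpace (Fin 5 × Fin 5)}
    (hz : p.1 ∈ points (exceptionalLine i j)) {x y : Fin 5 → ℂ} (hxy : IsPluckerPoint x y p.2)
    {c : ℂ} (hc : c ≠ 0) (hpow : ∀ a : Fin 5 × Fin 5,
      p.2.rep a ^ 5 = c * pairForm p.1.rep a.1 a.2) : ∃ ζ : ℂ, ζ ^ 5 = 1 ∧ p ∈ sheet i j ζ := by
  obtain ⟨hne, hP⟩ := hxy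
  obtain ⟨d, hd, hrep⟩ := exists_rep_mk _ hne
  rw [← hP] at hrep
  have hanti : ∀ a b, p.2.rep (a, b) = -p.2.rep (b, a) := fun a b => by
    simp [hrep, plucker]
    ring
  have hrel : ∀ a b c e, p.2.rep (a, b) * p.2.rep (c, e) - p.2.rep (a, c) * p.2.rep (b, e) +
      p.2.rep (a, e) * p.2.rep (b, c) = 0 := fun a b c e => by
    simp only [hrep, Pi.smul_apply, smul_eq_mul]
    linear_combination d ^ 2 * plucker_relation x y a b c e
  have hpf := pairForm_exceptionalLine h hz
  obtain ⟨h0, h1⟩ := (mem_exceptionalLine_iff h _).1 hz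
  have hij : p.2.rep (i, j) = 0 := by simpa [h0] using hpow (i, j)
  have hkl : ∀ k l, k ≠ i ∧ k ≠ j → l ≠ i ∧ l ≠ j → p.2.rep (k, l) = 0 := fun k l hk hl => by
    simpa [h1 k l hk hl] using hpow (k, l)
  have hd0 : ∀ a, p.2.rep (a, a) = 0 := fun a => by
    linear_combination hanti a a / 2
  have hik : ∀ k, k ≠ i ∧ k ≠ j → p.2.rep (i, k) ^ 5 = c * branchValues i j p.1.rep k :=
    fun k hk => by
      rw [hpow, branchValues, if_pos hk]
  have hjk : ∀ k, k ≠ i ∧ k ≠ j → p.2.rep (j, k) ^ 5 = -(c * branchValues i j p.1.rep k) :=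
    fun k hk => by
      rw [hpow]
      simp only [hpf]
      simp [plucker, coneVertex, h.symm, branchValues, hk]
  obtain ⟨k, hk⟩ := Function.ne_iff.1 (branchValues_ne_zero h hz p.1.rep_nonzero)
  have hk0 : branchValues i j p.1.rep k ≠ 0 := hk
  have hko : k ≠ i ∧ k ≠ j := by
    by_contra hn
    exact hk0 (if_neg hn)
  have hik0 : p.2.rep (i, k) ≠ 0 := fun h0 => by
    have := hik k hko
    rw [h0] at this
    exact mul_ne_zero hc hk0 (by simpa using this.symm)
  refine ⟨-(p.2.rep (j, k) / p.2.rep (i, k)), ?_, (mem_sheet_iff h _ p).2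
    ⟨fun l => p.2.rep (i, l.1), ?_, ?_⟩⟩
  · rw [Odd.neg_pow (by decide), div_pow, hik k hko, hjk k hko]
    field_simp
  · refine mem_rootCone_of_branchValues h hz hc (funext fun l => ?_)
    by_cases hl : l ≠ i ∧ l ≠ j
    · rw [fifthPowers, extendZero_of_ne _ ⟨l, hl⟩, hik l hl]
      rfl
    · rw [fifthPowers, extendZero_eq_zero _ hl, Pi.smul_apply, branchValues, if_neg hl, smul_zero]
  · set ζ := -(p.2.rep (j, k) / p.2.rep (i, k)) with hζ
    have hjl : ∀ l, l ≠ i ∧ l ≠ j → p.2.rep (j, l) = -ζ * p.2.rep (i, l) := fun l hl => by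
      -- Since p_ij = 0, the Plücker relation reduces to p_ik p_jl = p_il p_jk.
      have := hrel i j k l
      rw [hij, zero_mul, zero_sub] at this
      rw [hζ]
      field_simp
      linear_combination -this
    funext ab
    obtain ⟨a, b⟩ := ab
    have key : ∀ c : Fin 5, c = i ∨ c = j ∨ (c ≠ i ∧ c ≠ j) := fun c => by omega
    have hw : ∀ l, l ≠ i ∧ l ≠ j → extendZero (fun l : Others i j => p.2.rep (i, l.1)) l =
        p.2.rep (i, l) := fun l hl => extendZero_of_ne _ ⟨l, hl⟩
    have hwi := extendZero_left (fun l : Others i j => p.2.rep (i, l.1))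
    have hwj := extendZero_right (fun l : Others i j => p.2.rep (i, l.1))
    rw [sheetMap_apply]
    clear_value ζ
    rcases key a with rfl | rfl | ha <;> rcases key b with rfl | rfl | hb <;>
      simp only [plucker, coneVertex, Pi.sub_apply, Pi.smul_apply, Pi.single_eq_same, smul_eq_mul,
        hwi, hwj, hd0, hij]
    · simp
    · simp
    · rw [hw _ hb]
      simp [h, hb.1]
    · rw [hanti, hij]
      simp
    · simp
    · rw [hw _ hb, hjl _ hb]
      simp [h.symm]
    · rw [hw _ ha, hanti]
      simp [h]
    · rw [hw _ ha, hanti, hjl _ ha]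
      simp [h.symm]
    · rw [hkl _ _ ha hb]
      simp [ha, hb]

theorem finite_fifthRoots : {ζ : ℂ | ζ ^ 5 = 1}.Finite := by
  refine (Polynomial.nthRoots 5 (1 : ℂ)).toFinset.finite_toSet.subset fun ζ hζ => ?_
  simpa [Polynomial.mem_nthRoots] using hζ

/-- The cone over a sheet, as a closed set. -/
def sheetCone (i j : Fin 5) (ζ : ℂ) : Set ((Fin 6 → ℂ) × (Fin 5 × Fin 5 → ℂ)) :=
  {p | p.1 ∈ exceptionalLine i j ∧ p.2 ∈ LinearMap.range (sheetMap i j ζ) ∧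
    ∀ k l : Others i j, p.2 (i, k.1) ^ 5 * branchValues i j p.1 l.1 =
      p.2 (i, l.1) ^ 5 * branchValues i j p.1 k.1}

theorem isBicone_sheetCone (ζ : ℂ) : IsBicone (sheetCone i j ζ) := by
  rintro ⟨v, P⟩ ⟨hv, hP, hw⟩ a b ha hb
  refine ⟨Submodule.smul_mem _ _ hv, Submodule.smul_mem _ _ hP, fun k l => ?_⟩
  have := hw k l
  simp only [branchValues_smul, Pi.smul_apply, smul_eq_mul] at this ⊢
  linear_combination b ^ 5 * a * this

theorem isClosed_sheetCone (ζ : ℂ) : IsClosed (sheetCone i j ζ) := by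
  have hCeq : sheetCone i j ζ = (Prod.fst ⁻¹' (exceptionalLine i j : Set (Fin 6 → ℂ))) ∩
      ((Prod.snd ⁻¹' (LinearMap.range (sheetMap i j ζ) : Set (Fin 5 × Fin 5 → ℂ))) ∩
      ⋂ k : Others i j, ⋂ l : Others i j, {p | p.2 (i, k.1) ^ 5 * branchValues i j p.1 l.1 =
        p.2 (i, l.1) ^ 5 * branchValues i j p.1 k.1}) := by
    ext p
    simp [sheetCone]
  rw [hCeq]
  refine ((Submodule.closed_of_finiteDimensional _).preimage continuous_fst).inter
    (((Submodule.closed_of_finiteDimensional _).preimage continuous_snd).inter ?_)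
  refine isClosed_iInter fun k => isClosed_iInter fun l => isClosed_eq ?_ ?_ <;>
  exact (((continuous_apply _).comp continuous_snd).pow 5).mul
    ((continuous_branchValues _).comp continuous_fst)

theorem mem_sheet_iff_mem_sheetCone (h : i ≠ j) (ζ : ℂ)
    (p : PSpace (Fin 6) × PSpace (Fin 5 × Fin 5)) :
    p ∈ sheet i j ζ ↔ (p.1.rep, p.2.rep) ∈ sheetCone i j ζ := by
  rw [mem_sheet_iff h]
  constructor
  · rintro ⟨w, hw, hT⟩
    refine ⟨rootCone_mem_line h hw, ⟨w, hT.symm⟩, fun k l => ?_⟩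
    obtain ⟨c, -, hb⟩ := rootCone_branchValues h hw
    simp only at hb ⊢
    rw [hT, hb, sheetMap_left h, sheetMap_left h]
    simp only [Pi.smul_apply, smul_eq_mul, fifthPowers, extendZero_of_ne]
    ring
  · rintro ⟨hz, ⟨w, hT⟩, hprop⟩
    simp only at hz hT hprop
    refine ⟨w, mem_rootCone_of_proportional h hz p.1.rep_nonzero
      (fun h0 => p.2.rep_nonzero (by rw [← hT, h0, map_zero])) fun k l => ?_, hT.symm⟩
    by_cases hk : k ≠ i ∧ k ≠ j
    · by_cases hl : l ≠ i ∧ l ≠ j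
      · have := hprop ⟨k, hk⟩ ⟨l, hl⟩
        rw [← hT, sheetMap_left h, sheetMap_left h] at this
        rw [fifthPowers, extendZero_of_ne _ ⟨k, hk⟩, extendZero_of_ne _ ⟨l, hl⟩]
        exact this
      · rw [fifthPowers, extendZero_eq_zero _ hl, branchValues, if_neg hl, mul_zero, zero_mul]
    · rw [fifthPowers, extendZero_eq_zero _ hk, branchValues, branchValues, if_neg hk, mul_zero,
        zero_mul]

end Fermat

theorem lineCover_eq {φ : ℂ} (hφ : φ ≠ 0) : lineCover (wimanCurve 0 φ) =
    {p | ∃ (i j : Fin 5) (ζ : ℂ), i ≠ j ∧ ζ ^ 5 = 1 ∧ p ∈ sheet i j ζ} := by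
  -- Finiteness of the index set is what makes the union of the closed cones over the sheets closed.
  let I : Set (Fin 5 × Fin 5 × ℂ) := {t | t.1 ≠ t.2.1 ∧ t.2.2 ^ 5 = 1}
  have hI : I.Finite := by
    refine (Set.finite_univ.prod (Set.finite_univ.prod finite_fifthRoots)).subset ?_
    exact fun t ht => ⟨trivial, trivial, ht.2⟩
  let C : Set ((Fin 6 → ℂ) × (Fin 5 × Fin 5 → ℂ)) := ⋃ t ∈ I, sheetCone t.1 t.2.1 t.2.2
  have hcl : IsClosed C := hI.isClosed_biUnion fun t _ => isClosed_sheetCone _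
  have hC : IsBicone C := by
    intro v hv c d hc hd
    obtain ⟨t, ht, hvt⟩ := Set.mem_iUnion₂.1 hv
    exact Set.mem_iUnion₂.2 ⟨t, ht, isBicone_sheetCone _ _ hvt c d hc hd⟩
  have hmem : ∀ p : PSpace (Fin 6) × PSpace (Fin 5 × Fin 5), (p.1.rep, p.2.rep) ∈ C ↔
      ∃ (i j : Fin 5) (ζ : ℂ), i ≠ j ∧ ζ ^ 5 = 1 ∧ p ∈ sheet i j ζ := fun p => by
    constructor
    · intro hp
      obtain ⟨t, ht, hpt⟩ := Set.mem_iUnion₂.1 hp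
      exact ⟨_, _, _, ht.1, ht.2, (mem_sheet_iff_mem_sheetCone ht.1 _ p).2 hpt⟩
    · rintro ⟨i, j, ζ, h, hζ, hp⟩
      exact Set.mem_iUnion₂.2 ⟨(i, j, ζ), ⟨h, hζ⟩, (mem_sheet_iff_mem_sheetCone h ζ p).1 hp⟩
  ext p
  constructor
  · intro hp
    refine (hmem p).1 (projClosure_subset hC hcl (fun p hp => (hmem p).2 ?_) p hp)
    obtain ⟨hz, ⟨x, y, hxy⟩, q, hq, c, hc, hpow⟩ := hp
    rw [wimanCurve_infinity hφ] at hz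
    obtain ⟨i, j, hij, hz⟩ := hz
    obtain ⟨d, hd, hq'⟩ := hq.rep_eq hij hz
    obtain ⟨ζ, hζ, hs⟩ := mem_sheet_of_pow hij hz hxy (mul_ne_zero hc hd) fun a => by
      rw [hpow, hq', mul_assoc]
    exact ⟨i, j, ζ, hij, hζ, hs⟩
  · rintro ⟨i, j, ζ, h, hζ, hp⟩
    exact sheet_subset_lineCover h hφ hζ hp

/-! ### Counting points of the fibres -/

theorem ncard_fifthRoots {A : ℂ} (hA : A ≠ 0) : {t : ℂ | t ^ 5 = A}.ncard = 5 := by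
  classical
  have hprim : IsPrimitiveRoot (Complex.exp (2 * Real.pi * Complex.I / 5)) 5 := by
    simpa using Complex.isPrimitiveRoot_exp 5 (by norm_num)
  have hset : {t : ℂ | t ^ 5 = A} = ((Polynomial.nthRoots 5 A).toFinset : Set ℂ) := by
    ext t
    simp [Polynomial.mem_nthRoots]
  rw [hset, Set.ncard_coe_finset, Multiset.toFinset_card_of_nodup (hprim.nthRoots_nodup hA),
    hprim.card_nthRoots, if_pos (IsAlgClosed.exists_pow_nat_eq A (by norm_num))]

section Fibres

variable {i j : Fin 5}

/-- A zero of the branch value at k puts z on E_lm, with l, m the other two labels off i, j. -/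
theorem branchValues_ne_zero_of_unique (h : i ≠ j) {z : PSpace (Fin 6)}
    (hz : z ∈ points (exceptionalLine i j))
    (hu : ∀ L ∈ linesOn dP5, z ∈ points L → L = exceptionalLine i j) {k : Fin 5}
    (hk : k ≠ i ∧ k ≠ j) : branchValues i j z.rep k ≠ 0 := fun h0 => by
  obtain ⟨l, m, hl, hm, hkl, hkm, hlm⟩ : ∃ l m : Fin 5, (l ≠ i ∧ l ≠ j) ∧ (m ≠ i ∧ m ≠ j) ∧
      k ≠ l ∧ k ≠ m ∧ l ≠ m := by
    clear h0 hz hu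
    revert i j k; decide
  have hz' : z ∈ points (exceptionalLine l m) :=
    mem_exceptionalLine_of_branchValues h hk hl hm hkl hkm hlm hz h0
  have he := hu (exceptionalLine l m) (by rw [linesOn_dP5]; exact ⟨l, m, hlm, rfl⟩) hz'
  rcases (exceptionalLine_eq_iff hlm h).1 he with ⟨rfl, -⟩ | ⟨rfl, -⟩
  exacts [hl.1 rfl, hm.1 rfl]

theorem mem_rootCover_iff_fifthPowers (h : i ≠ j) {z : PSpace (Fin 6)}
    (hz : z ∈ points (exceptionalLine i j)) (w : PSpace (Others i j)) :
    (z, w) ∈ rootCover i j ↔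
      ∃ c : ℂ, c ≠ 0 ∧ fifthPowers w.rep = c • branchValues i j z.rep := by
  rw [mem_rootCover_iff h]
  constructor
  · intro hw
    obtain ⟨c, hc, hb⟩ := rootCone_branchValues h hw
    exact ⟨c⁻¹, inv_ne_zero hc, by rw [hb, smul_smul, inv_mul_cancel₀ hc, one_smul]⟩
  · rintro ⟨c, hc, hb⟩
    exact mem_rootCone_of_branchValues h hz hc hb

theorem ncard_rootCover_fibre (h : i ≠ j) {z : PSpace (Fin 6)}
    (hz : z ∈ points (exceptionalLine i j))
    (hu : ∀ L ∈ linesOn dP5, z ∈ points L → L = exceptionalLine i j) :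
    {w | (z, w) ∈ rootCover i j}.ncard = 25 := by
  obtain ⟨k, l, m, hki, hkj, hli, hlj, hmi, hmj, hkl, hkm, hlm⟩ := exists_others i j h
  have : Nonempty (Others i j) := ⟨⟨k, hki, hkj⟩⟩
  have hcases := label_cases h ⟨hki, hkj⟩ ⟨hli, hlj⟩ ⟨hmi, hmj⟩ hkl hkm hlm
  have hbk := branchValues_ne_zero_of_unique h hz hu ⟨hki, hkj⟩
  have hbl := branchValues_ne_zero_of_unique h hz hu ⟨hli, hlj⟩
  have hbm := branchValues_ne_zero_of_unique h hz hu ⟨hmi, hmj⟩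
  have hbi : branchValues i j z.rep i = 0 := by simp [branchValues]
  have hbj : branchValues i j z.rep j = 0 := by simp [branchValues]
  set b := branchValues i j z.rep with hb
  -- Normalizing w_m = 1 leaves two independent fifth roots of nonzero numbers, hence 5 · 5 points.
  let V : ℂ × ℂ → Others i j → ℂ := fun t a => if a.1 = k then t.1 else if a.1 = l then t.2 else 1
  have hVk : ∀ t, V t ⟨k, hki, hkj⟩ = t.1 := fun t => by simp [V]
  have hVl : ∀ t, V t ⟨l, hli, hlj⟩ = t.2 := fun t => by simp [V, hkl.symm]
  have hVm : ∀ t, V t ⟨m, hmi, hmj⟩ = 1 := fun t => by simp [V, hkm.symm, hlm.symm]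
  have hV0 : ∀ t, V t ≠ 0 := fun t h0 => by
    have := hVm t
    rw [h0] at this
    exact one_ne_zero this.symm
  have hset : {w | (z, w) ∈ rootCover i j} = (fun t => toProj (V t)) ''
      ({t : ℂ | t ^ 5 = b k / b m} ×ˢ {t : ℂ | t ^ 5 = b l / b m}) := by
    ext w
    simp only [Set.mem_ofPred_eq, mem_rootCover_iff_fifthPowers h hz, Set.mem_image, Set.mem_prod,
      ← hb]
    constructor
    · rintro ⟨c, hc, hw⟩
      have hwa : ∀ a (ha : a ≠ i ∧ a ≠ j), w.rep ⟨a, ha⟩ ^ 5 = c * b a := fun a ha => by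
        have := congrFun hw a
        rwa [fifthPowers, extendZero_of_ne _ ⟨a, ha⟩] at this
      have hm0 : w.rep ⟨m, hmi, hmj⟩ ≠ 0 := fun h0 => by
        have := hwa m ⟨hmi, hmj⟩
        rw [h0] at this
        exact mul_ne_zero hc hbm (by simpa using this.symm)
      refine ⟨(w.rep ⟨k, hki, hkj⟩ / w.rep ⟨m, hmi, hmj⟩,
        w.rep ⟨l, hli, hlj⟩ / w.rep ⟨m, hmi, hmj⟩), ⟨?_, ?_⟩, ?_⟩
      · simp only [div_pow, hwa]
        field_simp
      · simp only [div_pow, hwa]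
        field_simp
      · refine toProj_eq (inv_ne_zero hm0) (funext fun a => ?_)
        obtain ⟨a, ha⟩ := a
        rcases hcases a with rfl | rfl | rfl | rfl | rfl
        · simp at ha
        · simp at ha
        · rw [hVk, Pi.smul_apply, smul_eq_mul]
          field_simp
        · rw [hVl, Pi.smul_apply, smul_eq_mul]
          field_simp
        · rw [hVm, Pi.smul_apply, smul_eq_mul]
          field_simp
    · rintro ⟨t, ⟨ht1, ht2⟩, rfl⟩
      rw [toProj_of_ne (hV0 t)]
      obtain ⟨d, hd, hrep⟩ := exists_rep_mk _ (hV0 t)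
      refine ⟨d ^ 5 * (b m)⁻¹, by positivity, ?_⟩
      rw [hrep, fifthPowers_smul, ← smul_smul]
      congr 1
      funext a
      rw [Pi.smul_apply, smul_eq_mul]
      rcases hcases a with rfl | rfl | rfl | rfl | rfl
      · rw [fifthPowers_left, hbi, mul_zero]
      · rw [fifthPowers_right, hbj, mul_zero]
      · rw [fifthPowers, extendZero_of_ne _ ⟨a, hki, hkj⟩, hVk, ht1]
        field_simp
      · rw [fifthPowers, extendZero_of_ne _ ⟨a, hli, hlj⟩, hVl, ht2]
        field_simp
      · rw [fifthPowers, extendZero_of_ne _ ⟨a, hmi, hmj⟩, hVm]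
        field_simp
  rw [hset, Set.InjOn.ncard_image, Set.ncard_prod, ncard_fifthRoots (div_ne_zero hbk hbm),
    ncard_fifthRoots (div_ne_zero hbl hbm)]
  intro t _ t' _ he
  simp only at he
  rw [toProj_of_ne (hV0 t), toProj_of_ne (hV0 t'), Projectivization.mk_eq_mk_iff'] at he
  obtain ⟨c, hc⟩ := he
  have h1 := congrFun hc ⟨m, hmi, hmj⟩
  rw [Pi.smul_apply, hVm, hVm, smul_eq_mul, mul_one] at h1
  rw [h1, one_smul] at hc
  refine Prod.ext ?_ ?_
  · rw [← hVk t, ← hVk t', hc]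
  · rw [← hVl t, ← hVl t', hc]

/-- The fifth-power condition sees only the unordered pair {i, j}, so `mem_sheet_of_pow` applies in
either order. The fibre count then needs only one ordering. -/
theorem exists_mem_sheet_swap (h : i ≠ j) {ζ : ℂ} (hζ : ζ ^ 5 = 1)
    {p : PSpace (Fin 6) × PSpace (Fin 5 × Fin 5)} (hp : p ∈ sheet j i ζ) :
    ∃ ζ' : ℂ, ζ' ^ 5 = 1 ∧ p ∈ sheet i j ζ' := by
  obtain ⟨hz, c, hc, hpow⟩ := sheet_pow h.symm hζ hp
  obtain ⟨w, -, hw⟩ := hp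
  rw [exceptionalLine_comm] at hz
  exact mem_sheet_of_pow h hz hw hc hpow

theorem ncard_lineCover_fibre {φ : ℂ} (hφ : φ ≠ 0) {z : PSpace (Fin 6)}
    (hz : z ∈ wimanCurve 0 φ) (hu : ∃! L, L ∈ linesOn dP5 ∧ z ∈ points L) :
    {P | (z, P) ∈ lineCover (wimanCurve 0 φ)}.ncard = 125 := by
  rw [wimanCurve_infinity hφ] at hz
  obtain ⟨i, j, h, hz⟩ := hz
  have hu' : ∀ L ∈ linesOn dP5, z ∈ points L → L = exceptionalLine i j := fun L hL hzL =>
    hu.unique ⟨hL, hzL⟩ ⟨by rw [linesOn_dP5]; exact ⟨i, j, h, rfl⟩, hz⟩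
  have hT0 : ∀ (ζ : ℂ) (w : PSpace (Others i j)), sheetMap i j ζ w.rep ≠ 0 := fun ζ w =>
    sheetMap_ne_zero h ζ w.rep_nonzero
  have hset : {P | (z, P) ∈ lineCover (wimanCurve 0 φ)} =
      (fun t : ℂ × PSpace (Others i j) => toProj (sheetMap i j t.1 t.2.rep)) ''
        ({ζ : ℂ | ζ ^ 5 = 1} ×ˢ {w | (z, w) ∈ rootCover i j}) := by
    ext P
    rw [lineCover_eq hφ]
    simp only [Set.mem_ofPred_eq, Set.mem_image, Set.mem_prod]
    constructor
    · rintro ⟨i', j', ζ', h', hζ', hP⟩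
      obtain ⟨ζ, hζ, w, hw, hPw⟩ : ∃ ζ : ℂ, ζ ^ 5 = 1 ∧ (z, P) ∈ sheet i j ζ := by
        have he := hu' _ (by rw [linesOn_dP5]; exact ⟨i', j', h', rfl⟩) (sheet_pow h' hζ' hP).1
        rcases (exceptionalLine_eq_iff h' h).1 he with ⟨rfl, rfl⟩ | ⟨rfl, rfl⟩
        · exact ⟨ζ', hζ', hP⟩
        · exact exists_mem_sheet_swap h hζ' hP
      obtain ⟨h0, hPw⟩ := hPw
      exact ⟨(ζ, w), ⟨hζ, hw⟩, (toProj_of_ne h0).trans hPw.symm⟩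
    · rintro ⟨⟨ζ, w⟩, ⟨hζ, hw⟩, rfl⟩
      exact ⟨i, j, ζ, h, hζ, w, hw, hT0 ζ w, toProj_of_ne (hT0 ζ w)⟩
  rw [hset, Set.InjOn.ncard_image, Set.ncard_prod, ncard_fifthRoots one_ne_zero,
    ncard_rootCover_fibre h hz hu']
  rintro ⟨ζ, w⟩ _ ⟨ζ', w'⟩ _ he
  simp only at he
  rw [toProj_of_ne (hT0 ζ w), toProj_of_ne (hT0 ζ' w'), Projectivization.mk_eq_mk_iff'] at he
  obtain ⟨c, hc⟩ := he
  obtain ⟨h1, h2⟩ := sheetMap_eq_smul h w.rep_nonzero hc.symm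
  exact Prod.ext h1 (eq_of_rep_eq_smul h2)

/-! ### The cones of lines -/

/-- A line is spanned by rows a and b of its Plücker matrix p whenever p_ab ≠ 0: any v on it
satisfies p_ab v_k = v_b p_ak - v_a p_bk. -/
theorem span_pair_le {x y x' y' : Fin 5 → ℂ} {c : ℂ} (hne : plucker x y ≠ 0)
    (he : plucker x y = c • plucker x' y') :
    Submodule.span ℂ {x', y'} ≤ Submodule.span ℂ {x, y} := by
  obtain ⟨⟨a, b⟩, hab⟩ := Function.ne_iff.1 hne
  have hab0 : plucker x y (a, b) ≠ 0 := hab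
  have hk : ∀ a k, x a * y k - x k * y a = c * (x' a * y' k - x' k * y' a) := fun a k =>
    congrFun he (a, k)
  have hpi : plucker x y (a, b) = c * (x' a * y' b - x' b * y' a) := congrFun he (a, b)
  rw [Submodule.span_le]
  have hmem : ∀ u v : ℂ, (plucker x y (a, b))⁻¹ • (u • (x a • y - y a • x) +
      v • (x b • y - y b • x)) ∈ Submodule.span ℂ {x, y} := fun u v => by
    have hx : x ∈ Submodule.span ℂ {x, y} := Submodule.subset_span (by simp)
    have hy : y ∈ Submodule.span ℂ {x, y} := Submodule.subset_span (by simp)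
    exact Submodule.smul_mem _ _ (Submodule.add_mem _
      (Submodule.smul_mem _ _ (Submodule.sub_mem _ (Submodule.smul_mem _ _ hy)
        (Submodule.smul_mem _ _ hx)))
      (Submodule.smul_mem _ _ (Submodule.sub_mem _ (Submodule.smul_mem _ _ hy)
        (Submodule.smul_mem _ _ hx))))
  rintro v (rfl | rfl)
  · refine (congrArg (· ∈ Submodule.span ℂ {x, y}) (funext fun k => ?_)).mpr
      (hmem (v b) (-v a))
    simp only [Pi.smul_apply, Pi.add_apply, Pi.sub_apply, smul_eq_mul]
    rw [eq_inv_mul_iff_mul_eq₀ hab0, hpi]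
    linear_combination -v b * hk a k + v a * hk b k
  · refine (congrArg (· ∈ Submodule.span ℂ {x, y}) (funext fun k => ?_)).mpr
      (hmem (v b) (-v a))
    simp only [Pi.smul_apply, Pi.add_apply, Pi.sub_apply, smul_eq_mul]
    rw [eq_inv_mul_iff_mul_eq₀ hab0, hpi]
    linear_combination -v b * hk a k + v a * hk b k

theorem span_pair_eq {x y x' y' : Fin 5 → ℂ} {c : ℂ} (hc : c ≠ 0) (hne : plucker x y ≠ 0)
    (he : plucker x y = c • plucker x' y') :
    Submodule.span ℂ {x, y} = Submodule.span ℂ {x', y'} := by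
  have he' : plucker x' y' = c⁻¹ • plucker x y := by
    rw [he, smul_smul, inv_mul_cancel₀ hc, one_smul]
  refine le_antisymm (span_pair_le ?_ he') (span_pair_le hne he)
  rw [he']
  exact smul_ne_zero (inv_ne_zero hc) hne

theorem mk_mem_sheet (h : i ≠ j) (ζ : ℂ) {v : Fin 6 → ℂ} {w : Others i j → ℂ} (hv : v ≠ 0)
    (hT : sheetMap i j ζ w ≠ 0) (hvw : (v, w) ∈ rootCone i j) :
    (Projectivization.mk ℂ v hv, Projectivization.mk ℂ _ hT) ∈ sheet i j ζ := by
  obtain ⟨c, hc, hrep⟩ := exists_rep_mk _ hv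
  obtain ⟨d, hd, hrep'⟩ := exists_rep_mk _ hT
  refine (mem_sheet_iff h ζ _).2 ⟨d • w, ?_, ?_⟩
  · simp only [hrep]
    exact isBicone_rootCone _ hvw c d hc hd
  · simp only [hrep', map_smul]

theorem isPluckerPoint_mk {x y : Fin 5 → ℂ} {P : Fin 5 × Fin 5 → ℂ} (hP : P ≠ 0)
    (h : plucker x y = P) : IsPluckerPoint x y (Projectivization.mk ℂ P hP) := by
  subst h
  exact ⟨hP, rfl⟩

theorem parametrizedLines_sheet (h : i ≠ j) (ζ : ℂ) :
    parametrizedLines (sheet i j ζ) = cone i j ζ := by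
  ext L
  constructor
  · rintro ⟨x, y, rfl, p, hp, hne, hP⟩
    obtain ⟨w, hw, hT⟩ := (mem_sheet_iff h ζ p).1 hp
    have hw0 : w ≠ 0 := fun h0 => p.2.rep_nonzero (by rw [hT, h0, map_zero])
    obtain ⟨d, hd, hrep⟩ := exists_rep_mk _ hne
    rw [← hP, hT] at hrep
    refine ⟨extendZero w, extendZero_ne_zero hw0, extendZero_left w, extendZero_right w, ?_, ?_⟩
    · simpa only [extendZero_pow] using hw.1
    · exact (span_pair_eq hd (sheetMap_ne_zero h ζ hw0) hrep).symm
  · rintro ⟨x, hx0, hi, hj, hx5, rfl⟩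
    let w : Others i j → ℂ := fun k => x k.1
    have hwx : extendZero w = x := by
      funext k
      by_cases hk : k ≠ i ∧ k ≠ j
      · exact extendZero_of_ne w ⟨k, hk⟩
      · rw [extendZero_eq_zero w hk]
        have : k = i ∨ k = j := by tauto
        rcases this with rfl | rfl
        exacts [hi.symm, hj.symm]
    have hw0 : w ≠ 0 := fun h0 => hx0 <| by
      rw [← hwx, h0]
      exact (extendZeroLinear i j).map_zero
    have hs : ∑ k, fifthPowers w k = 0 := by
      simpa only [← extendZero_pow, hwx] using hx5
    have hz := linePoint_fifthPowers_ne_zero h hw0 hs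
    have hT := sheetMap_ne_zero h ζ hw0
    have hT' : plucker (coneVertex i j ζ) x = sheetMap i j ζ w := by
      rw [sheetMap_apply, hwx]
    exact ⟨coneVertex i j ζ, x, rfl, _,
      mk_mem_sheet h ζ hz hT ⟨hs, 1, one_ne_zero, (one_smul _ _).symm⟩,
      isPluckerPoint_mk hT hT'⟩

theorem coneVertex_left (h : i ≠ j) (ζ : ℂ) : coneVertex i j ζ i = 1 := by
  simp [coneVertex, h]

theorem coneVertex_right (h : i ≠ j) (ζ : ℂ) : coneVertex i j ζ j = -ζ := by
  simp [coneVertex, h.symm]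

theorem coneVertex_other (ζ : ℂ) {k : Fin 5} (hk : k ≠ i ∧ k ≠ j) : coneVertex i j ζ k = 0 := by
  simp [coneVertex, hk]

/-- The vertices are proportional, with factor -ζ, because ζ · ζ⁴ = 1. Ordered pairs thus count
every cone twice. -/
theorem cone_swap (h : i ≠ j) {ζ : ℂ} (hζ : ζ ^ 5 = 1) : cone i j ζ = cone j i (ζ ^ 4) := by
  have hv : coneVertex i j ζ = -ζ • coneVertex j i (ζ ^ 4) := by
    funext k
    have key : k = i ∨ k = j ∨ (k ≠ i ∧ k ≠ j) := by omega
    rw [Pi.smul_apply, smul_eq_mul]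
    rcases key with rfl | rfl | hk
    · rw [coneVertex_left h, coneVertex_right h.symm]
      linear_combination -hζ
    · rw [coneVertex_right h, coneVertex_left h.symm, mul_one]
    · rw [coneVertex_other ζ hk, coneVertex_other _ hk.symm, mul_zero]
  have hζ0 : -ζ ≠ 0 := fun h0 => by
    rw [neg_eq_zero.1 h0] at hζ
    norm_num at hζ
  have hspan : ∀ x, Submodule.span ℂ {coneVertex i j ζ, x} =
      Submodule.span ℂ {coneVertex j i (ζ ^ 4), x} := fun x => by
    rw [Submodule.span_insert, Submodule.span_insert, hv,
      Submodule.span_singleton_smul_eq (IsUnit.mk0 _ hζ0)]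
  ext L
  simp only [cone, Set.mem_ofPred_eq, hspan]
  constructor <;> rintro ⟨x, h0, h1, h2, h3⟩ <;> exact ⟨x, h0, h2, h1, h3⟩

theorem mem_cone_of_difference (ζ : ℂ) {k l : Fin 5} (hk : k ≠ i ∧ k ≠ j)
    (hl : l ≠ i ∧ l ≠ j) (hkl : k ≠ l) :
    Submodule.span ℂ {coneVertex i j ζ, Pi.single k 1 - Pi.single l 1} ∈ cone i j ζ := by
  refine ⟨_, fun h0 => ?_, ?_, ?_, ?_, rfl⟩
  · have := congrFun h0 k
    simp [hkl] at this
  · simp [hk.1.symm, hl.1.symm]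
  · simp [hk.2.symm, hl.2.symm]
  · have : ∀ a : Fin 5, ((Pi.single k 1 - Pi.single l 1 : Fin 5 → ℂ) a) ^ 5 =
        (Pi.single k 1 - Pi.single l 1 : Fin 5 → ℂ) a := fun a => by
      by_cases hak : a = k
      · subst hak; simp [hkl]
      · by_cases hal : a = l
        · subst hal
          simp [hak]
          norm_num
        · simp [hak, hal]
    simp only [this]
    simp [Finset.sum_sub_distrib]

/-- A cone determines its vertex as the common point of two of its lines, here those through e_k -
e_l and e_k - e_m. -/
theorem coneVertex_of_cone_eq (h : i ≠ j) {ζ ζ' : ℂ} {i' j' : Fin 5}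
    (he : cone i j ζ = cone i' j' ζ') : ∃ a : ℂ, coneVertex i' j' ζ' = a • coneVertex i j ζ := by
  obtain ⟨k, l, m, hki, hkj, hli, hlj, hmi, hmj, hkl, hkm, hlm⟩ := exists_others i j h
  have hmem : ∀ l, l ≠ i ∧ l ≠ j → k ≠ l → ∃ a b : ℂ, a • coneVertex i j ζ +
      b • (Pi.single k 1 - Pi.single l 1) = coneVertex i' j' ζ' := fun l hl hkl => by
    have h1 := mem_cone_of_difference ζ ⟨hki, hkj⟩ hl hkl
    rw [he] at h1
    obtain ⟨x, -, -, -, -, hx⟩ := h1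
    refine Submodule.mem_span_pair.1 ?_
    rw [hx]
    exact Submodule.subset_span (by simp)
  obtain ⟨a, b, hab⟩ := hmem l ⟨hli, hlj⟩ hkl
  obtain ⟨a', b', hab'⟩ := hmem m ⟨hmi, hmj⟩ hkm
  have hb : b = 0 := by
    have := congrFun (hab.trans hab'.symm) l
    simpa [coneVertex_other ζ ⟨hli, hlj⟩, hkl.symm, hlm] using this
  exact ⟨a, by rw [← hab, hb]; simp⟩

theorem ncard_cones : {K | ∃ (i j : Fin 5) (ζ : ℂ), i ≠ j ∧ ζ ^ 5 = 1 ∧ K = cone i j ζ}.ncard =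
    50 := by
  have hset : {K | ∃ (i j : Fin 5) (ζ : ℂ), i ≠ j ∧ ζ ^ 5 = 1 ∧ K = cone i j ζ} =
      (fun t : (Fin 5 × Fin 5) × ℂ => cone t.1.1 t.1.2 t.2) ''
      (((Finset.univ.filter fun p : Fin 5 × Fin 5 => p.1 < p.2 : Finset (Fin 5 × Fin 5)) :
        Set (Fin 5 × Fin 5)) ×ˢ {ζ : ℂ | ζ ^ 5 = 1}) := by
    ext K
    simp only [Set.mem_ofPred_eq, Set.mem_image, Set.mem_prod, Finset.coe_filter, Finset.mem_univ,
      true_and, Prod.exists]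
    constructor
    · rintro ⟨i, j, ζ, hij, hζ, rfl⟩
      rcases lt_or_gt_of_ne hij with hlt | hlt
      · exact ⟨i, j, ζ, ⟨hlt, hζ⟩, rfl⟩
      · exact ⟨j, i, ζ ^ 4, ⟨hlt, by rw [← pow_mul, mul_comm, pow_mul, hζ, one_pow]⟩,
          (cone_swap hij hζ).symm⟩
    · rintro ⟨i, j, ζ, ⟨hlt, hζ⟩, rfl⟩
      exact ⟨i, j, ζ, hlt.ne, hζ, rfl⟩
  rw [hset, Set.InjOn.ncard_image, Set.ncard_prod, Set.ncard_coe_finset,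
    ncard_fifthRoots one_ne_zero]
  · decide
  · rintro ⟨⟨i, j⟩, ζ⟩ ht ⟨⟨i', j'⟩, ζ'⟩ ht' he
    simp only [Set.mem_prod, Finset.coe_filter, Finset.mem_univ, true_and, Set.mem_ofPred_eq]
      at ht ht' he
    obtain ⟨hij, hζ⟩ := ht
    obtain ⟨hij', hζ'⟩ := ht'
    obtain ⟨a, ha⟩ := coneVertex_of_cone_eq hij.ne he
    have hi' : i' = i ∨ i' = j := by
      by_contra hn
      have := congrFun ha i'
      rw [coneVertex_left hij'.ne, Pi.smul_apply, coneVertex_other ζ (by tauto)] at this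
      simp at this
    have hj' : j' = i ∨ j' = j := by
      by_contra hn
      have := congrFun ha j'
      rw [coneVertex_right hij'.ne, Pi.smul_apply, coneVertex_other ζ (by tauto)] at this
      simp only [smul_zero, neg_eq_zero] at this
      rw [this] at hζ'
      norm_num at hζ'
    obtain ⟨rfl, rfl⟩ : i' = i ∧ j' = j := by omega
    have h1 := congrFun ha i'
    rw [Pi.smul_apply, coneVertex_left hij'.ne, coneVertex_left hij'.ne, smul_eq_mul, mul_one] at h1
    have h2 := congrFun ha j'
    rw [Pi.smul_apply, coneVertex_right hij'.ne, coneVertex_right hij'.ne, smul_eq_mul, ← h1,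
      one_mul] at h2
    rw [neg_inj.1 h2]

end Fibres

theorem parametrizedLines_lineCover {φ : ℂ} (hφ : φ ≠ 0) :
    parametrizedLines (lineCover (wimanCurve 0 φ)) =
      {L | ∃ (i j : Fin 5) (ζ : ℂ), i ≠ j ∧ ζ ^ 5 = 1 ∧ L ∈ cone i j ζ} := by
  rw [lineCover_eq hφ]
  ext L
  constructor
  · rintro ⟨x, y, hL, p, ⟨i, j, ζ, h, hζ, hp⟩, hP⟩
    exact ⟨i, j, ζ, h, hζ, by rw [← parametrizedLines_sheet h]; exact ⟨x, y, hL, p, hp, hP⟩⟩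
  · rintro ⟨i, j, ζ, h, hζ, hL⟩
    rw [← parametrizedLines_sheet h] at hL
    obtain ⟨x, y, hL, p, hp, hP⟩ := hL
    exact ⟨x, y, hL, p, ⟨i, j, ζ, h, hζ, hp⟩, hP⟩

/-! ### The lines on the Fermat quintic -/

/-- The last three hypotheses say that Σ x_n² y_n Q(x_n, y_n) = 0 for every binary quadratic form Q.
Testing with well-chosen Q shows which of the vectors (x_n, y_n) are parallel. -/
theorem mul_eq_zero_of_moments {x₁ x₂ x₃ y₁ y₂ y₃ : ℂ}
    (hx : 1 + x₁ ^ 5 + x₂ ^ 5 + x₃ ^ 5 = 0) (hy : 1 + y₁ ^ 5 + y₂ ^ 5 + y₃ ^ 5 = 0)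
    (h₁ : x₁ ^ 4 * y₁ + x₂ ^ 4 * y₂ + x₃ ^ 4 * y₃ = 0)
    (h₂ : x₁ ^ 3 * y₁ ^ 2 + x₂ ^ 3 * y₂ ^ 2 + x₃ ^ 3 * y₃ ^ 2 = 0)
    (h₃ : x₁ ^ 2 * y₁ ^ 3 + x₂ ^ 2 * y₂ ^ 3 + x₃ ^ 2 * y₃ ^ 3 = 0) : x₁ * y₁ = 0 := by
  by_contra hne
  obtain ⟨hx₁, hy₁⟩ := mul_ne_zero_iff.1 hne
  -- Q is the form vanishing at the second and third vectors.
  have hprod : (x₁ ^ 2 * y₁) * ((x₁ * y₂ - y₁ * x₂) * (x₁ * y₃ - y₁ * x₃)) = 0 := by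
    linear_combination y₂ * y₃ * h₁ - (x₂ * y₃ + y₂ * x₃) * h₂ + x₂ * x₃ * h₃
  have hor := mul_eq_zero.1 ((mul_eq_zero.1 hprod).resolve_left
    (mul_ne_zero (pow_ne_zero 2 hx₁) hy₁))
  wlog hπ : x₁ * y₂ - y₁ * x₂ = 0 generalizing x₂ y₂ x₃ y₃
  · exact this (x₂ := x₃) (y₂ := y₃) (x₃ := x₂) (y₃ := y₂)
      (by linear_combination hx) (by linear_combination hy) (by linear_combination h₁)
      (by linear_combination h₂) (by linear_combination h₃) (by linear_combination hprod)
      hor.symm (hor.resolve_left hπ)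
  obtain ⟨t, rfl⟩ : ∃ t, x₂ = t * x₁ := ⟨x₂ / x₁, by field_simp⟩
  obtain rfl : y₂ = t * y₁ := mul_left_cancel₀ hx₁ (by linear_combination hπ)
  by_cases hπ' : x₁ * y₃ - y₁ * x₃ = 0
  · obtain ⟨s, rfl⟩ : ∃ s, x₃ = s * x₁ := ⟨x₃ / x₁, by field_simp⟩
    obtain rfl : y₃ = s * y₁ := mul_left_cancel₀ hx₁ (by linear_combination hπ')
    have h0 : x₁ ^ 4 * y₁ * (1 + t ^ 5 + s ^ 5) = 0 := by linear_combination h₁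
    have h1 := (mul_eq_zero.1 h0).resolve_left (mul_ne_zero (pow_ne_zero 4 hx₁) hy₁)
    exact one_ne_zero (by linear_combination hx - x₁ ^ 5 * h1)
  -- Here Q is x times the linear form vanishing at the third vector. The first two terms then
  -- cancel everywhere, which leaves x₃⁵ = y₃⁵ = -1 together with x₃⁴ y₃ = 0.
  · have h0 : x₁ ^ 3 * y₁ * (x₁ * y₃ - y₁ * x₃) * (1 + t ^ 5) = 0 := by
      linear_combination y₃ * h₁ - x₃ * h₂
    have h1 := (mul_eq_zero.1 h0).resolve_left
      (mul_ne_zero (mul_ne_zero (pow_ne_zero 3 hx₁) hy₁) hπ')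
    have h2 : x₃ ^ 5 = -1 := by linear_combination hx - x₁ ^ 5 * h1
    have h3 : y₃ ^ 5 = -1 := by linear_combination hy - y₁ ^ 5 * h1
    have h4 : x₃ ^ 4 * y₃ = 0 := by linear_combination h₁ - x₁ ^ 4 * y₁ * h1
    rcases mul_eq_zero.1 h4 with h5 | h5
    · rw [pow_eq_zero_iff (by norm_num)] at h5
      rw [h5] at h2
      norm_num at h2
    · rw [h5] at h3
      norm_num at h3

theorem mem_cone_of_pure {i j k : Fin 5} {x y : Fin 5 → ℂ} (hik : i ≠ k)
    (hxi : x i = 1) (hyi : y i = 0) (hyk : y k = 0) (hyj : y j = 1)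
    (hx : ∀ n, n ≠ i → n ≠ k → x n = 0) (hy : ∑ n, y n ^ 5 = 0) :
    Submodule.span ℂ {x, y} ∈ cone i k (-x k) := by
  refine ⟨y, fun h0 => one_ne_zero (hyj.symm.trans (congrFun h0 j)), hyi, hyk, hy, ?_⟩
  congr 2
  funext n
  by_cases hni : n = i
  · rw [hni, hxi, coneVertex_left hik]
  · by_cases hnk : n = k
    · rw [hnk, coneVertex_right hik, neg_neg]
    · rw [hx n hni hnk, coneVertex_other _ ⟨hni, hnk⟩]

/-- The two triples have disjoint supports, both nonempty, inside three places. One of the supports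
is therefore a single place, where the other triple vanishes. -/
theorem exists_pure_of_mul_eq_zero {x₁ x₂ x₃ y₁ y₂ y₃ : ℂ}
    (hx : 1 + x₁ ^ 5 + x₂ ^ 5 + x₃ ^ 5 = 0) (hy : 1 + y₁ ^ 5 + y₂ ^ 5 + y₃ ^ 5 = 0)
    (h₁ : x₁ = 0 ∨ y₁ = 0) (h₂ : x₂ = 0 ∨ y₂ = 0) (h₃ : x₃ = 0 ∨ y₃ = 0) :
    (y₁ = 0 ∧ x₂ = 0 ∧ x₃ = 0 ∨ y₂ = 0 ∧ x₁ = 0 ∧ x₃ = 0 ∨ y₃ = 0 ∧ x₁ = 0 ∧ x₂ = 0) ∨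
    (x₁ = 0 ∧ y₂ = 0 ∧ y₃ = 0 ∨ x₂ = 0 ∧ y₁ = 0 ∧ y₃ = 0 ∨ x₃ = 0 ∧ y₁ = 0 ∧ y₂ = 0) := by
  have hx' : ¬ (x₁ = 0 ∧ x₂ = 0 ∧ x₃ = 0) := by
    rintro ⟨rfl, rfl, rfl⟩
    norm_num at hx
  have hy' : ¬ (y₁ = 0 ∧ y₂ = 0 ∧ y₃ = 0) := by
    rintro ⟨rfl, rfl, rfl⟩
    norm_num at hy
  tauto

theorem exists_cone_of_sum_pow_five {i j : Fin 5} (h : i ≠ j) {x y : Fin 5 → ℂ}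
    (hxi : x i = 1) (hxj : x j = 0) (hyi : y i = 0) (hyj : y j = 1)
    (hxy : ∀ s t : ℂ, ∑ n, (s * x n + t * y n) ^ 5 = 0) :
    ∃ (i j : Fin 5) (ζ : ℂ), i ≠ j ∧ ζ ^ 5 = 1 ∧ Submodule.span ℂ {x, y} ∈ cone i j ζ := by
  have hx5 : ∑ n, x n ^ 5 = 0 := by simpa using hxy 1 0
  have hy5 : ∑ n, y n ^ 5 = 0 := by simpa using hxy 0 1
  have left : ∀ k, k ≠ i ∧ k ≠ j → y k = 0 → (∀ n, n ≠ i → n ≠ k → x n = 0) →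
      ∃ (i j : Fin 5) (ζ : ℂ), i ≠ j ∧ ζ ^ 5 = 1 ∧ Submodule.span ℂ {x, y} ∈ cone i j ζ :=
    fun k hk hyk hx => by
      refine ⟨i, k, -x k, hk.1.symm, ?_, mem_cone_of_pure hk.1.symm hxi hyi hyk hyj hx hy5⟩
      rw [Finset.sum_eq_add i k hk.1.symm (fun n _ hn => by rw [hx n hn.1 hn.2]; norm_num)
        (by simp) (by simp), hxi] at hx5
      linear_combination -hx5
  have right : ∀ k, k ≠ i ∧ k ≠ j → x k = 0 → (∀ n, n ≠ j → n ≠ k → y n = 0) →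
      ∃ (i j : Fin 5) (ζ : ℂ), i ≠ j ∧ ζ ^ 5 = 1 ∧ Submodule.span ℂ {x, y} ∈ cone i j ζ :=
    fun k hk hxk hy => by
      rw [Set.pair_comm]
      refine ⟨j, k, -y k, hk.2.symm, ?_, mem_cone_of_pure hk.2.symm hyj hxj hxk hxi hy hx5⟩
      rw [Finset.sum_eq_add j k hk.2.symm (fun n _ hn => by rw [hy n hn.1 hn.2]; norm_num)
        (by simp) (by simp), hyj] at hy5
      linear_combination -hy5
  obtain ⟨k, l, m, hki, hkj, hli, hlj, hmi, hmj, hkl, hkm, hlm⟩ := exists_others i j h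
  have hcases := label_cases h ⟨hki, hkj⟩ ⟨hli, hlj⟩ ⟨hmi, hmj⟩ hkl hkm hlm
  simp only [sum_labels h ⟨hki, hkj⟩ ⟨hli, hlj⟩ ⟨hmi, hmj⟩ hkl hkm hlm, hxi, hxj, hyi, hyj]
    at hxy
  have hx : 1 + x k ^ 5 + x l ^ 5 + x m ^ 5 = 0 := by linear_combination hxy 1 0
  have hy : 1 + y k ^ 5 + y l ^ 5 + y m ^ 5 = 0 := by linear_combination hxy 0 1
  -- The middle coefficients of the quintic in t are interpolated from its values at t = ±1, ±2: odd
  -- and even parts are separated, one unknown is eliminated in each, and the extreme coefficients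
  -- are removed by `hy` and `hx`.
  have e₁ : x k ^ 4 * y k + x l ^ 4 * y l + x m ^ 4 * y m = 0 := by
    linear_combination (8 * (hxy 1 1 - hxy 1 (-1)) - (hxy 1 2 - hxy 1 (-2))) / 60 + 4 / 5 * hy
  have e₂ : x k ^ 3 * y k ^ 2 + x l ^ 3 * y l ^ 2 + x m ^ 3 * y m ^ 2 = 0 := by
    linear_combination (16 * (hxy 1 1 + hxy 1 (-1)) - (hxy 1 2 + hxy 1 (-2))) / 240 - hx / 8
  have e₃ : x k ^ 2 * y k ^ 3 + x l ^ 2 * y l ^ 3 + x m ^ 2 * y m ^ 3 = 0 := by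
    linear_combination ((hxy 1 2 - hxy 1 (-2)) - 2 * (hxy 1 1 - hxy 1 (-1))) / 120 - hy / 2
  have zk := mul_eq_zero.1 (mul_eq_zero_of_moments hx hy e₁ e₂ e₃)
  have zl := mul_eq_zero.1 (mul_eq_zero_of_moments (x₁ := x l) (x₂ := x k) (x₃ := x m)
    (y₁ := y l) (y₂ := y k) (y₃ := y m) (by linear_combination hx) (by linear_combination hy)
    (by linear_combination e₁) (by linear_combination e₂) (by linear_combination e₃))
  have zm := mul_eq_zero.1 (mul_eq_zero_of_moments (x₁ := x m) (x₂ := x k) (x₃ := x l)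
    (y₁ := y m) (y₂ := y k) (y₃ := y l) (by linear_combination hx) (by linear_combination hy)
    (by linear_combination e₁) (by linear_combination e₂) (by linear_combination e₃))
  have fill : ∀ (f : Fin 5 → ℂ) (a b : Fin 5), (∀ n, n = i ∨ n = j ∨ n = k ∨ n = l ∨ n = m →
      n ≠ a → n ≠ b → f n = 0) → ∀ n, n ≠ a → n ≠ b → f n = 0 := fun f a b hf n =>
    hf n (hcases n)
  rcases exists_pure_of_mul_eq_zero hx hy zk zl zm with
    (⟨h0, h1, h2⟩ | ⟨h0, h1, h2⟩ | ⟨h0, h1, h2⟩) | (⟨h0, h1, h2⟩ | ⟨h0, h1, h2⟩ | ⟨h0, h1, h2⟩)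
  · refine left k ⟨hki, hkj⟩ h0 (fill _ _ _ ?_)
    rintro n (rfl | rfl | rfl | rfl | rfl) <;> intro _ _ <;> first | assumption | contradiction
  · refine left l ⟨hli, hlj⟩ h0 (fill _ _ _ ?_)
    rintro n (rfl | rfl | rfl | rfl | rfl) <;> intro _ _ <;> first | assumption | contradiction
  · refine left m ⟨hmi, hmj⟩ h0 (fill _ _ _ ?_)
    rintro n (rfl | rfl | rfl | rfl | rfl) <;> intro _ _ <;> first | assumption | contradiction
  · refine right k ⟨hki, hkj⟩ h0 (fill _ _ _ ?_)
    rintro n (rfl | rfl | rfl | rfl | rfl) <;> intro _ _ <;> first | assumption | contradiction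
  · refine right l ⟨hli, hlj⟩ h0 (fill _ _ _ ?_)
    rintro n (rfl | rfl | rfl | rfl | rfl) <;> intro _ _ <;> first | assumption | contradiction
  · refine right m ⟨hmi, hmj⟩ h0 (fill _ _ _ ?_)
    rintro n (rfl | rfl | rfl | rfl | rfl) <;> intro _ _ <;> first | assumption | contradiction

theorem finrank_span_pair {x y : Fin 5 → ℂ} (h : LinearIndependent ℂ ![x, y]) :
    Module.finrank ℂ (Submodule.span ℂ {x, y}) = 2 := by
  have := finrank_span_eq_card h
  rwa [Matrix.range_cons_cons_empty, Fintype.card_fin] at this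

theorem exists_reduced_basis {L : Submodule ℂ (Fin 5 → ℂ)} (hL : Module.finrank ℂ L = 2) :
    ∃ (i j : Fin 5) (x y : Fin 5 → ℂ), i ≠ j ∧ x i = 1 ∧ x j = 0 ∧ y i = 0 ∧ y j = 1 ∧
      L = Submodule.span ℂ {x, y} := by
  have : Nontrivial L := Module.nontrivial_of_finrank_pos (R := ℂ) (by omega)
  obtain ⟨u, hu⟩ := exists_ne (0 : L)
  obtain ⟨v, hv⟩ := exists_linearIndependent_pair_of_one_lt_finrank (R := ℂ) (M := L)
    (by omega) hu
  rw [LinearIndependent.pair_iff] at hv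
  have hu0 : (u : Fin 5 → ℂ) ≠ 0 := fun h0 => hu (Subtype.ext h0)
  obtain ⟨a, ha⟩ := Function.ne_iff.1 hu0
  obtain ⟨b, hb⟩ : ∃ b, u.1 a * v.1 b - u.1 b * v.1 a ≠ 0 := by
    by_contra! hn
    have := hv (-v.1 a) (u.1 a) (Subtype.ext (funext fun k => by
      simp only [Submodule.coe_add, Submodule.coe_smul, Pi.add_apply, Pi.smul_apply,
        smul_eq_mul, ZeroMemClass.coe_zero, Pi.zero_apply]
      linear_combination hn k))
    exact ha this.2
  -- Cramer's rule with this nonzero minor reduces the basis at the coordinates a and b.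
  set d := u.1 a * v.1 b - u.1 b * v.1 a with hd
  have hab : a ≠ b := by
    rintro rfl
    exact hb (by rw [hd]; ring)
  let x : L := d⁻¹ • (v.1 b • u - u.1 b • v)
  let y : L := d⁻¹ • (u.1 a • v - v.1 a • u)
  have hxa : x.1 a = 1 := by
    simp only [x, Submodule.coe_sub, Submodule.coe_smul, Pi.sub_apply, Pi.smul_apply, smul_eq_mul]
    rw [inv_mul_eq_one₀ hb, hd]
    ring
  have hxb : x.1 b = 0 := by
    simp only [x, Submodule.coe_sub, Submodule.coe_smul, Pi.sub_apply, Pi.smul_apply, smul_eq_mul]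
    ring
  have hya : y.1 a = 0 := by
    simp only [y, Submodule.coe_sub, Submodule.coe_smul, Pi.sub_apply, Pi.smul_apply, smul_eq_mul]
    ring
  have hyb : y.1 b = 1 := by
    simp only [y, Submodule.coe_sub, Submodule.coe_smul, Pi.sub_apply, Pi.smul_apply, smul_eq_mul]
    rw [inv_mul_eq_one₀ hb, hd]
    ring
  refine ⟨a, b, x.1, y.1, hab, hxa, hxb, hya, hyb, (Submodule.eq_of_le_of_finrank_eq ?_ ?_).symm⟩
  · rw [Submodule.span_le]
    rintro w (rfl | rfl)
    exacts [x.2, y.2]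
  · rw [hL]
    refine finrank_span_pair (LinearIndependent.pair_iff.2 fun s t hst => ⟨?_, ?_⟩)
    · simpa [hxa, hya] using congrFun hst a
    · simpa [hxb, hyb] using congrFun hst b

theorem points_subset_dworkQuintic_zero_iff (L : Submodule ℂ (Fin 5 → ℂ)) :
    points L ⊆ dworkQuintic 0 ↔ ∀ v ∈ L, ∑ k, v k ^ 5 = 0 := by
  constructor
  · intro hL v hv
    by_cases hv0 : v = 0
    · simp [hv0]
    · obtain ⟨c, hc, hrep⟩ := exists_rep_mk v hv0
      have hm : Projectivization.mk ℂ v hv0 ∈ dworkQuintic 0 := hL ((mk_mem_points hv0).2 hv)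
      simp only [dworkQuintic, Set.mem_ofPred_eq, hrep, Pi.smul_apply, smul_eq_mul, mul_pow,
        ← Finset.mul_sum, mul_zero, zero_mul, sub_zero] at hm
      exact (mul_eq_zero.1 hm).resolve_left (pow_ne_zero 5 hc)
  · intro hL p hp
    simpa [dworkQuintic] using hL _ hp

theorem linesOn_dworkQuintic_zero : linesOn (dworkQuintic 0) =
    {L | ∃ (i j : Fin 5) (ζ : ℂ), i ≠ j ∧ ζ ^ 5 = 1 ∧ L ∈ cone i j ζ} := by
  ext L
  simp only [linesOn, Set.mem_ofPred_eq, points_subset_dworkQuintic_zero_iff]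
  constructor
  · rintro ⟨hrk, hL⟩
    obtain ⟨i, j, x, y, hij, hxi, hxj, hyi, hyj, rfl⟩ := exists_reduced_basis hrk
    exact exists_cone_of_sum_pow_five hij hxi hxj hyi hyj fun s t =>
      hL (s • x + t • y) (Submodule.mem_span_pair.2 ⟨s, t, rfl⟩)
  · rintro ⟨i, j, ζ, h, hζ, x, hx0, hi, hj, hx5, rfl⟩
    constructor
    · refine finrank_span_pair (LinearIndependent.pair_iff.2 fun s t hst => ?_)
      have hs : s = 0 := by simpa [coneVertex_left h, hi] using congrFun hst i
      rw [hs, zero_smul, zero_add] at hst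
      exact ⟨hs, (smul_eq_zero.1 hst).resolve_right hx0⟩
    · intro v hv
      obtain ⟨s, t, rfl⟩ := Submodule.mem_span_pair.1 hv
      obtain ⟨k, l, m, hki, hkj, hli, hlj, hmi, hmj, hkl, hkm, hlm⟩ := exists_others i j h
      rw [sum_labels h ⟨hki, hkj⟩ ⟨hli, hlj⟩ ⟨hmi, hmj⟩ hkl hkm hlm] at hx5 ⊢
      simp only [Pi.add_apply, Pi.smul_apply, smul_eq_mul, coneVertex_left h,
        coneVertex_right h, coneVertex_other ζ ⟨hki, hkj⟩, coneVertex_other ζ ⟨hli, hlj⟩,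
        coneVertex_other ζ ⟨hmi, hmj⟩, hi, hj] at hx5 ⊢
      -- Since the supports are disjoint, the sum of fifth powers splits as s⁵(1 - ζ⁵) + t⁵ Σ x_k⁵.
      linear_combination t ^ 5 * hx5 - s ^ 5 * hζ

end DworkFermat

theorem mainTheorem8 (φ₀ φ₁ : ℂ) (hφ : ¬ (φ₀ = 0 ∧ φ₁ = 0))
    (hψ : ParameterRelation 0 φ₀ φ₁) :
    -- for `ψ = 0` the parameter is `φ = ∞`
    φ₀ = 0 ∧
    -- the surface contains exactly ten lines, the lines `E_{ij}`
    linesOn dP5 = {L | ∃ i j : Fin 5, i ≠ j ∧ L = exceptionalLine i j} ∧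
    (linesOn dP5).ncard = 10 ∧
    -- `C_∞` is their union
    wimanCurve φ₀ φ₁ = ⋃ L ∈ linesOn dP5, points L ∧
    -- the cover of each `E_{ij}` given by two polynomials is a Fermat curve, of degree 25
    (∀ i j : Fin 5, i ≠ j →
      IsIsomorphic (rootCover i j) fermatCurve ∧
      (Prod.fst '' rootCover i j = points (exceptionalLine i j)) ∧
      ∀ z ∈ points (exceptionalLine i j),
        (∀ L ∈ linesOn dP5, z ∈ points L → L = exceptionalLine i j) →
        {w | (z, w) ∈ rootCover i j}.ncard = 25) ∧
    -- over each of these ten curves, the cover `C̃_∞` of degree 125 consists of five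
    -- disjoint copies of it
    (lineCover (wimanCurve φ₀ φ₁) =
      {p | ∃ (i j : Fin 5) (ζ : ℂ), i ≠ j ∧ ζ ^ 5 = 1 ∧ p ∈ sheet i j ζ}) ∧
    (∀ (i j : Fin 5) (ζ : ℂ), i ≠ j → ζ ^ 5 = 1 → IsIsomorphic (sheet i j ζ) fermatCurve) ∧
    (∀ (i j : Fin 5) (ζ ζ' : ℂ), i ≠ j → ζ ^ 5 = 1 → ζ' ^ 5 = 1 → ζ ≠ ζ' →
      Disjoint (sheet i j ζ) (sheet i j ζ')) ∧
    (∀ z ∈ wimanCurve φ₀ φ₁, (∃! L, L ∈ linesOn dP5 ∧ z ∈ points L) →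
      {P | (z, P) ∈ lineCover (wimanCurve φ₀ φ₁)}.ncard = 125) ∧
    -- the copies parametrize the fifty cones of lines on the Fermat quintic
    (∀ (i j : Fin 5) (ζ : ℂ), i ≠ j → ζ ^ 5 = 1 →
      parametrizedLines (sheet i j ζ) = cone i j ζ) ∧
    {K | ∃ (i j : Fin 5) (ζ : ℂ), i ≠ j ∧ ζ ^ 5 = 1 ∧ K = cone i j ζ}.ncard = 50 ∧
    parametrizedLines (lineCover (wimanCurve φ₀ φ₁)) =
      {L | ∃ (i j : Fin 5) (ζ : ℂ), i ≠ j ∧ ζ ^ 5 = 1 ∧ L ∈ cone i j ζ} ∧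
    parametrizedLines (lineCover (wimanCurve φ₀ φ₁)) = linesOn (dworkQuintic 0) := by
  have h0 : φ₀ = 0 := by simpa [ParameterRelation] using hψ
  have h1 : φ₁ ≠ 0 := fun h => hφ ⟨h0, h⟩
  subst h0
  refine ⟨rfl, linesOn_dP5, ncard_linesOn_dP5, ?_,
    fun i j h => ⟨rootCover_isIsomorphic h, image_fst_rootCover h,
      fun z hz hu => ncard_rootCover_fibre h hz hu⟩,
    lineCover_eq h1, fun i j ζ h _ => sheet_isIsomorphic h ζ,
    fun i j ζ ζ' h _ _ hne => disjoint_sheet h hne,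
    fun z hz hu => ncard_lineCover_fibre h1 hz hu,
    fun i j ζ h _ => parametrizedLines_sheet h ζ, ncard_cones, parametrizedLines_lineCover h1,
    (parametrizedLines_lineCover h1).trans linesOn_dworkQuintic_zero.symm⟩
  rw [wimanCurve_infinity h1, linesOn_dP5]
  ext z
  simp only [Set.mem_ofPred_eq, Set.mem_iUnion, exists_prop]
  constructor
  · rintro ⟨i, j, h, hz⟩
    exact ⟨_, ⟨i, j, h, rfl⟩, hz⟩
  · rintro ⟨_, ⟨i, j, h, rfl⟩, hz⟩
    exact ⟨i, j, h, hz⟩
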